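/- **Theorem 5.1.** Let $n\ge 1$, $1<p<\infty$, and let $\Omega\subset\mathbb R^n$ be open (not necessarily bounded). Let $m\in L^\infty(\mathbb R^n\times\mathbb R^n)$ satisfy: (H1) there are constants $0<m_-\le m_+<\infty$ with $m_-\le m(x,h)\le m_+$ for a.e. $(x,h)$; (H2) $m(x,h)=m(x-h,-h)$ for a.e. $(x,h)$; (H3) there is a function $a:\mathbb R^n\times\mathbb S^{n-1}\to\mathbb R$ such that, for a.e. $x$, $m(x,r\omega)=a(x,\omega)+O(r)$ as $r\downarrow0$, uniformly in $\omega\in\mathbb S^{n-1}$ (null sets of $\omega$ and $r$ being disregarded). Put $$\mathcal A(x,\xi)=\frac1p\int_{\mathbb S^{n-1}}a(x,\omega)\,|\xi\cdot\omega|^p\,d\mathcal H^{n-1}(\omega).$$ For $0<s<1$ let $W^{s,p}_0(\Omega)$ be the set of $u\in L^p(\mathbb R^n)$ with $\iint_{\mathbb R^n\times\mathbb R^n}\frac{|u(x)-u(x-h)|^p}{|h|^{n+sp}}\,dx\,dh<\infty$ and $u=0$ a.e. in $\mathbb R^n\setminus\Omega$; likewise let $W^{1,p}_0(\Omega)$ be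 the set of $u\in W^{1,p}(\mathbb R^n)$ with $u=0$ a.e. in $\mathbb R^n\setminus\Omega$ (this is the closure of $C^\infty_c(\Omega)$ in $W^{1,p}(\mathbb R^n)$ if, for instance, $\Omega$ has Lipschitz boundary). Identify functions on $\Omega$ with their extensions by $0$ to $\mathbb R^n$, and define $J_{m,s},J:L^p(\Omega)\to[0,\infty]$ by $$J_{m,s}(u)=\begin{cases}\displaystyle\frac{1-s}{p}\iint_{\mathbb R^n\times\mathbb R^n}m(x,h)\frac{|u(x)-u(x-h)|^p}{|h|^{n+sp}}\,dx\,dh & \text{if }u\in W^{s,p}_0(\Omega),\\ +\infty&\text{otherwise,}\end{cases}$$ $$J(u)=\begin{cases}\displaystyle\int_{\mathbb R^n}\mathcal A(x,\nabla u)\,dx & \text{if }u\in W^{1,p}_0(\Omega),\\ +\infty&\text{otherwise.}\end{cases}$$ Then $J_{m,s}$ $\Gamma$-converges to $\frac1p J$ in $L^p(\Omega)$ as $s\uparrow1$, that is, for every $u\in L^p(\Omega)$, $$\sup_{U}\ \liminf_{s\uparrow1}\ \inf_{v\in U}J_{m,s}(v)=\sup_{U}\ \limsup_{s\uparrow1}\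 \inf_{v\in U}J_{m,s}(v)=\frac1p J(u),$$ where $U$ ranges over the neighbourhoods of $u$ in $L^p(\Omega)$. -/

import Mathlib

open MeasureTheory Set Filter Topology
open scoped ENNReal

noncomputable section

/-! ### Gamma-convergence -/

section GammaConvergence

variable {ι X β : Type*} [TopologicalSpace X] [CompleteLattice β]

/-- The `Γ`-lower limit along the filter `l`: the supremum over the neighbourhoods `U` of `x` of
`liminf_i inf_{y ∈ U} F_i(y)`. -/
def gammaLiminf (l : Filter ι) (F : ι → X → β) (x : X) : β :=
  ⨆ U ∈ 𝓝 x, liminf (fun i => ⨅ y ∈ U, F i y) l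

/-- The `Γ`-upper limit along the filter `l`: the supremum over the neighbourhoods `U` of `x` of
`limsup_i inf_{y ∈ U} F_i(y)`. -/
def gammaLimsup (l : Filter ι) (F : ι → X → β) (x : X) : β :=
  ⨆ U ∈ 𝓝 x, limsup (fun i => ⨅ y ∈ U, F i y) l

/-- `F_i` `Γ`-converges to `F₀` along `l` in the topological space `X`: the `Γ`-lower limit and the
`Γ`-upper limit are both equal to `F₀` at every point. -/
def GammaTendsto (l : Filter ι) (F : ι → X → β) (F₀ : X → β) : Prop :=
  ∀ x, gammaLiminf l F x = F₀ x ∧ gammaLimsup l F x = F₀ x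

end GammaConvergence

/-- The Euclidean space `ℝⁿ`. -/
abbrev Eucl (n : ℕ) : Type := EuclideanSpace ℝ (Fin n)

/-- The unit sphere of `ℝⁿ`. -/
abbrev USphere (n : ℕ) : Type := Metric.sphere (0 : Eucl n) 1

/-- The surface measure of the unit sphere of `ℝⁿ`, normalized by the polar coordinates formula
`∫ f(h) dh = ∫_S ∫_0^∞ f(rω) r^(n-1) dr dω`, that is, the usual `(n-1)`-dimensional Hausdorff
measure, of total mass `n` times the volume of the unit ball. (The Hausdorff measures of Mathlib are
not normalized in this way.) -/
abbrev surfaceMeasure (n : ℕ) : Measure (USphere n) := (volume : Measure (Eucl n)).toSphere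

/-! ### Sobolev spaces -/

section Sobolev

variable {n : ℕ}

/-- The `p`-th power of the Gagliardo seminorm,
`[u]_{s,p}^p = ∬ |u(x) - u(x - h)|^p / |h|^(n + s p) dx dh`. -/
def gagliardoEnergy (s : ℝ) (p : ℝ≥0∞) (u : Eucl n → ℝ) : ℝ≥0∞ :=
  ∫⁻ z : Eucl n × Eucl n,
    ENNReal.ofReal (|u z.1 - u (z.1 - z.2)| ^ p.toReal / ‖z.2‖ ^ ((n : ℝ) + s * p.toReal))

/-- `u ∈ W^{s,p}(ℝⁿ)`. -/
def MemFracSobolev (s : ℝ) (p : ℝ≥0∞) (u : Eucl n → ℝ) : Prop :=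
  MemLp u p volume ∧ gagliardoEnergy s p u < ∞

/-- `u ∈ W₀^{s,p}(Ω)`: `u ∈ W^{s,p}(ℝⁿ)` and `u = 0` a.e. outside `Ω`. -/
def MemFracSobolevZero (Ω : Set (Eucl n)) (s : ℝ) (p : ℝ≥0∞) (u : Eucl n → ℝ) : Prop :=
  MemFracSobolev s p u ∧ ∀ᵐ x : Eucl n, x ∉ Ω → u x = 0

/-- `g` is the weak (distributional) gradient of `u` on `ℝⁿ`. -/
def HasWeakGradient (u : Eucl n → ℝ) (g : Eucl n → Eucl n) : Prop :=
  LocallyIntegrable u volume ∧ LocallyIntegrable g volume ∧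
    ∀ φ : Eucl n → ℝ, ContDiff ℝ ((⊤ : ℕ∞) : WithTop ℕ∞) φ → HasCompactSupport φ → ∀ v : Eucl n,
      ∫ x, u x * fderiv ℝ φ x v = - ∫ x, φ x * inner ℝ (g x) v

open Classical in
/-- The weak gradient `∇u` (unique up to null sets where it exists; `0` if there is none). -/
def weakGradient (u : Eucl n → ℝ) : Eucl n → Eucl n :=
  if h : ∃ g, HasWeakGradient u g then h.choose else 0

/-- `u ∈ W^{1,p}(ℝⁿ)`. -/
def MemSobolevOne (p : ℝ≥0∞) (u : Eucl n → ℝ) : Prop :=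
  MemLp u p volume ∧ ∃ g : Eucl n → Eucl n, HasWeakGradient u g ∧ MemLp g p volume

/-- `u ∈ W₀^{1,p}(Ω)`: `u ∈ W^{1,p}(ℝⁿ)` and `u = 0` a.e. outside `Ω`. -/
def MemSobolevOneZero (Ω : Set (Eucl n)) (p : ℝ≥0∞) (u : Eucl n → ℝ) : Prop :=
  MemSobolevOne p u ∧ ∀ᵐ x : Eucl n, x ∉ Ω → u x = 0

end Sobolev

/-! ### The kernel -/

section Kernel

variable {n : ℕ}

/-- `m₋ ≤ m(x,h) ≤ m₊` for (almost) all `(x,h)`, for some `0 < m₋ ≤ m₊ < ∞`. -/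
def KernelBounded (m : Eucl n → Eucl n → ℝ) : Prop :=
  ∃ mlow mupp : ℝ, 0 < mlow ∧ mlow ≤ mupp ∧
    ∀ᵐ z : Eucl n × Eucl n, mlow ≤ m z.1 z.2 ∧ m z.1 z.2 ≤ mupp

/-- `m(x,h) = m(x - h, -h)` for (almost) all `(x,h)`. -/
def KernelSymmetric (m : Eucl n → Eucl n → ℝ) : Prop :=
  ∀ᵐ z : Eucl n × Eucl n, m z.1 z.2 = m (z.1 - z.2) (-z.2)

/-- `m(x, rω) = a(x, ω) + O(r)` as `r ↓ 0`, uniformly in the direction `ω`. As `m` is an element of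
`L^∞`, null sets of `x`, of `ω` and of `r` are disregarded. -/
def KernelRadialLimit (m : Eucl n → Eucl n → ℝ) (a : Eucl n → USphere n → ℝ) : Prop :=
  ∀ᵐ x : Eucl n, ∃ C δ : ℝ, 0 < δ ∧
    ∀ᵐ ω : USphere n ∂(surfaceMeasure n), ∀ᵐ r : ℝ, 0 < r → r < δ →
      |m x (r • (ω : Eucl n)) - a x ω| ≤ C * r

/-- `𝒜(x,ξ) = (1/p) ∫_{S^{n-1}} a(x,ω) |ξ · ω|^p dω`. -/
def localDensity (a : Eucl n → USphere n → ℝ) (p : ℝ≥0∞) (x ξ : Eucl n) : ℝ :=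
  1 / p.toReal * ∫ ω : USphere n, a x ω * |inner ℝ ξ (ω : Eucl n)| ^ p.toReal ∂(surfaceMeasure n)

end Kernel

/-! ### The functionals on `L^p(Ω)`; a function on `Ω` is extended by `0` to `ℝⁿ` -/

section Functionals

variable {n : ℕ}

open Classical in
/-- The nonlocal functional `J_{m,s} : L^p(Ω) → [0,∞]`. -/
def nonlocalEnergy (m : Eucl n → Eucl n → ℝ) (Ω : Set (Eucl n)) (p : ℝ≥0∞) (s : ℝ)
    (u : Lp ℝ p (volume.restrict Ω)) : ℝ≥0∞ :=
  if MemFracSobolevZero Ω s p (Ω.indicator u) then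
    ENNReal.ofReal ((1 - s) / p.toReal) * ∫⁻ z : Eucl n × Eucl n,
      ENNReal.ofReal (m z.1 z.2 *
        (|Ω.indicator u z.1 - Ω.indicator u (z.1 - z.2)| ^ p.toReal /
          ‖z.2‖ ^ ((n : ℝ) + s * p.toReal)))
  else ∞

open Classical in
/-- The local functional `J : L^p(Ω) → [0,∞]`, `J(u) = ∫ 𝒜(x,∇u) dx` on `W₀^{1,p}(Ω)`. -/
def localEnergy (a : Eucl n → USphere n → ℝ) (Ω : Set (Eucl n)) (p : ℝ≥0∞)
    (u : Lp ℝ p (volume.restrict Ω)) : ℝ≥0∞ :=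
  if MemSobolevOneZero Ω p (Ω.indicator u) then
    ∫⁻ x : Eucl n, ENNReal.ofReal (localDensity a p x (weakGradient (Ω.indicator u) x))
  else ∞

end Functionals

end

/-! ### Polar coordinates and the radial measures -/

section Polar

variable {n : ℕ}

theorem lintegral_polar [NeZero n] {f : Eucl n → ℝ≥0∞} (hf : Measurable f) :
    ∫⁻ x, f x = ∫⁻ ω, ∫⁻ r in Ioi (0 : ℝ), ENNReal.ofReal (r ^ (n - 1)) * f (r • (ω : Eucl n))
      ∂(volume : Measure ℝ) ∂(surfaceMeasure n) := by
  have hmp := (volume : Measure (Eucl n)).measurePreserving_homeomorphUnitSphereProd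
  have hd : Module.finrank ℝ (Eucl n) = n := by simp
  rw [hd] at hmp
  have hn0 : 0 < n := Nat.pos_of_ne_zero (NeZero.ne n)
  have : Nontrivial (Eucl n) := Module.nontrivial_of_finrank_pos (R := ℝ) (by rw [hd]; exact hn0)
  have hsm : Measurable fun p : USphere n × Ioi (0 : ℝ) => f (p.2.1 • (p.1 : Eucl n)) :=
    hf.comp (by fun_prop)
  calc ∫⁻ x, f x = ∫⁻ x in ({(0 : Eucl n)}ᶜ : Set (Eucl n)), f x := by
        rw [restrict_compl_singleton]
    _ = ∫⁻ x : ({(0 : Eucl n)}ᶜ : Set (Eucl n)), f x ∂(volume.comap Subtype.val) := by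
        rw [lintegral_subtype_comap (measurableSet_singleton _).compl]
    _ = ∫⁻ x : ({(0 : Eucl n)}ᶜ : Set (Eucl n)),
          (fun p : USphere n × Ioi (0 : ℝ) => f (p.2.1 • (p.1 : Eucl n)))
            (homeomorphUnitSphereProd (Eucl n) x) ∂(volume.comap Subtype.val) := by
        refine lintegral_congr fun x => ?_
        have : ‖(x : Eucl n)‖ ≠ 0 := norm_ne_zero_iff.2 x.2
        simp [smul_smul, this]
    _ = ∫⁻ p, f (p.2.1 • (p.1 : Eucl n)) ∂((surfaceMeasure n).prod (.volumeIoiPow (n - 1))) :=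
        hmp.lintegral_comp hsm
    _ = ∫⁻ ω, ∫⁻ r : Ioi (0 : ℝ), f (r.1 • (ω : Eucl n)) ∂(.volumeIoiPow (n - 1))
          ∂(surfaceMeasure n) := lintegral_prod _ hsm.aemeasurable
    _ = _ := by
        refine lintegral_congr fun ω => ?_
        have hm1 : Measurable fun r : ℝ => f (r • (ω : Eucl n)) := hf.comp (by fun_prop)
        have hm2 : Measurable fun r : Ioi (0 : ℝ) => f (r.1 • (ω : Eucl n)) :=
          hm1.comp measurable_subtype_coe
        rw [Measure.volumeIoiPow, lintegral_withDensity_eq_lintegral_mul _ (by fun_prop) hm2]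
        exact lintegral_subtype_comap measurableSet_Ioi
          fun r : ℝ => ENNReal.ofReal (r ^ (n - 1)) * f (r • (ω : Eucl n))

theorem volume_eq_zero_iff_polar [NeZero n] {A : Set (Eucl n)} (hA : MeasurableSet A) :
    (volume : Measure (Eucl n)) A = 0 ↔
      ∀ᵐ ω : USphere n ∂(surfaceMeasure n), ∀ᵐ r : ℝ, 0 < r → r • (ω : Eucl n) ∉ A := by
  have hsm : Measurable fun p : USphere n × ℝ =>
      ENNReal.ofReal (p.2 ^ (n - 1)) * A.indicator (1 : Eucl n → ℝ≥0∞) (p.2 • (p.1 : Eucl n)) :=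
    Measurable.mul (by fun_prop) ((measurable_one.indicator hA).comp (by fun_prop))
  rw [← lintegral_indicator_one hA, lintegral_polar (measurable_one.indicator hA),
    lintegral_eq_zero_iff hsm.lintegral_prod_right']
  refine eventually_congr (Eventually.of_forall fun ω => ?_)
  have hsr : Measurable fun r : ℝ => ENNReal.ofReal (r ^ (n - 1)) *
      A.indicator (1 : Eucl n → ℝ≥0∞) (r • (ω : Eucl n)) := hsm.comp measurable_prodMk_left
  rw [Pi.zero_apply]
  change (∫⁻ r in Ioi (0 : ℝ), ENNReal.ofReal (r ^ (n - 1)) *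
    A.indicator (1 : Eucl n → ℝ≥0∞) (r • (ω : Eucl n))) = 0 ↔ _
  rw [lintegral_eq_zero_iff hsr, Filter.EventuallyEq,
    ae_restrict_iff' measurableSet_Ioi]
  refine eventually_congr (Eventually.of_forall fun r => ?_)
  refine forall_congr' fun hr => ?_
  have hr' : 0 < r := hr
  by_cases h : r • (ω : Eucl n) ∈ A <;> simp [h, hr']

theorem ae_polar_of_ae [NeZero n] {P : Eucl n → Prop} (h : ∀ᵐ x, P x) :
    ∀ᵐ ω : USphere n ∂(surfaceMeasure n), ∀ᵐ r : ℝ, 0 < r → P (r • (ω : Eucl n)) := by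
  have h0 : (volume : Measure (Eucl n)) (toMeasurable volume {x : Eucl n | ¬ P x}) = 0 := by
    rw [measure_toMeasurable]; exact h
  have := (volume_eq_zero_iff_polar (measurableSet_toMeasurable _ _)).1 h0
  filter_upwards [this] with ω hω
  filter_upwards [hω] with r hr h0
  by_contra hP
  exact hr h0 (subset_toMeasurable _ _ hP)

/-- The direction `h / ‖h‖`, with an arbitrary value at `0`. -/
noncomputable def dir [NeZero n] (h : Eucl n) : USphere n :=
  ⟨if h = 0 then EuclideanSpace.single 0 1 else ‖h‖⁻¹ • h, by
    split_ifs with h0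
    · simp
    · simp [norm_smul, h0]⟩

theorem dir_coe [NeZero n] {h : Eucl n} (h0 : h ≠ 0) : (dir h : Eucl n) = ‖h‖⁻¹ • h := by
  simp [dir, h0]

theorem dir_smul [NeZero n] {r : ℝ} (hr : 0 < r) (ω : USphere n) : dir (r • (ω : Eucl n)) = ω := by
  have hω : ‖(ω : Eucl n)‖ = 1 := by simp
  have h0 : r • (ω : Eucl n) ≠ 0 := by
    rw [← norm_ne_zero_iff, norm_smul, hω]; simp [hr.ne']
  apply Subtype.ext
  rw [dir_coe h0, norm_smul, hω, smul_smul]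
  simp [abs_of_pos hr, hr.ne']

theorem measurable_dir [NeZero n] : Measurable (dir : Eucl n → USphere n) := by
  refine Measurable.subtype_mk ?_
  exact Measurable.ite (measurableSet_singleton 0) measurable_const (by fun_prop)

/-- The measure `t ‖h‖^(t-n) dh` on the unit ball. -/
noncomputable def radialMeasure (n : ℕ) (t : ℝ) : Measure (Eucl n) :=
  (volume.restrict (Metric.ball 0 1)).withDensity fun h => ENNReal.ofReal (t * ‖h‖ ^ (t - n))

theorem radialMeasure_ac (t : ℝ) : radialMeasure n t ≪ volume :=
  (withDensity_absolutelyContinuous _ _).trans Measure.restrict_le_self.absolutelyContinuous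

theorem lintegral_radialMeasure {t : ℝ} {f : Eucl n → ℝ≥0∞} (hf : Measurable f) :
    ∫⁻ h, f h ∂(radialMeasure n t) =
      ∫⁻ h in Metric.ball 0 1, ENNReal.ofReal (t * ‖h‖ ^ (t - n)) * f h := by
  rw [radialMeasure, lintegral_withDensity_eq_lintegral_mul _ (by fun_prop) hf]
  rfl

theorem lintegral_radialMeasure_polar [NeZero n] {t : ℝ} {f : Eucl n → ℝ≥0∞}
    (hf : Measurable f) :
    ∫⁻ h, f h ∂(radialMeasure n t) =
      ∫⁻ ω, ∫⁻ r in Ioo (0 : ℝ) 1, ENNReal.ofReal (t * r ^ (t - 1)) * f (r • (ω : Eucl n))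
      ∂(volume : Measure ℝ) ∂(surfaceMeasure n) := by
  have hn0 : 1 ≤ n := Nat.one_le_iff_ne_zero.2 (NeZero.ne n)
  have hm : Measurable fun h : Eucl n => ENNReal.ofReal (t * ‖h‖ ^ (t - n)) * f h :=
    Measurable.mul (by fun_prop) hf
  rw [lintegral_radialMeasure hf, ← lintegral_indicator Metric.isOpen_ball.measurableSet,
    lintegral_polar (hm.indicator Metric.isOpen_ball.measurableSet)]
  refine lintegral_congr fun ω => ?_
  rw [← lintegral_indicator measurableSet_Ioi, ← lintegral_indicator measurableSet_Ioo]
  refine lintegral_congr fun r => ?_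
  by_cases h0 : 0 < r
  · have hω : ‖r • (ω : Eucl n)‖ = r := by simp [norm_smul, abs_of_pos h0]
    by_cases h1 : r < 1
    · have hb : r • (ω : Eucl n) ∈ Metric.ball (0 : Eucl n) 1 := by
        rw [mem_ball_zero_iff, hω]; exact h1
      rw [indicator_of_mem (show r ∈ Ioi 0 from h0), indicator_of_mem hb,
        indicator_of_mem (show r ∈ Ioo 0 1 from ⟨h0, h1⟩), hω, ← mul_assoc,
        ← ENNReal.ofReal_mul (by positivity)]
      congr 2
      rw [mul_left_comm, ← Real.rpow_natCast, ← Real.rpow_add h0, Nat.cast_sub hn0]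
      congr 2
      push_cast
      ring
    · have hb : r • (ω : Eucl n) ∉ Metric.ball (0 : Eucl n) 1 := by
        rw [mem_ball_zero_iff, hω]; exact h1
      rw [indicator_of_mem (show r ∈ Ioi 0 from h0), indicator_of_notMem hb,
        indicator_of_notMem (fun h => h1 h.2), mul_zero]
  · rw [indicator_of_notMem (show r ∉ Ioi 0 from h0), indicator_of_notMem (fun h => h0 h.1)]

theorem lintegral_rpow_Ioo {t : ℝ} (ht : 0 < t) :
    ∫⁻ r in Ioo (0 : ℝ) 1, ENNReal.ofReal (t * r ^ (t - 1)) = 1 := by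
  have hi : IntervalIntegrable (fun r : ℝ => t * r ^ (t - 1)) volume 0 1 :=
    (intervalIntegral.intervalIntegrable_rpow' (by linarith)).const_mul t
  rw [intervalIntegrable_iff_integrableOn_Ioo_of_le zero_le_one] at hi
  rw [← ofReal_integral_eq_lintegral_ofReal hi
    ((ae_restrict_mem measurableSet_Ioo).mono fun r hr => by
      have := hr.1
      simp only [Pi.zero_apply]
      positivity), ← integral_Ioc_eq_integral_Ioo, ← intervalIntegral.integral_of_le zero_le_one,
    intervalIntegral.integral_const_mul, integral_rpow (Or.inl (by linarith))]
  simp [ht.ne']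

theorem measurePreserving_dir [NeZero n] {t : ℝ} (ht : 0 < t) :
    MeasurePreserving dir (radialMeasure n t) (surfaceMeasure n) := by
  refine ⟨measurable_dir, Measure.ext fun B hB => ?_⟩
  have hm : Measurable fun h : Eucl n => B.indicator (1 : USphere n → ℝ≥0∞) (dir h) :=
    (measurable_one.indicator hB).comp measurable_dir
  rw [← lintegral_indicator_one hB, lintegral_map (measurable_one.indicator hB) measurable_dir,
    lintegral_radialMeasure_polar hm, ← lintegral_indicator_one hB]
  refine lintegral_congr fun ω => ?_
  rw [← one_mul (B.indicator 1 ω), ← lintegral_rpow_Ioo ht, ← lintegral_mul_const _ (by fun_prop)]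
  refine setLIntegral_congr_fun measurableSet_Ioo fun r hr => ?_
  simp only [dir_smul hr.1]

theorem radialMeasure_univ [NeZero n] {t : ℝ} (ht : 0 < t) :
    radialMeasure n t univ = surfaceMeasure n univ := by
  rw [← (measurePreserving_dir ht).map_eq, Measure.map_apply measurable_dir .univ, preimage_univ]

theorem isFiniteMeasure_radialMeasure [NeZero n] {t : ℝ} (ht : 0 < t) :
    IsFiniteMeasure (radialMeasure n t) :=
  ⟨by rw [radialMeasure_univ ht]; exact measure_lt_top _ _⟩

instance sfinite_radialMeasure (t : ℝ) : SFinite (radialMeasure n t) := by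
  unfold radialMeasure; infer_instance

theorem lintegral_norm_radialMeasure_le [NeZero n] {t : ℝ} (ht : 0 < t) :
    ∫⁻ h, ENNReal.ofReal ‖h‖ ∂(radialMeasure n t) ≤ ENNReal.ofReal t * surfaceMeasure n univ := by
  rw [lintegral_radialMeasure_polar (by fun_prop), ← lintegral_const]
  refine lintegral_mono fun ω => ?_
  calc ∫⁻ r in Ioo (0 : ℝ) 1, ENNReal.ofReal (t * r ^ (t - 1)) *
        ENNReal.ofReal ‖r • (ω : Eucl n)‖
      ≤ ∫⁻ r in Ioo (0 : ℝ) 1, ENNReal.ofReal t := by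
        refine setLIntegral_mono measurable_const fun r hr => ?_
        have h0 := hr.1
        rw [← ENNReal.ofReal_mul (by positivity)]
        refine ENNReal.ofReal_le_ofReal ?_
        have hω : ‖r • (ω : Eucl n)‖ = r := by simp [norm_smul, abs_of_pos h0]
        rw [hω, mul_assoc, ← Real.rpow_add_one h0.ne', sub_add_cancel]
        exact mul_le_of_le_one_right ht.le (Real.rpow_le_one h0.le hr.2.le ht.le)
    _ = ENNReal.ofReal t := by simp

theorem ae_radialMeasure_norm_pos_lt [NeZero n] (t : ℝ) :
    ∀ᵐ h ∂(radialMeasure n t), h ≠ 0 ∧ ‖h‖ < 1 := by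
  have h1 : ∀ᵐ h ∂(volume.restrict (Metric.ball (0 : Eucl n) 1)), h ≠ 0 ∧ ‖h‖ < 1 := by
    have : Nontrivial (Eucl n) := Module.nontrivial_of_finrank_pos (R := ℝ)
      (by simpa using Nat.pos_of_ne_zero (NeZero.ne n))
    filter_upwards [ae_restrict_mem Metric.isOpen_ball.measurableSet,
      ae_restrict_of_ae (Measure.ae_ne volume 0)] with h hh h0
    exact ⟨h0, mem_ball_zero_iff.1 hh⟩
  exact (withDensity_absolutelyContinuous _ _).ae_le h1

/-- The measures `radialMeasure n t` concentrate at the origin as `t ↓ 0`. -/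
theorem tendsto_lintegral_radialMeasure_zero [NeZero n] {ι : Type*} {l : Filter ι} {t : ι → ℝ}
    (ht : Tendsto t l (𝓝[>] 0)) {f : Eucl n → ℝ≥0∞} {M : ℝ≥0∞} (hM : M ≠ ∞)
    (hfM : ∀ h, f h ≤ M) (hf : Tendsto f (𝓝 0) (𝓝 0)) :
    Tendsto (fun i => ∫⁻ h, f h ∂(radialMeasure n (t i))) l (𝓝 0) := by
  have hS : surfaceMeasure n univ ≠ ∞ := measure_ne_top _ _
  have ht0 : Tendsto t l (𝓝 0) := ht.mono_right nhdsWithin_le_nhds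
  have htpos : ∀ᶠ i in l, 0 < t i := ht.eventually self_mem_nhdsWithin
  rw [ENNReal.tendsto_nhds_zero]
  intro ε hε
  obtain ⟨ε₁, hε₁, hε₁S⟩ : ∃ ε₁ : ℝ≥0∞, 0 < ε₁ ∧ ε₁ * surfaceMeasure n univ ≤ ε / 2 := by
    refine ⟨ε / 2 / (surfaceMeasure n univ + 1), ?_, ?_⟩
    · exact ENNReal.div_pos (ENNReal.half_pos hε.ne').ne' (ENNReal.add_ne_top.2 ⟨hS, ENNReal.one_ne_top⟩)
    · calc _ ≤ ε / 2 / (surfaceMeasure n univ + 1) * (surfaceMeasure n univ + 1) := by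
            gcongr; exact le_self_add
        _ ≤ ε / 2 := (ENNReal.le_div_iff_mul_le (by simp) (Or.inl (ENNReal.add_ne_top.2 ⟨hS, ENNReal.one_ne_top⟩)))
            |>.1 le_rfl
  obtain ⟨δ, hδ, hδf⟩ := Metric.eventually_nhds_iff.1 (ENNReal.tendsto_nhds_zero.1 hf ε₁ hε₁)
  have hbound : ∀ h, f h ≤ ε₁ + M * ENNReal.ofReal δ⁻¹ * ENNReal.ofReal ‖h‖ := by
    intro h
    by_cases hh : ‖h‖ < δ
    · exact (hδf (by simpa using hh)).trans le_self_add
    · refine (hfM h).trans (le_trans ?_ le_add_self)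
      rw [mul_assoc, ← ENNReal.ofReal_mul (by positivity)]
      refine le_mul_of_one_le_right zero_le (ENNReal.one_le_ofReal.2 ?_)
      rw [inv_mul_eq_div, one_le_div hδ]
      exact not_lt.1 hh
  have hlim : Tendsto (fun i => M * ENNReal.ofReal δ⁻¹ *
      (ENNReal.ofReal (t i) * surfaceMeasure n univ)) l (𝓝 0) := by
    have h1 : Tendsto (fun i => ENNReal.ofReal (t i)) l (𝓝 0) := by
      simpa using ENNReal.tendsto_ofReal ht0
    have h2 := ENNReal.Tendsto.mul_const h1 (b := surfaceMeasure n univ) (Or.inr hS)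
    simpa using ENNReal.Tendsto.const_mul h2 (a := M * ENNReal.ofReal δ⁻¹)
      (Or.inr (ENNReal.mul_ne_top hM ENNReal.ofReal_ne_top))
  filter_upwards [htpos, ENNReal.tendsto_nhds_zero.1 hlim _ (ENNReal.half_pos hε.ne')] with i hi hi2
  calc ∫⁻ h, f h ∂(radialMeasure n (t i))
      ≤ ∫⁻ h, (ε₁ + M * ENNReal.ofReal δ⁻¹ * ENNReal.ofReal ‖h‖) ∂(radialMeasure n (t i)) :=
        lintegral_mono hbound
    _ = ε₁ * surfaceMeasure n univ + M * ENNReal.ofReal δ⁻¹ *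
        ∫⁻ h, ENNReal.ofReal ‖h‖ ∂(radialMeasure n (t i)) := by
        rw [lintegral_add_left measurable_const, lintegral_const, radialMeasure_univ hi,
          lintegral_const_mul _ (by fun_prop)]
    _ ≤ ε / 2 + ε / 2 := by
        refine add_le_add hε₁S (le_trans ?_ hi2)
        gcongr
        exact lintegral_norm_radialMeasure_le hi
    _ = ε := ENNReal.add_halves ε

end Polar

/-! ### Measurable versions of the kernel and of its radial limit -/

section Kernels

variable {n : ℕ}

/-- A kernel `m` and a radial limit `a` that are jointly measurable, are bounded above and away
from zero, and satisfy `m(x,h) = a(x, h / |h|) + O(|h|)` as `h → 0` for almost every `x`. -/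
structure IsRegularKernel [NeZero n] (m : Eucl n × Eucl n → ℝ) (a : Eucl n × USphere n → ℝ)
    (lo up : ℝ) : Prop where
  lo_pos : 0 < lo
  measurable_m : Measurable m
  measurable_a : Measurable a
  lo_le_m : ∀ z, lo ≤ m z
  m_le_up : ∀ z, m z ≤ up
  lo_le_a : ∀ z, lo ≤ a z
  a_le_up : ∀ z, a z ≤ up
  radial : ∀ᵐ x, ∃ C : ℝ, ∀ᵐ h, |m (x, h) - a (x, dir h)| ≤ C * ‖h‖

/-- The average of `f` over `(0, 1 / (k + 1))`. -/
noncomputable def initialAverage (k : ℕ) (f : ℝ → ℝ) : ℝ :=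
  ((k : ℝ) + 1) * ∫ r in Ioo (0 : ℝ) (((k : ℝ) + 1)⁻¹), f r

theorem abs_initialAverage_sub_le {f : ℝ → ℝ} {lo up c C δ : ℝ} (hf : Measurable f)
    (hlo : ∀ r, lo ≤ f r) (hup : ∀ r, f r ≤ up)
    (h : ∀ᵐ r : ℝ, 0 < r → r < δ → |f r - c| ≤ C * r) {k : ℕ} (hk : ((k : ℝ) + 1)⁻¹ < δ) :
    |initialAverage k f - c| ≤ |C| * ((k : ℝ) + 1)⁻¹ := by
  have hk0 : (0 : ℝ) < (k : ℝ) + 1 := by positivity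
  set b : ℝ := ((k : ℝ) + 1)⁻¹ with hb
  have hb0 : 0 < b := by positivity
  have hfi : IntegrableOn f (Ioo 0 b) := by
    refine Measure.integrableOn_of_bounded (M := max |lo| |up|) (by simp) hf.aestronglyMeasurable ?_
    exact Eventually.of_forall fun r => abs_le_max_abs_abs (hlo r) (hup r)
  have h1 : initialAverage k f - c = ((k : ℝ) + 1) * ∫ r in Ioo (0 : ℝ) b, (f r - c) := by
    rw [integral_sub hfi (by simp), initialAverage, mul_sub]
    simp only [integral_const, smul_eq_mul, measureReal_restrict_apply, MeasurableSet.univ,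
      univ_inter, Real.volume_real_Ioo_of_le hb0.le, sub_zero]
    rw [← mul_assoc, hb, mul_inv_cancel₀ hk0.ne', one_mul]
  have h2 : ‖∫ r in Ioo (0 : ℝ) b, (f r - c)‖ ≤ |C| * b * (volume.real (Ioo (0 : ℝ) b)) := by
    refine norm_setIntegral_le_of_norm_le_const_ae' (by simp) ?_
    filter_upwards [h] with r hr hrb
    refine (hr hrb.1 (hrb.2.trans hk)).trans ?_
    exact mul_le_mul (le_abs_self C) hrb.2.le hrb.1.le (abs_nonneg C)
  rw [h1, abs_mul, abs_of_pos hk0]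
  rw [Real.norm_eq_abs, Real.volume_real_Ioo_of_le hb0.le, sub_zero] at h2
  calc ((k : ℝ) + 1) * |∫ r in Ioo (0 : ℝ) b, (f r - c)|
      ≤ ((k : ℝ) + 1) * (|C| * b * b) := by gcongr
    _ = |C| * b := by rw [hb]; field_simp

theorem tendsto_initialAverage {f : ℝ → ℝ} {lo up c C δ : ℝ} (hf : Measurable f)
    (hlo : ∀ r, lo ≤ f r) (hup : ∀ r, f r ≤ up) (hδ : 0 < δ)
    (h : ∀ᵐ r : ℝ, 0 < r → r < δ → |f r - c| ≤ C * r) :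
    Tendsto (fun k => initialAverage k f) atTop (𝓝 c) := by
  have h0 : Tendsto (fun k : ℕ => ((k : ℝ) + 1)⁻¹) atTop (𝓝 0) := by
    simpa using tendsto_one_div_add_atTop_nhds_zero_nat (𝕜 := ℝ)
  rw [tendsto_iff_norm_sub_tendsto_zero]
  refine squeeze_zero' (Eventually.of_forall fun _ => norm_nonneg _) ?_
    (by simpa using h0.const_mul |C|)
  filter_upwards [h0.eventually_lt_const hδ] with k hk
  exact abs_initialAverage_sub_le hf hlo hup h hk

theorem mem_Icc_of_ae_abs_sub_le {f : ℝ → ℝ} {lo up c C δ : ℝ}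
    (hlo : ∀ r, lo ≤ f r) (hup : ∀ r, f r ≤ up) (hδ : 0 < δ)
    (h : ∀ᵐ r : ℝ, 0 < r → r < δ → |f r - c| ≤ C * r) : lo ≤ c ∧ c ≤ up := by
  have key : ∀ ε > 0, ∃ r, |f r - c| ≤ ε := by
    intro ε hε
    have hpos : 0 < min δ (ε / (|C| + 1)) := by positivity
    have hne : ¬ ∀ᵐ r : ℝ, r ∉ Ioo 0 (min δ (ε / (|C| + 1))) := by
      rw [ae_iff]
      simp only [not_not]
      change volume (Ioo 0 (min δ (ε / (|C| + 1)))) ≠ 0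
      simp only [Real.volume_Ioo, ne_eq, ENNReal.ofReal_eq_zero, not_le]
      linarith
    by_contra! hcon
    refine hne ?_
    filter_upwards [h] with r hr hr2
    have h1 := hr hr2.1 (hr2.2.trans_le (min_le_left _ _))
    have h2 := hr2.2.trans_le (min_le_right _ _)
    rw [lt_div_iff₀ (by positivity)] at h2
    have h3 := hcon r
    nlinarith [le_abs_self C, hr2.1, mul_le_mul_of_nonneg_right (le_abs_self C) hr2.1.le]
  refine ⟨le_of_forall_pos_le_add fun ε hε => ?_, le_of_forall_pos_le_add fun ε hε => ?_⟩
  · obtain ⟨r, hr⟩ := key ε hε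
    linarith [hlo r, (abs_le.1 hr).2]
  · obtain ⟨r, hr⟩ := key ε hε
    linarith [hup r, (abs_le.1 hr).1]

theorem exists_isRegularKernel [NeZero n] {m : Eucl n → Eucl n → ℝ} {a : Eucl n → USphere n → ℝ}
    (hm : AEStronglyMeasurable (fun z : Eucl n × Eucl n => m z.1 z.2) volume)
    (hm1 : KernelBounded m) (hm3 : KernelRadialLimit m a) :
    ∃ (m' : Eucl n × Eucl n → ℝ) (a' : Eucl n × USphere n → ℝ) (lo up : ℝ),
      IsRegularKernel m' a' lo up ∧ (∀ᵐ z : Eucl n × Eucl n, m z.1 z.2 = m' z) ∧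
      ∀ᵐ x, ∀ᵐ ω ∂(surfaceMeasure n), a x ω = a' (x, ω) := by
  obtain ⟨lo, up, hlo, hlu, hb⟩ := hm1
  set m' : Eucl n × Eucl n → ℝ := fun z => max lo (min up (hm.mk _ z)) with hm'
  have hm'm : Measurable m' := by
    have := hm.stronglyMeasurable_mk.measurable
    exact measurable_const.max (measurable_const.min this)
  have hm'lo : ∀ z, lo ≤ m' z := fun z => le_max_left _ _
  have hm'up : ∀ z, m' z ≤ up := fun z => max_le hlu (min_le_left _ _)
  have hmm' : ∀ᵐ z : Eucl n × Eucl n, m z.1 z.2 = m' z := by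
    filter_upwards [hm.ae_eq_mk, hb] with z hz hbz
    simp only [hm']
    rw [← hz, min_eq_right hbz.2, max_eq_right hbz.1]
  have hline : ∀ x ω, Measurable fun r : ℝ => m' (x, r • ((ω : USphere n) : Eucl n)) :=
    fun x ω => hm'm.comp (by fun_prop)
  set avg : ℕ → Eucl n × USphere n → ℝ := fun k z =>
    initialAverage k fun r => m' (z.1, r • (z.2 : Eucl n)) with havg
  have havgm : ∀ k, Measurable (avg k) := by
    intro k
    refine Measurable.const_mul ?_ _
    have h1 : Measurable fun q : (Eucl n × USphere n) × ℝ => m' (q.1.1, q.2 • (q.1.2 : Eucl n)) :=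
      hm'm.comp (by fun_prop)
    exact (h1.stronglyMeasurable.integral_prod_right'
      (ν := volume.restrict (Ioo (0 : ℝ) (((k : ℝ) + 1)⁻¹)))).measurable
  set a' : Eucl n × USphere n → ℝ := fun z =>
    max lo (min up (limsup (fun k => avg k z) atTop)) with ha'
  have ha'm : Measurable a' := measurable_const.max (measurable_const.min (.limsup havgm))
  have ha'lo : ∀ z, lo ≤ a' z := fun z => le_max_left _ _
  have ha'up : ∀ z, a' z ≤ up := fun z => max_le hlu (min_le_left _ _)
  have hdata : ∀ᵐ x, ∃ C δ : ℝ, 0 < δ ∧ ∀ᵐ ω : USphere n ∂(surfaceMeasure n), ∀ᵐ r : ℝ,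
      0 < r → r < δ → |m' (x, r • (ω : Eucl n)) - a x ω| ≤ C * r := by
    have h1 : ∀ᵐ x : Eucl n, ∀ᵐ h : Eucl n, m x h = m' (x, h) := Measure.ae_ae_of_ae_prod hmm'
    filter_upwards [h1, hm3] with x hx1 hx3
    obtain ⟨C, δ, hδ, hx3⟩ := hx3
    refine ⟨C, δ, hδ, ?_⟩
    filter_upwards [ae_polar_of_ae hx1, hx3] with ω hω1 hω3
    filter_upwards [hω1, hω3] with r hr1 hr3 h0 hrδ
    rw [← hr1 h0]
    exact hr3 h0 hrδ
  have haa' : ∀ {x : Eucl n} {ω : USphere n} {C δ : ℝ}, 0 < δ →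
      (∀ᵐ r : ℝ, 0 < r → r < δ → |m' (x, r • (ω : Eucl n)) - a x ω| ≤ C * r) →
      a x ω = a' (x, ω) := by
    intro x ω C δ hδ h
    have hl := tendsto_initialAverage (hline x ω) (fun _ => hm'lo _) (fun _ => hm'up _) hδ h
    have hI := mem_Icc_of_ae_abs_sub_le (fun _ => hm'lo _) (fun _ => hm'up _) hδ h
    simp only [ha', havg]
    rw [hl.limsup_eq, min_eq_right hI.2, max_eq_right hI.1]
  refine ⟨m', a', lo, up, ⟨hlo, hm'm, ha'm, hm'lo, hm'up, ha'lo, ha'up, ?_⟩, hmm', ?_⟩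
  · filter_upwards [hdata] with x hx
    obtain ⟨C, δ, hδ, hx⟩ := hx
    refine ⟨|C| + (up - lo) / δ, ?_⟩
    have hA : MeasurableSet {h : Eucl n |
        ¬ |m' (x, h) - a' (x, dir h)| ≤ (|C| + (up - lo) / δ) * ‖h‖} := by
      refine (measurableSet_le (f := fun h : Eucl n => |m' (x, h) - a' (x, dir h)|) ?_
        (by fun_prop)).compl
      have h1 : Measurable fun h : Eucl n => m' (x, h) := hm'm.comp measurable_prodMk_left
      have h2 : Measurable fun h : Eucl n => a' (x, dir h) :=
        ha'm.comp (measurable_const.prodMk measurable_dir)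
      exact (h1.sub h2).abs
    rw [ae_iff, volume_eq_zero_iff_polar hA]
    filter_upwards [hx] with ω hω
    have haω := haa' hδ hω
    filter_upwards [hω] with r hr h0
    have hω1 : ‖r • (ω : Eucl n)‖ = r := by simp [norm_smul, abs_of_pos h0]
    simp only [not_not]
    rw [dir_smul h0, hω1, add_mul]
    have hul : 0 ≤ (up - lo) / δ * r := by
      have : 0 ≤ up - lo := by linarith
      positivity
    by_cases hrδ : r < δ
    · rw [← haω]
      have h1 := hr h0 hrδ
      have h2 := mul_le_mul_of_nonneg_right (le_abs_self C) h0.le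
      linarith
    · have h1 : |m' (x, r • (ω : Eucl n)) - a' (x, ω)| ≤ up - lo := by
        rw [abs_le]
        constructor <;> linarith [hm'lo (x, r • (ω : Eucl n)), hm'up (x, r • (ω : Eucl n)),
          ha'lo (x, ω), ha'up (x, ω)]
      have h2 : up - lo ≤ (up - lo) / δ * r := by
        rw [div_mul_eq_mul_div, le_div_iff₀ hδ]
        exact mul_le_mul_of_nonneg_left (not_lt.1 hrδ) (by linarith)
      have h3 : 0 ≤ |C| * r := by positivity
      linarith
  · filter_upwards [hdata] with x hx
    obtain ⟨C, δ, hδ, hx⟩ := hx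
    filter_upwards [hx] with ω hω
    exact haa' hδ hω

end Kernels

/-! ### Difference quotients and the decomposition of the nonlocal energy -/

section Decomposition

variable {n : ℕ}

/-- The difference quotient `(u(x) - u(x - h)) / |h|`. -/
noncomputable def diffQuot (u : Eucl n → ℝ) (z : Eucl n × Eucl n) : ℝ :=
  (u z.1 - u (z.1 - z.2)) / ‖z.2‖

/-- The measure `dx ⊗ t |h|^(t-n) dh` on `ℝⁿ × B₁`. -/
noncomputable def pairMeasure (n : ℕ) (t : ℝ) : Measure (Eucl n × Eucl n) :=
  (volume : Measure (Eucl n)).prod (radialMeasure n t)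

theorem measurable_diffQuot {u : Eucl n → ℝ} (hu : Measurable u) : Measurable (diffQuot u) := by
  unfold diffQuot
  fun_prop

theorem lintegral_pairMeasure {t : ℝ} {f : Eucl n × Eucl n → ℝ≥0∞} (hf : Measurable f) :
    ∫⁻ z, f z ∂(pairMeasure n t) = ∫⁻ x, ∫⁻ h, f (x, h) ∂(radialMeasure n t) :=
  lintegral_prod _ hf.aemeasurable

theorem measurable_energyDensity {u : Eucl n → ℝ} (hu : Measurable u) {κ : Eucl n × Eucl n → ℝ}
    (hκ : Measurable κ) (P β : ℝ) : Measurable fun z : Eucl n × Eucl n =>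
      ENNReal.ofReal (κ z * (|u z.1 - u (z.1 - z.2)| ^ P / ‖z.2‖ ^ β)) := by
  fun_prop

theorem lintegral_ball_energyDensity [NeZero n] {u : Eucl n → ℝ} (hu : Measurable u)
    {κ : Eucl n × Eucl n → ℝ} (hκ : Measurable κ)
    {P s t : ℝ} (ht : 0 < t) (hts : t = P * (1 - s)) :
    ∫⁻ x, ∫⁻ h in Metric.ball 0 1, ENNReal.ofReal
        (κ (x, h) * (|u x - u (x - h)| ^ P / ‖h‖ ^ ((n : ℝ) + s * P))) =
      ENNReal.ofReal t⁻¹ *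
        ∫⁻ z, ENNReal.ofReal (κ z * |diffQuot u z| ^ P) ∂(pairMeasure n t) := by
  have hV := measurable_diffQuot hu
  have hm1 : Measurable fun z => ENNReal.ofReal (κ z * |diffQuot u z| ^ P) := by fun_prop
  rw [lintegral_pairMeasure hm1, ← lintegral_const_mul _ hm1.lintegral_prod_right']
  refine lintegral_congr fun x => ?_
  have hm2 : Measurable fun h => ENNReal.ofReal (κ (x, h) * |diffQuot u (x, h)| ^ P) :=
    hm1.comp measurable_prodMk_left
  have hm3 : Measurable fun h : Eucl n => ENNReal.ofReal (t * ‖h‖ ^ (t - n)) *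
      ENNReal.ofReal (κ (x, h) * |diffQuot u (x, h)| ^ P) := Measurable.mul (by fun_prop) hm2
  rw [lintegral_radialMeasure hm2, ← lintegral_const_mul _ hm3]
  have : Nontrivial (Eucl n) := Module.nontrivial_of_finrank_pos (R := ℝ)
      (by simpa using Nat.pos_of_ne_zero (NeZero.ne n))
  refine lintegral_congr_ae (ae_restrict_of_ae ?_)
  filter_upwards [Measure.ae_ne volume (0 : Eucl n)] with h h0
  have hpos : 0 < ‖h‖ := norm_pos_iff.2 h0
  rw [← ENNReal.ofReal_mul (by positivity), ← ENNReal.ofReal_mul (by positivity)]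
  congr 1
  rw [diffQuot, abs_div, abs_norm, Real.div_rpow (abs_nonneg _) hpos.le]
  have e1 : ‖h‖ ^ (t - n) = ‖h‖ ^ P / ‖h‖ ^ ((n : ℝ) + s * P) := by
    rw [← Real.rpow_sub hpos, hts]
    congr 1
    ring
  have e2 : ‖h‖ ^ P ≠ 0 := (Real.rpow_pos_of_pos hpos P).ne'
  have e3 : ‖h‖ ^ ((n : ℝ) + s * P) ≠ 0 := (Real.rpow_pos_of_pos hpos _).ne'
  rw [e1]
  field_simp

/-- The mass of `‖h‖^(-(n + P/2))` outside the unit ball. -/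
noncomputable def tailMass (n : ℕ) (P : ℝ) : ℝ≥0∞ :=
  ∫⁻ h in (Metric.ball (0 : Eucl n) 1)ᶜ, ENNReal.ofReal (‖h‖ ^ (-((n : ℝ) + P / 2)))

theorem tailMass_lt_top {P : ℝ} (hP : 0 < P) : tailMass n P < ∞ := by
  have hfin : ∫⁻ h : Eucl n, ENNReal.ofReal ((1 + ‖h‖) ^ (-((n : ℝ) + P / 2))) < ∞ :=
    finite_integral_one_add_norm (by simp; linarith)
  have hle : tailMass n P ≤ ∫⁻ h in (Metric.ball (0 : Eucl n) 1)ᶜ,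
      ENNReal.ofReal (2 ^ ((n : ℝ) + P / 2)) *
        ENNReal.ofReal ((1 + ‖h‖) ^ (-((n : ℝ) + P / 2))) := by
    refine setLIntegral_mono' Metric.isOpen_ball.measurableSet.compl fun h hh => ?_
    have h1 : 1 ≤ ‖h‖ := by simpa using hh
    rw [← ENNReal.ofReal_mul (by positivity)]
    refine ENNReal.ofReal_le_ofReal ?_
    rw [Real.rpow_neg (by positivity), Real.rpow_neg (by positivity), ← div_eq_mul_inv,
      ← Real.div_rpow (by positivity) (by positivity), ← Real.inv_rpow (by positivity)]
    refine Real.rpow_le_rpow (by positivity) ?_ (by positivity)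
    rw [inv_eq_one_div, div_le_div_iff₀ (by positivity) (by positivity)]
    linarith
  refine hle.trans_lt ((setLIntegral_le_lintegral _ _).trans_lt ?_)
  rw [lintegral_const_mul _ (by fun_prop)]
  exact ENNReal.mul_lt_top ENNReal.ofReal_lt_top hfin

theorem abs_sub_rpow_le {P : ℝ} (hP : 0 ≤ P) (x y : ℝ) :
    |x - y| ^ P ≤ 2 ^ P * (|x| ^ P + |y| ^ P) := by
  have h1 : |x - y| ≤ 2 * max |x| |y| := by
    have := abs_sub x y
    linarith [le_max_left |x| |y|, le_max_right |x| |y|]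
  calc |x - y| ^ P ≤ (2 * max |x| |y|) ^ P := Real.rpow_le_rpow (abs_nonneg _) h1 hP
    _ = 2 ^ P * (max |x| |y|) ^ P := Real.mul_rpow (by norm_num) (by positivity)
    _ ≤ _ := by
      gcongr
      rcases max_cases |x| |y| with h | h <;> rw [h.1]
      · linarith [Real.rpow_nonneg (abs_nonneg y) P]
      · linarith [Real.rpow_nonneg (abs_nonneg x) P]

/-- The part at distance `≥ 1` of the nonlocal energy. -/
noncomputable def farEnergy (κ : Eucl n × Eucl n → ℝ) (P s : ℝ) (u : Eucl n → ℝ) : ℝ≥0∞ :=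
  ∫⁻ x, ∫⁻ h in (Metric.ball 0 1)ᶜ, ENNReal.ofReal
    (κ (x, h) * (|u x - u (x - h)| ^ P / ‖h‖ ^ ((n : ℝ) + s * P)))

theorem farEnergy_le {u : Eucl n → ℝ} (hu : Measurable u)
    {κ : Eucl n × Eucl n → ℝ} (hκ0 : ∀ z, 0 ≤ κ z) {M : ℝ}
    (hκM : ∀ z, κ z ≤ M) {P s : ℝ} (hP : 0 < P) (hs : 1 / 2 ≤ s) :
    farEnergy κ P s u ≤
      ENNReal.ofReal (M * 2 ^ P) * (2 * tailMass n P * ∫⁻ x, ENNReal.ofReal (|u x| ^ P)) := by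
  have hM : 0 ≤ M := (hκ0 0).trans (hκM 0)
  set w : Eucl n → ℝ≥0∞ := fun h => ENNReal.ofReal (‖h‖ ^ (-((n : ℝ) + P / 2))) with hw
  have hwm : Measurable w := by fun_prop
  set U : Eucl n → ℝ≥0∞ := fun x => ENNReal.ofReal (|u x| ^ P) with hU
  have hUm : Measurable U := by fun_prop
  calc _ ≤ ∫⁻ x, ∫⁻ h in (Metric.ball 0 1)ᶜ,
          ENNReal.ofReal (M * 2 ^ P) * (w h * (U x + U (x - h))) := by
        refine lintegral_mono fun x => setLIntegral_mono'
          Metric.isOpen_ball.measurableSet.compl fun h hh => ?_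
        have h1 : 1 ≤ ‖h‖ := by simpa using hh
        rw [hw, hU, ← ENNReal.ofReal_add (by positivity) (by positivity),
          ← ENNReal.ofReal_mul (by positivity), ← ENNReal.ofReal_mul (by positivity)]
        refine ENNReal.ofReal_le_ofReal ?_
        have h2 : (‖h‖ ^ ((n : ℝ) + s * P))⁻¹ ≤ ‖h‖ ^ (-((n : ℝ) + P / 2)) := by
          rw [← Real.rpow_neg (by positivity)]
          refine Real.rpow_le_rpow_of_exponent_le h1 ?_
          nlinarith
        have h3 := abs_sub_rpow_le hP.le (u x) (u (x - h))
        rw [div_eq_mul_inv]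
        have h4 : 0 ≤ (‖h‖ ^ ((n : ℝ) + s * P))⁻¹ := by positivity
        calc κ (x, h) * (|u x - u (x - h)| ^ P * (‖h‖ ^ ((n : ℝ) + s * P))⁻¹)
            ≤ M * ((2 ^ P * (|u x| ^ P + |u (x - h)| ^ P)) * ‖h‖ ^ (-((n : ℝ) + P / 2))) := by
              gcongr
              exact hκM _
          _ = _ := by ring
    _ = ENNReal.ofReal (M * 2 ^ P) * ∫⁻ x, ∫⁻ h in (Metric.ball 0 1)ᶜ, w h * (U x + U (x - h)) := by
        have hm : Measurable fun z : Eucl n × Eucl n => w z.2 * (U z.1 + U (z.1 - z.2)) := by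
          fun_prop
        rw [← lintegral_const_mul _ hm.lintegral_prod_right']
        refine lintegral_congr fun x => ?_
        have hmx : Measurable fun h => w h * (U x + U (x - h)) := by fun_prop
        exact lintegral_const_mul _ hmx
    _ = _ := by
        congr 1
        rw [lintegral_lintegral_swap (by fun_prop)]
        have : ∀ h : Eucl n, ∫⁻ x, w h * (U x + U (x - h)) = w h * (2 * ∫⁻ x, U x) := by
          intro h
          rw [lintegral_const_mul _ (by fun_prop), lintegral_add_left hUm,
            lintegral_sub_right_eq_self U h, two_mul]
        simp only [this]
        rw [lintegral_mul_const _ hwm, tailMass]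
        ring

theorem energy_decomposition [NeZero n] {u : Eucl n → ℝ} (hu : Measurable u)
    {κ : Eucl n × Eucl n → ℝ} (hκ : Measurable κ)
    {P s : ℝ} (hP : 0 < P) (hs : s < 1) :
    ENNReal.ofReal ((1 - s) / P) * ∫⁻ z : Eucl n × Eucl n, ENNReal.ofReal
        (κ z * (|u z.1 - u (z.1 - z.2)| ^ P / ‖z.2‖ ^ ((n : ℝ) + s * P))) =
      ENNReal.ofReal (P⁻¹ * P⁻¹) *
        ∫⁻ z, ENNReal.ofReal (κ z * |diffQuot u z| ^ P) ∂(pairMeasure n (P * (1 - s))) +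
      ENNReal.ofReal ((1 - s) / P) * farEnergy κ P s u := by
  have hm := measurable_energyDensity hu hκ P ((n : ℝ) + s * P)
  have hs' : 0 < 1 - s := by linarith
  rw [Measure.volume_eq_prod, lintegral_prod _ hm.aemeasurable]
  have hsplit : ∀ x, ∫⁻ h, ENNReal.ofReal
      (κ (x, h) * (|u x - u (x - h)| ^ P / ‖h‖ ^ ((n : ℝ) + s * P))) =
      (∫⁻ h in Metric.ball 0 1, ENNReal.ofReal
        (κ (x, h) * (|u x - u (x - h)| ^ P / ‖h‖ ^ ((n : ℝ) + s * P)))) +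
      ∫⁻ h in (Metric.ball 0 1)ᶜ, ENNReal.ofReal
        (κ (x, h) * (|u x - u (x - h)| ^ P / ‖h‖ ^ ((n : ℝ) + s * P))) := fun x =>
    (lintegral_add_compl _ Metric.isOpen_ball.measurableSet).symm
  simp only [hsplit]
  rw [lintegral_add_left hm.lintegral_prod_right', mul_add,
    lintegral_ball_energyDensity hu hκ (t := P * (1 - s)) (by positivity) rfl, ← mul_assoc,
    ← ENNReal.ofReal_mul (by positivity), farEnergy]
  congr 3
  field_simp

end Decomposition

/-! ### Difference quotients of Sobolev functions -/

section SobolevDiffQuot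

variable {n : ℕ}

theorem eLpNorm_rpow_toReal {α F : Type*} [MeasurableSpace α] [NormedAddCommGroup F]
    {μ : Measure α} {p : ℝ≥0∞} (hp : 1 ≤ p) (hp' : p ≠ ∞) (f : α → F) :
    eLpNorm f p μ ^ p.toReal = ∫⁻ x, ‖f x‖ₑ ^ p.toReal ∂μ := by
  have hp0 : p ≠ 0 := (one_pos.trans_le hp).ne'
  rw [eLpNorm_eq_lintegral_rpow_enorm_toReal hp0 hp', ← ENNReal.rpow_mul, one_div,
    inv_mul_cancel₀ (ENNReal.toReal_pos hp0 hp').ne', ENNReal.rpow_one]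

theorem toReal_pos_of_one_le {p : ℝ≥0∞} (hp : 1 ≤ p) (hp' : p ≠ ∞) : 0 < p.toReal :=
  ENNReal.toReal_pos (one_pos.trans_le hp).ne' hp'

theorem lintegral_rpow_enorm_lt_top {α F : Type*} [MeasurableSpace α] [NormedAddCommGroup F]
    {μ : Measure α} {p : ℝ≥0∞} (hp : 1 ≤ p) (hp' : p ≠ ∞) {f : α → F} (hf : MemLp f p μ) :
    ∫⁻ x, ‖f x‖ₑ ^ p.toReal ∂μ < ∞ := by
  rw [← eLpNorm_rpow_toReal hp hp']
  exact ENNReal.rpow_lt_top_of_nonneg (toReal_pos_of_one_le hp hp').le hf.2.ne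

/-- The `p`-th power of the `L^p` norm of `g(· - k) - g`. -/
noncomputable def translationModulus {F : Type*} [NormedAddCommGroup F] (p : ℝ≥0∞)
    (g : Eucl n → F) (k : Eucl n) : ℝ≥0∞ :=
  ∫⁻ x, ‖g (x - k) - g x‖ₑ ^ p.toReal

section

variable {F : Type*} [NormedAddCommGroup F] {p : ℝ≥0∞}

theorem tendsto_translationModulus (hp : 1 ≤ p) (hp' : p ≠ ∞) {g : Eucl n → F}
    (hg : MemLp g p volume) : Tendsto (translationModulus p g) (𝓝 0) (𝓝 0) := by
  have : Fact (1 ≤ p) := ⟨hp⟩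
  have hP := toReal_pos_of_one_le hp hp'
  let T : Eucl n → C(Eucl n, Eucl n) := fun k => ⟨fun x => x - k, by fun_prop⟩
  have hT : Continuous T := by
    refine ContinuousMap.continuous_of_continuous_uncurry _ ?_
    simp only [T, Function.uncurry_def, ContinuousMap.coe_mk]
    fun_prop
  have hTm : ∀ k, MeasurePreserving (T k) volume volume := fun k =>
    measurePreserving_sub_right volume k
  have hc : Continuous fun k => Lp.compMeasurePreserving (T k) (hTm k) (hg.toLp g) :=
    continuous_const.compMeasurePreservingLp hT hTm hp'
  have h0 : Tendsto (fun k => edist (Lp.compMeasurePreserving (T k) (hTm k) (hg.toLp g))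
      (Lp.compMeasurePreserving (T 0) (hTm 0) (hg.toLp g))) (𝓝 0) (𝓝 0) :=
    tendsto_iff_edist_tendsto_0.1 (hc.tendsto 0)
  have h1 : ∀ k, edist (Lp.compMeasurePreserving (T k) (hTm k) (hg.toLp g))
      (Lp.compMeasurePreserving (T 0) (hTm 0) (hg.toLp g)) ^ p.toReal =
      translationModulus p g k := by
    intro k
    rw [Lp.edist_def, eLpNorm_rpow_toReal hp hp', translationModulus]
    refine lintegral_congr_ae ?_
    have e1 : ∀ k, Lp.compMeasurePreserving (T k) (hTm k) (hg.toLp g) =ᵐ[volume]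
        fun x => g (x - k) := fun k =>
      (Lp.coeFn_compMeasurePreserving _ (hTm k)).trans
        ((hTm k).quasiMeasurePreserving.ae_eq_comp hg.coeFn_toLp)
    filter_upwards [e1 k, e1 0] with x hx hx0
    simp only [Pi.sub_apply]
    rw [hx, hx0, sub_zero]
  have h2 := h0.ennrpow_const p.toReal
  simp only [h1, ENNReal.zero_rpow_of_pos hP] at h2
  exact h2

theorem ennreal_add_rpow_le {P : ℝ} (hP : 0 ≤ P) (a b : ℝ≥0∞) :
    (a + b) ^ P ≤ 2 ^ P * (a ^ P + b ^ P) := by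
  calc (a + b) ^ P ≤ (2 * max a b) ^ P := by
        gcongr
        rw [two_mul]
        exact add_le_add (le_max_left _ _) (le_max_right _ _)
    _ = 2 ^ P * (max a b) ^ P := ENNReal.mul_rpow_of_nonneg _ _ hP
    _ ≤ _ := by
        gcongr
        rcases max_cases a b with h | h <;> rw [h.1]
        · exact le_self_add
        · exact le_add_self

theorem translationModulus_le [MeasurableSpace F] [BorelSpace F] (hp : 1 ≤ p)
    (hp' : p ≠ ∞) {g : Eucl n → F} (hg : Measurable g) (k : Eucl n) :
    translationModulus p g k ≤ 2 ^ p.toReal * (2 * ∫⁻ x, ‖g x‖ₑ ^ p.toReal) := by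
  have hP := toReal_pos_of_one_le hp hp'
  have hm : Measurable fun x => ‖g x‖ₑ ^ p.toReal := by fun_prop
  calc translationModulus p g k ≤ ∫⁻ x, 2 ^ p.toReal *
        (‖g (x - k)‖ₑ ^ p.toReal + ‖g x‖ₑ ^ p.toReal) := by
        refine lintegral_mono fun x => ?_
        refine le_trans ?_ (ennreal_add_rpow_le hP.le _ _)
        gcongr
        exact enorm_sub_le
    _ = _ := by
        rw [lintegral_const_mul _ (by fun_prop), lintegral_add_right _ hm,
          lintegral_sub_right_eq_self (fun x => ‖g x‖ₑ ^ p.toReal) k, two_mul]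

end

theorem ennreal_le_one_add_rpow {P : ℝ} (hP : 1 ≤ P) (a : ℝ≥0∞) : a ≤ 1 + a ^ P := by
  rcases le_total a 1 with h | h
  · exact h.trans le_self_add
  · refine le_trans ?_ le_add_self
    conv_lhs => rw [← ENNReal.rpow_one a]
    exact ENNReal.rpow_le_rpow_of_exponent_le h hP

theorem enorm_integral_rpow_le {α : Type*} [MeasurableSpace α] {ρ : Measure α}
    [IsProbabilityMeasure ρ] {p : ℝ≥0∞} (hp : 1 ≤ p) (hp' : p ≠ ∞) {f : α → ℝ}
    (hf : AEStronglyMeasurable f ρ) :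
    ‖∫ τ, f τ ∂ρ‖ₑ ^ p.toReal ≤ ∫⁻ τ, ‖f τ‖ₑ ^ p.toReal ∂ρ := by
  have hP := toReal_pos_of_one_le hp hp'
  rw [← eLpNorm_rpow_toReal hp hp']
  gcongr
  refine (enorm_integral_le_lintegral_enorm f).trans ?_
  rw [← eLpNorm_one_eq_lintegral_enorm]
  exact eLpNorm_le_eLpNorm_of_exponent_le hp hf

/-- The uniform measure on the unit interval. -/
noncomputable abbrev unitMeasure : Measure ℝ := volume.restrict (Icc 0 1)

instance : IsProbabilityMeasure unitMeasure := ⟨by simp⟩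

theorem integrable_translates {g : Eucl n → Eucl n} (hgm : Measurable g) {p : ℝ≥0∞} (hp : 1 ≤ p)
    (hp' : p ≠ ∞) (hg : MemLp g p volume) (h v : Eucl n) {K : Set (Eucl n)} (hK : IsCompact K) :
    Integrable (fun z : Eucl n × ℝ => inner ℝ (g (z.1 - z.2 • h)) v)
      ((volume.restrict K).prod unitMeasure) := by
  have hP : 1 ≤ p.toReal := by simpa using (ENNReal.toReal_le_toReal (by simp) hp').2 hp
  have hgv : MemLp (fun x => inner ℝ (g x) v) p volume := hg.inner_const v
  have hmz : Measurable fun z : Eucl n × ℝ => inner ℝ (g (z.1 - z.2 • h)) v := by fun_prop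
  refine ⟨hmz.aestronglyMeasurable, ?_⟩
  rw [HasFiniteIntegral, lintegral_prod_symm _ (by fun_prop)]
  have hb : ∀ τ : ℝ, ∫⁻ x in K, ‖(inner ℝ (g (x - τ • h)) v : ℝ)‖ₑ ≤
      volume K + ∫⁻ x, ‖(inner ℝ (g x) v : ℝ)‖ₑ ^ p.toReal := by
    intro τ
    calc _ ≤ ∫⁻ x in K, (1 + ‖(inner ℝ (g (x - τ • h)) v : ℝ)‖ₑ ^ p.toReal) :=
          lintegral_mono fun x => ennreal_le_one_add_rpow hP _
      _ = volume K + ∫⁻ x in K, ‖(inner ℝ (g (x - τ • h)) v : ℝ)‖ₑ ^ p.toReal := by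
          rw [lintegral_add_left measurable_const]; simp
      _ ≤ volume K + ∫⁻ x, ‖(inner ℝ (g (x - τ • h)) v : ℝ)‖ₑ ^ p.toReal := by
          gcongr; exact Measure.restrict_le_self
      _ = _ := by
          rw [lintegral_sub_right_eq_self (fun x => ‖(inner ℝ (g x) v : ℝ)‖ₑ ^ p.toReal)]
  refine (lintegral_mono hb).trans_lt ?_
  rw [lintegral_const, measure_univ, mul_one]
  exact ENNReal.add_lt_top.2 ⟨hK.measure_lt_top, lintegral_rpow_enorm_lt_top hp hp' hgv⟩

theorem integral_fderiv_segment {φ : Eucl n → ℝ} (hφ : ContDiff ℝ ((⊤ : ℕ∞) : WithTop ℕ∞) φ)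
    (x h : Eucl n) : ∫ τ, fderiv ℝ φ (x + τ • h) h ∂unitMeasure = φ (x + h) - φ x := by
  have hd : ∀ τ : ℝ, HasDerivAt (fun τ : ℝ => φ (x + τ • h)) (fderiv ℝ φ (x + τ • h) h) τ := by
    intro τ
    have h1 : HasDerivAt (fun τ : ℝ => x + τ • h) h τ := by
      simpa using ((hasDerivAt_id τ).smul_const h).const_add x
    exact (hφ.differentiable (by simp) _).hasFDerivAt.comp_hasDerivAt τ h1
  have hc : Continuous fun τ : ℝ => fderiv ℝ φ (x + τ • h) h :=
    ((hφ.continuous_fderiv (by simp)).comp (by fun_prop)).clm_apply continuous_const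
  rw [integral_Icc_eq_integral_Ioc, ← intervalIntegral.integral_of_le zero_le_one,
    intervalIntegral.integral_eq_sub_of_hasDerivAt (fun τ _ => hd τ) (hc.intervalIntegrable _ _)]
  simp

end SobolevDiffQuot

section SobolevDiffQuot

variable {n : ℕ}

theorem HasWeakGradient.integral_fderiv_translate {u : Eucl n → ℝ} {g : Eucl n → Eucl n}
    (hw : HasWeakGradient u g) {φ : Eucl n → ℝ} (hφ : ContDiff ℝ ((⊤ : ℕ∞) : WithTop ℕ∞) φ)
    (hφc : HasCompactSupport φ) (y v : Eucl n) :
    ∫ x, φ x * inner ℝ (g (x - y)) v = - ∫ x, u x * fderiv ℝ φ (x + y) v := by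
  have h1 : ContDiff ℝ ((⊤ : ℕ∞) : WithTop ℕ∞) fun x => φ (x + y) := hφ.comp (by fun_prop)
  have h2 : HasCompactSupport fun x => φ (x + y) :=
    hφc.comp_homeomorph (Homeomorph.addRight y)
  have h3 := hw.2.2 _ h1 h2 v
  simp only [fderiv_comp_add_right] at h3
  rw [h3, neg_neg, ← integral_sub_right_eq_self (fun x => φ (x + y) * inner ℝ (g x) v) y]
  simp

theorem integrable_mul_fderiv_segment {u : Eucl n → ℝ} (hu : LocallyIntegrable u volume)
    (hum : Measurable u) {φ : Eucl n → ℝ} (hφ : ContDiff ℝ ((⊤ : ℕ∞) : WithTop ℕ∞) φ)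
    (hφc : HasCompactSupport φ) (h : Eucl n) :
    Integrable (fun z : Eucl n × ℝ => u z.1 * fderiv ℝ φ (z.1 + z.2 • h) h)
      (volume.prod unitMeasure) := by
  have hcont : Continuous (fderiv ℝ φ) := hφ.continuous_fderiv (by simp)
  obtain ⟨C, hC⟩ := hcont.bounded_above_of_compact_support (hφc.fderiv ℝ)
  obtain ⟨R, hR⟩ := (hφc.fderiv (𝕜 := ℝ)).isCompact.isBounded.subset_closedBall (0 : Eucl n)
  have hC0 : 0 ≤ C := (norm_nonneg _).trans (hC 0)
  set B := Metric.closedBall (0 : Eucl n) (R + ‖h‖) with hB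
  have hBi : Integrable (B.indicator fun x => |u x| * (C * ‖h‖)) volume :=
    (integrable_indicator_iff Metric.isClosed_closedBall.measurableSet).2
      ((hu.integrableOn_isCompact (isCompact_closedBall _ _)).abs.mul_const _)
  have hdom : Integrable (fun z : Eucl n × ℝ => B.indicator (fun x => |u x| * (C * ‖h‖)) z.1)
      (volume.prod unitMeasure) := hBi.comp_fst _
  refine hdom.mono' ?_ ?_
  · refine Measurable.aestronglyMeasurable ?_
    refine (hum.comp measurable_fst).mul (Continuous.measurable ?_)
    exact (hcont.comp (by fun_prop)).clm_apply continuous_const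
  · have hτ : ∀ᵐ z ∂((volume : Measure (Eucl n)).prod unitMeasure), z.2 ∈ Icc (0 : ℝ) 1 :=
      Measure.quasiMeasurePreserving_snd.ae (ae_restrict_mem measurableSet_Icc)
    filter_upwards [hτ] with z hz
    rw [norm_mul, Real.norm_eq_abs]
    by_cases hzB : z.1 ∈ B
    · rw [indicator_of_mem hzB]
      gcongr
      exact (ContinuousLinearMap.le_opNorm _ _).trans (by gcongr; exact hC _)
    · rw [indicator_of_notMem hzB]
      have : fderiv ℝ φ (z.1 + z.2 • h) = 0 := by
        by_contra hne
        have h1 := hR (subset_tsupport _ (Function.mem_support.2 hne))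
        rw [mem_closedBall_zero_iff] at h1
        refine hzB ?_
        rw [hB, mem_closedBall_zero_iff]
        have h2 : ‖z.1‖ ≤ ‖z.1 + z.2 • h‖ + ‖z.2 • h‖ := by
          simpa using norm_sub_le (z.1 + z.2 • h) (z.2 • h)
        have h3 : ‖z.2 • h‖ ≤ ‖h‖ := by
          rw [norm_smul, Real.norm_eq_abs, abs_of_nonneg hz.1]
          exact mul_le_of_le_one_left (norm_nonneg _) hz.2
        linarith
      rw [this]
      simp

/-- A Sobolev function is the integral of its weak gradient along almost every segment in a given
direction. -/
theorem HasWeakGradient.sub_translate_ae_eq {u : Eucl n → ℝ} {g : Eucl n → Eucl n}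
    (hw : HasWeakGradient u g) (hum : Measurable u) (hgm : Measurable g)
    {p : ℝ≥0∞} (hp : 1 ≤ p) (hp' : p ≠ ∞) (hu : MemLp u p volume) (hg : MemLp g p volume)
    (h : Eucl n) :
    ∀ᵐ x, u x - u (x - h) = ∫ τ, inner ℝ (g (x - τ • h)) h ∂unitMeasure := by
  have hul : LocallyIntegrable u volume := hw.1
  have huh : MemLp (fun x => u (x - h)) p volume :=
    hu.comp_measurePreserving (measurePreserving_sub_right volume h)
  have huhl : LocallyIntegrable (fun x => u (x - h)) volume := huh.locallyIntegrable hp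
  have hGl : LocallyIntegrable (fun x => ∫ τ, inner ℝ (g (x - τ • h)) h ∂unitMeasure)
      volume := by
    rw [locallyIntegrable_iff]
    intro K hK
    exact (integrable_translates hgm hp hp' hg h h hK).integral_prod_left
  refine ae_eq_of_integral_contDiff_smul_eq (hul.sub huhl) hGl fun φ hφ hφc => ?_
  have hφint : ∀ {w : Eucl n → ℝ}, LocallyIntegrable w volume →
      Integrable (fun x => φ x * w x) volume := fun hw =>
    hw.integrable_smul_left_of_hasCompactSupport hφ.continuous hφc
  simp only [smul_eq_mul]
  have hL : ∫ x, φ x * (u x - u (x - h)) = - ∫ x, u x * (φ (x + h) - φ x) := by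
    have i1 := hφint hul
    have i2 := hφint huhl
    have i3 : Integrable (fun x => φ (x + h) * u x) volume := by
      have := i2.comp_add_right h
      simpa using this
    have e1 : ∫ x, φ x * u (x - h) = ∫ x, φ (x + h) * u x := by
      rw [← integral_add_right_eq_self (fun x => φ x * u (x - h)) h]
      simp
    calc ∫ x, φ x * (u x - u (x - h)) = ∫ x, (φ x * u x - φ x * u (x - h)) := by
          simp only [mul_sub]
      _ = (∫ x, φ x * u x) - ∫ x, φ (x + h) * u x := by rw [integral_sub i1 i2, e1]
      _ = - ∫ x, (φ (x + h) * u x - φ x * u x) := by rw [integral_sub i3 i1]; ring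
      _ = _ := by congr 1; refine integral_congr_ae (Eventually.of_forall fun x => ?_); ring
  have hR : ∫ x, φ x * ∫ τ, inner ℝ (g (x - τ • h)) h ∂unitMeasure =
      - ∫ x, u x * (φ (x + h) - φ x) := by
    have i1 : Integrable (fun z : Eucl n × ℝ => φ z.1 * inner ℝ (g (z.1 - z.2 • h)) h)
        (volume.prod unitMeasure) := by
      have hK := integrable_translates hgm hp hp' hg h h hφc.isCompact
      obtain ⟨C, hC⟩ := hφ.continuous.bounded_above_of_compact_support hφc
      have h2 := hK.bdd_mul (c := C) (f := fun z : Eucl n × ℝ => φ z.1)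
        (hφ.continuous.measurable.comp measurable_fst).aestronglyMeasurable
        (Eventually.of_forall fun z => hC _)
      have h3 : (volume.restrict (tsupport φ)).prod unitMeasure =
          ((volume : Measure (Eucl n)).prod unitMeasure).restrict (tsupport φ ×ˢ univ) := by
        rw [← Measure.prod_restrict, Measure.restrict_univ]
      rw [h3] at h2
      refine (integrableOn_iff_integrable_of_support_subset ?_).1 h2
      intro z hz
      refine ⟨subset_tsupport _ fun h0 => hz ?_, mem_univ _⟩
      simp only [h0, zero_mul]
    calc ∫ x, φ x * ∫ τ, inner ℝ (g (x - τ • h)) h ∂unitMeasure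
        = ∫ x, ∫ τ, φ x * inner ℝ (g (x - τ • h)) h ∂unitMeasure := by
          simp only [integral_const_mul]
      _ = ∫ τ, (∫ x, φ x * inner ℝ (g (x - τ • h)) h) ∂unitMeasure := integral_integral_swap i1
      _ = ∫ τ, (- ∫ x, u x * fderiv ℝ φ (x + τ • h) h) ∂unitMeasure := by
          refine integral_congr_ae (Eventually.of_forall fun τ => ?_)
          exact hw.integral_fderiv_translate hφ hφc (τ • h) h
      _ = - ∫ x, ∫ τ, u x * fderiv ℝ φ (x + τ • h) h ∂unitMeasure := by
          rw [integral_neg]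
          congr 1
          exact (integral_integral_swap (integrable_mul_fderiv_segment hul hum hφ hφc h)).symm
      _ = _ := by
          simp only [integral_const_mul, integral_fderiv_segment hφ]
  rw [hL, hR]

/-- The pairing `∇u(x) · h/|h|` as a function of the pair `(x, h)`. -/
noncomputable def gradDir [NeZero n] (g : Eucl n → Eucl n) (z : Eucl n × Eucl n) : ℝ :=
  inner ℝ (g z.1) (dir z.2 : Eucl n)

theorem measurable_gradDir [NeZero n] {g : Eucl n → Eucl n} (hg : Measurable g) :
    Measurable (gradDir g) := by
  unfold gradDir
  have h1 : Measurable fun z : Eucl n × Eucl n => (dir z.2 : Eucl n) :=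
    measurable_subtype_coe.comp (measurable_dir.comp measurable_snd)
  exact (hg.comp measurable_fst).inner h1

theorem HasWeakGradient.lintegral_diffQuot_sub_le [NeZero n] {u : Eucl n → ℝ}
    {g : Eucl n → Eucl n} (hw : HasWeakGradient u g) (hum : Measurable u) (hgm : Measurable g)
    {p : ℝ≥0∞} (hp : 1 ≤ p) (hp' : p ≠ ∞) (hu : MemLp u p volume) (hg : MemLp g p volume)
    {h : Eucl n} (h0 : h ≠ 0) :
    ∫⁻ x, ‖diffQuot u (x, h) - gradDir g (x, h)‖ₑ ^ p.toReal ≤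
      ∫⁻ τ, translationModulus p g (τ • h) ∂unitMeasure := by
  have hP := toReal_pos_of_one_le hp hp'
  have hpt : ∀ᵐ x, diffQuot u (x, h) - gradDir g (x, h) =
      ∫ τ, inner ℝ (g (x - τ • h) - g x) (dir h : Eucl n) ∂unitMeasure := by
    have hint : ∀ᵐ x, Integrable (fun τ : ℝ => inner ℝ (g (x - τ • h)) (dir h : Eucl n))
        unitMeasure := by
      have h1 : ∀ N : ℕ, ∀ᵐ x ∂(volume.restrict (Metric.closedBall (0 : Eucl n) N)),
          Integrable (fun τ : ℝ => inner ℝ (g (x - τ • h)) (dir h : Eucl n)) unitMeasure :=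
        fun N => (integrable_translates hgm hp hp' hg h (dir h)
          (isCompact_closedBall 0 (N : ℝ))).prod_right_ae
      have h2 := ae_restrict_iUnion_iff (μ := volume)
        (fun N : ℕ => Metric.closedBall (0 : Eucl n) N) _ |>.2 h1
      rwa [Metric.iUnion_closedBall_nat, Measure.restrict_univ] at h2
    filter_upwards [hw.sub_translate_ae_eq hum hgm hp hp' hu hg h, hint] with x hx hxi
    have e1 : ∫ τ, inner ℝ (g (x - τ • h) - g x) (dir h : Eucl n) ∂unitMeasure =
        (∫ τ, inner ℝ (g (x - τ • h)) (dir h : Eucl n) ∂unitMeasure) -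
          inner ℝ (g x) (dir h : Eucl n) := by
      simp only [inner_sub_left]
      rw [integral_sub hxi (integrable_const _)]
      simp
    rw [e1, gradDir, diffQuot]
    congr 1
    simp only [hx]
    rw [dir_coe h0]
    simp only [inner_smul_right]
    rw [integral_const_mul, div_eq_inv_mul]
  calc ∫⁻ x, ‖diffQuot u (x, h) - gradDir g (x, h)‖ₑ ^ p.toReal
      = ∫⁻ x, ‖∫ τ, inner ℝ (g (x - τ • h) - g x) (dir h : Eucl n) ∂unitMeasure‖ₑ ^ p.toReal := by
        refine lintegral_congr_ae ?_
        filter_upwards [hpt] with x hx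
        rw [hx]
    _ ≤ ∫⁻ x, ∫⁻ τ, ‖g (x - τ • h) - g x‖ₑ ^ p.toReal ∂unitMeasure := by
        refine lintegral_mono fun x => ?_
        refine (enorm_integral_rpow_le hp hp' (by
          refine Measurable.aestronglyMeasurable ?_; fun_prop)).trans ?_
        refine lintegral_mono fun τ => ?_
        gcongr
        rw [← ofReal_norm, ← ofReal_norm]
        refine ENNReal.ofReal_le_ofReal ((norm_inner_le_norm _ _).trans ?_)
        simp
    _ = _ := by
        rw [lintegral_lintegral_swap (by fun_prop)]
        rfl

theorem HasWeakGradient.lintegral_diffQuot_sub_le_const [NeZero n] {u : Eucl n → ℝ}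
    {g : Eucl n → Eucl n} (hw : HasWeakGradient u g) (hum : Measurable u) (hgm : Measurable g)
    {p : ℝ≥0∞} (hp : 1 ≤ p) (hp' : p ≠ ∞) (hu : MemLp u p volume) (hg : MemLp g p volume) :
    ∃ M : ℝ≥0∞, M ≠ ∞ ∧ ∀ t : ℝ, 0 < t →
      ∫⁻ z, ‖diffQuot u z - gradDir g z‖ₑ ^ p.toReal ∂(pairMeasure n t) ≤ M := by
  have hfin : 2 ^ p.toReal * (2 * ∫⁻ x, ‖g x‖ₑ ^ p.toReal) ≠ ∞ := by
    refine ENNReal.mul_ne_top (by simp) (ENNReal.mul_ne_top (by simp) ?_)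
    exact (lintegral_rpow_enorm_lt_top hp hp' hg).ne
  refine ⟨_, ENNReal.mul_ne_top hfin (measure_ne_top (surfaceMeasure n) univ), fun t ht => ?_⟩
  have hmV : Measurable fun z => ‖diffQuot u z - gradDir g z‖ₑ ^ p.toReal :=
    ((measurable_diffQuot hum).sub (measurable_gradDir hgm)).enorm.pow_const _
  simp only [pairMeasure]
  rw [lintegral_prod_symm _ hmV.aemeasurable, ← radialMeasure_univ ht, ← lintegral_const]
  refine lintegral_mono_ae ?_
  filter_upwards [ae_radialMeasure_norm_pos_lt t] with h hh
  refine (hw.lintegral_diffQuot_sub_le hum hgm hp hp' hu hg hh.1).trans ?_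
  exact (lintegral_mono fun τ => translationModulus_le hp hp' hgm _).trans (by simp)

theorem HasWeakGradient.tendsto_lintegral_diffQuot_sub [NeZero n] {u : Eucl n → ℝ}
    {g : Eucl n → Eucl n} (hw : HasWeakGradient u g) (hum : Measurable u) (hgm : Measurable g)
    {p : ℝ≥0∞} (hp : 1 ≤ p) (hp' : p ≠ ∞) (hu : MemLp u p volume) (hg : MemLp g p volume)
    {ι : Type*} {l : Filter ι} {t : ι → ℝ} (ht : Tendsto t l (𝓝[>] 0)) :
    Tendsto (fun i => ∫⁻ z, ‖diffQuot u z - gradDir g z‖ₑ ^ p.toReal ∂(pairMeasure n (t i))) l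
      (𝓝 0) := by
  set f : Eucl n → ℝ≥0∞ := fun h => ∫⁻ τ, translationModulus p g (τ • h) ∂unitMeasure with hf
  have hbd : ∀ k, translationModulus p g k ≤ 2 ^ p.toReal * (2 * ∫⁻ x, ‖g x‖ₑ ^ p.toReal) :=
    translationModulus_le hp hp' hgm
  have hfin : 2 ^ p.toReal * (2 * ∫⁻ x, ‖g x‖ₑ ^ p.toReal) ≠ ∞ := by
    refine ENNReal.mul_ne_top (by simp) (ENNReal.mul_ne_top (by simp) ?_)
    exact (lintegral_rpow_enorm_lt_top hp hp' hg).ne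
  have hf0 : Tendsto f (𝓝 0) (𝓝 0) := by
    rw [ENNReal.tendsto_nhds_zero]
    intro ε hε
    obtain ⟨δ, hδ, hδf⟩ := Metric.eventually_nhds_iff.1
      (ENNReal.tendsto_nhds_zero.1 (tendsto_translationModulus hp hp' hg) ε hε)
    refine Metric.eventually_nhds_iff.2 ⟨δ, hδ, fun h hh => ?_⟩
    rw [dist_zero_right] at hh
    calc f h ≤ ∫⁻ τ, ε ∂unitMeasure := by
          refine setLIntegral_mono measurable_const fun τ hτ => hδf ?_
          rw [dist_zero_right, norm_smul, Real.norm_eq_abs, abs_of_nonneg hτ.1]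
          exact (mul_le_of_le_one_left (norm_nonneg _) hτ.2).trans_lt hh
      _ = ε := by simp
  have hfM : ∀ h, f h ≤ 2 ^ p.toReal * (2 * ∫⁻ x, ‖g x‖ₑ ^ p.toReal) := fun h =>
    (lintegral_mono fun τ => hbd _).trans (by simp)
  have hmV : Measurable fun z => ‖diffQuot u z - gradDir g z‖ₑ ^ p.toReal :=
    ((measurable_diffQuot hum).sub (measurable_gradDir hgm)).enorm.pow_const _
  refine tendsto_of_tendsto_of_tendsto_of_le_of_le tendsto_const_nhds
    (tendsto_lintegral_radialMeasure_zero ht hfin hfM hf0) (fun _ => zero_le) fun i => ?_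
  simp only [pairMeasure]
  rw [lintegral_prod_symm _ hmV.aemeasurable]
  refine lintegral_mono_ae ?_
  filter_upwards [ae_radialMeasure_norm_pos_lt (t i)] with h hh
  exact hw.lintegral_diffQuot_sub_le hum hgm hp hp' hu hg hh.1

end SobolevDiffQuot

/-! ### Representation of functionals on `L^q` -/

section LpDuality

/-- The duality map `y ↦ |y|^(P-2) y`. -/
noncomputable def dualPow (P y : ℝ) : ℝ := |y| ^ (P - 2) * y

theorem dualPow_mul_self {P : ℝ} (hP : 0 < P) (y : ℝ) : dualPow P y * y = |y| ^ P := by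
  rcases eq_or_ne y 0 with rfl | hy
  · simp [dualPow, Real.zero_rpow hP.ne']
  · have h0 : 0 < |y| := abs_pos.2 hy
    rw [dualPow, mul_assoc, ← sq, ← sq_abs, ← Real.rpow_natCast, ← Real.rpow_add h0]
    norm_num

theorem abs_dualPow {P : ℝ} (hP : 1 < P) (y : ℝ) : |dualPow P y| = |y| ^ (P - 1) := by
  rcases eq_or_ne y 0 with rfl | hy
  · simp [dualPow, Real.zero_rpow (sub_pos.2 hP).ne']
  · have h0 : 0 < |y| := abs_pos.2 hy
    rw [dualPow, abs_mul, abs_of_nonneg (Real.rpow_nonneg (abs_nonneg y) _),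
      ← Real.rpow_add_one h0.ne']
    congr 1
    ring

theorem abs_dualPow_rpow {P Q : ℝ} (hPQ : P.HolderConjugate Q) (y : ℝ) :
    |dualPow P y| ^ Q = |y| ^ P := by
  rw [abs_dualPow hPQ.lt, ← Real.rpow_mul (abs_nonneg y), hPQ.sub_one_mul_conj]

theorem measurable_dualPow (P : ℝ) : Measurable (dualPow P) := by
  unfold dualPow
  fun_prop

theorem enorm_dualPow_rpow {P Q : ℝ} (hPQ : P.HolderConjugate Q) (y : ℝ) :
    ‖dualPow P y‖ₑ ^ Q = ‖y‖ₑ ^ P := by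
  rw [Real.enorm_eq_ofReal_abs, Real.enorm_eq_ofReal_abs,
    ENNReal.ofReal_rpow_of_nonneg (abs_nonneg _) hPQ.symm.nonneg,
    ENNReal.ofReal_rpow_of_nonneg (abs_nonneg _) hPQ.nonneg, abs_dualPow_rpow hPQ]

variable {α : Type*} [MeasurableSpace α] {μ : Measure α} {p q : ℝ≥0∞}

theorem one_le_of_holderConjugate (hp' : p ≠ ∞) (hpq : p.toReal.HolderConjugate q.toReal) :
    1 ≤ p := by
  rw [← ENNReal.toReal_le_toReal ENNReal.one_ne_top hp', ENNReal.toReal_one]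
  exact hpq.lt.le

theorem tendsto_eLpNorm_sub_of_dominated {ι : Type*} {l : Filter ι} [l.IsCountablyGenerated]
    (hq : 1 ≤ q) (hq' : q ≠ ∞) {F : ι → α → ℝ} {f b : α → ℝ}
    (hF : ∀ i, AEStronglyMeasurable (F i) μ) (hf : AEStronglyMeasurable f μ) (hb : MemLp b q μ)
    (hFb : ∀ i x, |F i x| ≤ |b x|) (hfb : ∀ x, |f x| ≤ |b x|)
    (hlim : ∀ x, Tendsto (fun i => F i x) l (𝓝 (f x))) :
    Tendsto (fun i => eLpNorm (F i - f) q μ) l (𝓝 0) := by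
  have hQ := toReal_pos_of_one_le hq hq'
  have hlim' : Tendsto (fun i => ∫⁻ x, ‖F i x - f x‖ₑ ^ q.toReal ∂μ) l (𝓝 (∫⁻ _, 0 ∂μ)) := by
    refine tendsto_lintegral_filter_of_dominated_convergence'
      (fun x => 2 ^ q.toReal * (2 * ‖b x‖ₑ ^ q.toReal)) ?_ ?_ ?_ ?_
    · exact Eventually.of_forall fun i => ((hF i).sub hf).enorm.pow_const _
    · refine Eventually.of_forall fun i => Eventually.of_forall fun x => ?_
      refine le_trans (ENNReal.rpow_le_rpow (enorm_sub_le) hQ.le) ?_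
      refine (ennreal_add_rpow_le hQ.le _ _).trans ?_
      have h1 : ∀ {y : ℝ}, |y| ≤ |b x| → ‖y‖ₑ ≤ ‖b x‖ₑ := fun h => by
        rw [Real.enorm_eq_ofReal_abs, Real.enorm_eq_ofReal_abs]
        exact ENNReal.ofReal_le_ofReal h
      rw [two_mul]
      gcongr
      · exact h1 (hFb i x)
      · exact h1 (hfb x)
    · have h2 := (lintegral_rpow_enorm_lt_top hq hq' hb).ne
      have h3 : AEMeasurable (fun x => ‖b x‖ₑ ^ q.toReal) μ := hb.1.enorm.pow_const _
      rw [lintegral_const_mul'' _ (h3.const_mul _), lintegral_const_mul'' _ h3]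
      exact ENNReal.mul_ne_top (by simp) (ENNReal.mul_ne_top (by simp) h2)
    · refine Eventually.of_forall fun x => ?_
      have h1 : Tendsto (fun i => F i x - f x) l (𝓝 0) := by
        simpa using (hlim x).sub_const (f x)
      have h2 := (h1.enorm).ennrpow_const q.toReal
      simpa [ENNReal.zero_rpow_of_pos hQ] using h2
  have h3 := hlim'.ennrpow_const (1 / q.toReal)
  simp only [lintegral_zero, ENNReal.zero_rpow_of_pos (one_div_pos.2 hQ)] at h3
  refine h3.congr fun i => ?_
  rw [eLpNorm_eq_lintegral_rpow_enorm_toReal (one_pos.trans_le hq).ne' hq']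
  rfl

theorem tendsto_dual_of_dominated [Fact (1 ≤ q)] {ι : Type*} {l : Filter ι}
    [l.IsCountablyGenerated] (hq' : q ≠ ∞) (Λ : Lp ℝ q μ →L[ℝ] ℝ) {F : ι → α → ℝ} {f b : α → ℝ}
    (hF : ∀ i, MemLp (F i) q μ) (hf : MemLp f q μ) (hb : MemLp b q μ)
    (hFb : ∀ i x, |F i x| ≤ |b x|) (hfb : ∀ x, |f x| ≤ |b x|)
    (hlim : ∀ x, Tendsto (fun i => F i x) l (𝓝 (f x))) :
    Tendsto (fun i => Λ ((hF i).toLp (F i))) l (𝓝 (Λ (hf.toLp f))) := by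
  refine (Λ.continuous.tendsto _).comp ?_
  rw [Lp.tendsto_Lp_iff_tendsto_eLpNorm'']
  exact tendsto_eLpNorm_sub_of_dominated Fact.out hq' (fun i => (hF i).1) hf.1 hb hFb hfb hlim

theorem toLp_eq_zero_of_ae_eq {f : α → ℝ} (hf : MemLp f q μ) (h : f =ᵐ[μ] 0) :
    hf.toLp f = 0 :=
  ((MemLp.toLp_eq_toLp_iff hf MemLp.zero).2 h).trans (MemLp.toLp_zero _)

open Classical in
/-- The signed measure `A ↦ Λ(1_A w)`. -/
noncomputable def dualSignedMeasure [Fact (1 ≤ q)] (hq' : q ≠ ∞) (Λ : Lp ℝ q μ →L[ℝ] ℝ)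
    {w : α → ℝ} (hw : MemLp w q μ) : SignedMeasure α where
  measureOf' A := if hA : MeasurableSet A then Λ ((hw.indicator hA).toLp _) else 0
  empty' := by
    have : (hw.indicator MeasurableSet.empty).toLp _ = (0 : Lp ℝ q μ) :=
      toLp_eq_zero_of_ae_eq _ (by rw [indicator_empty]; exact EventuallyEq.rfl)
    rw [dif_pos MeasurableSet.empty, this, map_zero]
  not_measurable' A hA := by simp [hA]
  m_iUnion' A hA hdisj := by
    have hfin : ∀ s : Finset ℕ, MeasurableSet (⋃ i ∈ s, A i) := fun s =>
      s.measurableSet_biUnion fun i _ => hA i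
    have hlim := tendsto_dual_of_dominated hq' Λ (l := atTop)
      (F := fun s : Finset ℕ => (⋃ i ∈ s, A i).indicator w) (f := (⋃ i, A i).indicator w) (b := w)
      (fun s => hw.indicator (hfin s)) (hw.indicator (MeasurableSet.iUnion hA)) hw
      (fun s x => norm_indicator_le_norm_self w x) (fun x => norm_indicator_le_norm_self w x)
      (fun x => (tendsto_indicator_biUnion_finset A w x).mono_right (by simp))
    simp only [hA, MeasurableSet.iUnion hA, dif_pos]
    refine hlim.congr fun s => ?_
    rw [← map_sum]
    congr 1
    induction s using Finset.induction_on with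
    | empty =>
      rw [Finset.sum_empty]
      exact toLp_eq_zero_of_ae_eq _ (by
        simp only [indicator_empty, Finset.notMem_empty, iUnion_of_empty, iUnion_empty]
        exact EventuallyEq.rfl)
    | insert i s hi ih =>
      rw [Finset.sum_insert hi, ← ih, ← MemLp.toLp_add]
      congr 1
      rw [Finset.set_biUnion_insert, indicator_union_of_disjoint]
      · rfl
      · rw [disjoint_iUnion₂_right]
        intro j hj
        exact hdisj fun h => hi (h ▸ hj)

theorem dualSignedMeasure_apply [Fact (1 ≤ q)] (hq' : q ≠ ∞) (Λ : Lp ℝ q μ →L[ℝ] ℝ)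
    {w : α → ℝ} (hw : MemLp w q μ) {A : Set α} (hA : MeasurableSet A) :
    dualSignedMeasure hq' Λ hw A = Λ ((hw.indicator hA).toLp _) := by
  classical
  exact dif_pos hA

theorem exists_density_of_dual [Fact (1 ≤ q)] [SigmaFinite μ] (hq' : q ≠ ∞)
    (Λ : Lp ℝ q μ →L[ℝ] ℝ) {w : α → ℝ} (hw : MemLp w q μ) :
    ∃ g : α → ℝ, Measurable g ∧ Integrable g μ ∧
      ∀ A, ∀ hA : MeasurableSet A, Λ ((hw.indicator hA).toLp _) = ∫ x in A, g x ∂μ := by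
  set s := dualSignedMeasure hq' Λ hw with hs
  have hac : VectorMeasure.AbsolutelyContinuous s μ.toENNRealVectorMeasure := by
    refine VectorMeasure.AbsolutelyContinuous.mk fun A hA h0 => ?_
    rw [Measure.toENNRealVectorMeasure_apply_measurable hA] at h0
    rw [hs, dualSignedMeasure_apply hq' Λ hw hA]
    have : (hw.indicator hA).toLp _ = (0 : Lp ℝ q μ) :=
      toLp_eq_zero_of_ae_eq _ (indicator_meas_zero h0)
    rw [this, map_zero]
  refine ⟨s.rnDeriv μ, SignedMeasure.measurable_rnDeriv _ _, SignedMeasure.integrable_rnDeriv _ _,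
    fun A hA => ?_⟩
  rw [← dualSignedMeasure_apply hq' Λ hw hA, ← hs]
  conv_lhs => rw [← (SignedMeasure.absolutelyContinuous_iff_withDensityᵥ_rnDeriv_eq s μ).1 hac]
  rw [withDensityᵥ_apply (SignedMeasure.integrable_rnDeriv _ _) hA]

end LpDuality

section LpDuality

variable {α : Type*} [MeasurableSpace α] {μ : Measure α} {p q : ℝ≥0∞}

theorem memLp_bdd_mul {F w : α → ℝ} (hF : Measurable F) {C : ℝ} (hC : ∀ x, |F x| ≤ C)
    (hw : MemLp w q μ) : MemLp (fun x => F x * w x) q μ := by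
  refine (hw.const_mul C).of_le (hF.aestronglyMeasurable.mul hw.1) (Eventually.of_forall fun x => ?_)
  rw [norm_mul, norm_mul]
  gcongr
  exact (hC x).trans (le_abs_self C)

theorem dual_eq_integral_of_bdd [Fact (1 ≤ q)] (hq' : q ≠ ∞)
    (Λ : Lp ℝ q μ →L[ℝ] ℝ) {w g : α → ℝ} (hw : MemLp w q μ) (hg : Integrable g μ)
    (h : ∀ A, ∀ hA : MeasurableSet A, Λ ((hw.indicator hA).toLp _) = ∫ x in A, g x ∂μ)
    {F : α → ℝ} (hF : Measurable F) {C : ℝ} (hC : ∀ x, |F x| ≤ C) :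
    Λ ((memLp_bdd_mul hF hC hw).toLp _) = ∫ x, F x * g x ∂μ := by
  have hC0 : 0 ≤ C ∨ IsEmpty α := by
    rcases isEmpty_or_nonempty α with h | ⟨⟨x⟩⟩
    · exact Or.inr h
    · exact Or.inl ((abs_nonneg _).trans (hC x))
  rcases hC0 with hC0 | hemp
  swap
  · rw [toLp_eq_zero_of_ae_eq _ (Eventually.of_forall fun x => hemp.elim x), map_zero,
      integral_of_isEmpty]
  have hsimple : ∀ f : SimpleFunc α ℝ, ∀ hf : MemLp (fun x => f x * w x) q μ,
      Λ (hf.toLp _) = ∫ x, f x * g x ∂μ := by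
    intro f
    have hbd : ∀ f : SimpleFunc α ℝ, ∃ C, ∀ x, |f x| ≤ C := fun f =>
      f.exists_forall_norm_le
    induction f using SimpleFunc.induction with
    | @const c s hs =>
      intro hf
      have e1 : hf.toLp _ = c • ((hw.indicator hs).toLp _) := by
        rw [← MemLp.toLp_const_smul]
        refine (MemLp.toLp_eq_toLp_iff _ _).2 (Eventually.of_forall fun x => ?_)
        by_cases hx : x ∈ s <;> simp [hx]
      rw [e1, map_smul, h s hs, smul_eq_mul, ← integral_const_mul, ← integral_indicator hs]
      refine integral_congr_ae (Eventually.of_forall fun x => ?_)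
      by_cases hx : x ∈ s <;> simp [hx]
    | @add f₁ f₂ _ h₁ h₂ =>
      intro hf
      obtain ⟨C₁, hC₁⟩ := hbd f₁
      obtain ⟨C₂, hC₂⟩ := hbd f₂
      have m₁ := memLp_bdd_mul f₁.measurable hC₁ hw
      have m₂ := memLp_bdd_mul f₂.measurable hC₂ hw
      have i₁ : Integrable (fun x => f₁ x * g x) μ :=
        hg.bdd_mul f₁.measurable.aestronglyMeasurable (Eventually.of_forall hC₁)
      have i₂ : Integrable (fun x => f₂ x * g x) μ :=
        hg.bdd_mul f₂.measurable.aestronglyMeasurable (Eventually.of_forall hC₂)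
      have e1 : hf.toLp _ = m₁.toLp _ + m₂.toLp _ := by
        rw [← MemLp.toLp_add]
        refine (MemLp.toLp_eq_toLp_iff _ _).2 (Eventually.of_forall fun x => ?_)
        simp [add_mul]
      rw [e1, map_add, h₁ m₁, h₂ m₂, ← integral_add i₁ i₂]
      refine integral_congr_ae (Eventually.of_forall fun x => ?_)
      simp [add_mul]
  have hFs := hF.stronglyMeasurable
  set f : ℕ → SimpleFunc α ℝ := hFs.approxBounded C with hf
  have hfC : ∀ j x, |f j x| ≤ C := fun j x => hFs.norm_approxBounded_le hC0 j x
  have hfl : ∀ x, Tendsto (fun j => f j x) atTop (𝓝 (F x)) := fun x =>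
    hFs.tendsto_approxBounded_of_norm_le (hC x)
  have l1 := tendsto_dual_of_dominated hq' Λ (l := atTop) (F := fun j x => f j x * w x)
    (f := fun x => F x * w x) (b := fun x => C * w x)
    (fun j => memLp_bdd_mul (f j).measurable (hfC j) hw) (memLp_bdd_mul hF hC hw)
    (hw.const_mul C)
    (fun j x => by
      rw [abs_mul, abs_mul]
      exact mul_le_mul_of_nonneg_right ((hfC j x).trans (le_abs_self C)) (abs_nonneg _))
    (fun x => by
      rw [abs_mul, abs_mul]
      exact mul_le_mul_of_nonneg_right ((hC x).trans (le_abs_self C)) (abs_nonneg _))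
    (fun x => (hfl x).mul_const _)
  have l2 : Tendsto (fun j => ∫ x, f j x * g x ∂μ) atTop (𝓝 (∫ x, F x * g x ∂μ)) := by
    refine tendsto_integral_of_dominated_convergence (fun x => C * ‖g x‖)
      (fun j => (f j).measurable.aestronglyMeasurable.mul hg.1) (hg.norm.const_mul C)
      (fun j => Eventually.of_forall fun x => ?_)
      (Eventually.of_forall fun x => (hfl x).mul_const _)
    rw [norm_mul]
    gcongr
    exact hfC j x
  refine tendsto_nhds_unique l1 (l2.congr fun j => ?_)
  exact (hsimple (f j) _).symm

theorem ennreal_le_rpow_of_le_mul_rpow {P Q : ℝ} (hPQ : P.HolderConjugate Q) {I L : ℝ≥0∞}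
    (hI : I ≠ ∞) (h : I ≤ L * I ^ (1 / Q)) : I ≤ L ^ P := by
  rcases eq_or_ne I 0 with rfl | h0
  · exact zero_le
  have h1 : I ^ (1 / P) * I ^ (1 / Q) = I := by
    rw [← ENNReal.rpow_add _ _ h0 hI, one_div, one_div, hPQ.inv_add_inv_eq_one, ENNReal.rpow_one]
  have h2 : I ^ (1 / P) ≤ L := by
    rw [← ENNReal.mul_le_mul_iff_left (c := I ^ (1 / Q)), h1]
    · exact h
    · simp [ENNReal.rpow_eq_zero_iff, h0, hI]
    · exact ENNReal.rpow_ne_top_of_nonneg (one_div_nonneg.2 hPQ.symm.nonneg) hI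
  calc I = (I ^ (1 / P)) ^ P := by
        rw [← ENNReal.rpow_mul, one_div, inv_mul_cancel₀ hPQ.ne_zero, ENNReal.rpow_one]
    _ ≤ L ^ P := ENNReal.rpow_le_rpow h2 hPQ.nonneg

theorem exists_memLp_of_dual [Fact (1 ≤ q)] [SigmaFinite μ] (hp' : p ≠ ∞) (hq' : q ≠ ∞)
    (hpq : p.toReal.HolderConjugate q.toReal) (Λ : Lp ℝ q μ →L[ℝ] ℝ) {w : α → ℝ}
    (hwm : Measurable w) (hw0 : ∀ x, 0 < w x) (hw : MemLp w q μ) :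
    ∃ g : α → ℝ, Measurable g ∧ MemLp g p μ ∧ ∀ (F : α → ℝ) (hF : Measurable F) (C : ℝ)
      (hC : ∀ x, |F x| ≤ C),
      Λ ((memLp_bdd_mul hF hC hw).toLp _) = ∫ x, F x * w x * g x ∂μ := by
  have hp : 1 ≤ p := one_le_of_holderConjugate hp' hpq
  have hq : 1 ≤ q := Fact.out
  obtain ⟨g₀, hg₀m, hg₀i, hg₀⟩ := exists_density_of_dual hq' Λ hw
  set g : α → ℝ := fun x => g₀ x / w x with hg
  have hgm : Measurable g := hg₀m.div hwm
  have hrep : ∀ (F : α → ℝ) (hF : Measurable F) (C : ℝ) (hC : ∀ x, |F x| ≤ C),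
      Λ ((memLp_bdd_mul hF hC hw).toLp _) = ∫ x, F x * w x * g x ∂μ := by
    intro F hF C hC
    rw [dual_eq_integral_of_bdd hq' Λ hw hg₀i hg₀ hF hC]
    refine integral_congr_ae (Eventually.of_forall fun x => ?_)
    have := (hw0 x).ne'
    simp only [hg]
    field_simp
  refine ⟨g, hgm, ⟨hgm.aestronglyMeasurable, ?_⟩, hrep⟩
  set A : ℕ → Set α := fun k => {x | |g x| ≤ k ∧ (1 : ℝ) ≤ k * w x} with hA
  have hAm : ∀ k, MeasurableSet (A k) := fun k =>
    (measurableSet_le hgm.abs measurable_const).inter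
      (measurableSet_le measurable_const (hwm.const_mul _))
  have hbound : ∀ k : ℕ, ∫⁻ x, (A k).indicator (fun x => ‖g x‖ₑ ^ p.toReal) x ∂μ ≤
      ‖Λ‖ₑ ^ p.toReal := by
    intro k
    set F : α → ℝ := (A k).indicator fun x => dualPow p.toReal (g x) / w x with hF
    have hFm : Measurable F :=
      (((measurable_dualPow _).comp hgm).div hwm).indicator (hAm k)
    have hFC : ∀ x, |F x| ≤ (k : ℝ) ^ (p.toReal - 1) * k := by
      intro x
      by_cases hx : x ∈ A k
      · simp only [hF]
        rw [indicator_of_mem hx, abs_div, abs_dualPow hpq.lt, abs_of_pos (hw0 x),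
          div_le_iff₀ (hw0 x), mul_assoc]
        have h1 : |g x| ^ (p.toReal - 1) ≤ (k : ℝ) ^ (p.toReal - 1) :=
          Real.rpow_le_rpow (abs_nonneg _) hx.1 (sub_nonneg.2 hpq.lt.le)
        calc |g x| ^ (p.toReal - 1) ≤ (k : ℝ) ^ (p.toReal - 1) * 1 := by rw [mul_one]; exact h1
          _ ≤ _ := mul_le_mul_of_nonneg_left hx.2 (by positivity)
      · simp only [hF]
        rw [indicator_of_notMem hx, abs_zero]
        positivity
    have hFw : MemLp (fun x => F x * w x) q μ := memLp_bdd_mul hFm hFC hw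
    have hFwe : ∀ x, F x * w x = (A k).indicator (fun x => dualPow p.toReal (g x)) x := by
      intro x
      have := (hw0 x).ne'
      by_cases hx : x ∈ A k <;> simp only [hF, hx, indicator_of_mem, indicator_of_notMem,
        not_false_eq_true, zero_mul]
      field_simp
    set I := ∫⁻ x, (A k).indicator (fun x => ‖g x‖ₑ ^ p.toReal) x ∂μ with hI
    have hIq : ∫⁻ x, ‖F x * w x‖ₑ ^ q.toReal ∂μ = I := by
      refine lintegral_congr fun x => ?_
      rw [hFwe]
      by_cases hx : x ∈ A k
      · rw [indicator_of_mem hx, indicator_of_mem hx, enorm_dualPow_rpow hpq]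
      · rw [indicator_of_notMem hx, indicator_of_notMem hx, enorm_zero,
          ENNReal.zero_rpow_of_pos hpq.symm.pos]
    have hIfin : I ≠ ∞ := by
      rw [← hIq]
      exact (lintegral_rpow_enorm_lt_top hq hq' hFw).ne
    have hIΛ : I = ENNReal.ofReal (Λ (hFw.toLp _)) := by
      have e1 : ∀ x, F x * w x * g x = (A k).indicator (fun x => |g x| ^ p.toReal) x := by
        intro x
        rw [hFwe]
        by_cases hx : x ∈ A k <;> simp only [hx, indicator_of_mem, indicator_of_notMem,
          not_false_eq_true, zero_mul, dualPow_mul_self hpq.pos]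
      rw [hrep F hFm _ hFC, integral_congr_ae (Eventually.of_forall e1),
        integral_eq_lintegral_of_nonneg_ae
          (Eventually.of_forall fun x => indicator_nonneg (fun _ _ => by positivity) x)
          ((by fun_prop : Measurable fun x => |g x| ^ p.toReal).indicator
            (hAm k)).aestronglyMeasurable]
      have e2 : ∫⁻ x, ENNReal.ofReal ((A k).indicator (fun x => |g x| ^ p.toReal) x) ∂μ = I := by
        refine lintegral_congr fun x => ?_
        by_cases hx : x ∈ A k
        · rw [indicator_of_mem hx, indicator_of_mem hx, Real.enorm_eq_ofReal_abs,
            ENNReal.ofReal_rpow_of_nonneg (abs_nonneg _) hpq.nonneg]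
        · rw [indicator_of_notMem hx, indicator_of_notMem hx, ENNReal.ofReal_zero]
      rw [e2, ENNReal.ofReal_toReal hIfin]
    refine ennreal_le_rpow_of_le_mul_rpow hpq hIfin ?_
    calc I = ENNReal.ofReal (Λ (hFw.toLp _)) := hIΛ
      _ ≤ ‖Λ (hFw.toLp _)‖ₑ := by
          rw [Real.enorm_eq_ofReal_abs]
          exact ENNReal.ofReal_le_ofReal (le_abs_self _)
      _ ≤ ‖Λ‖ₑ * ‖hFw.toLp _‖ₑ := Λ.le_opENorm _
      _ = ‖Λ‖ₑ * I ^ (1 / q.toReal) := by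
          rw [Lp.enorm_toLp, eLpNorm_eq_lintegral_rpow_enorm_toReal
            (one_pos.trans_le hq).ne' hq', hIq]
  have hlim : ∀ x, Tendsto (fun k => (A k).indicator (fun x => ‖g x‖ₑ ^ p.toReal) x) atTop
      (𝓝 (‖g x‖ₑ ^ p.toReal)) := by
    intro x
    refine tendsto_const_nhds.congr' ?_
    filter_upwards [eventually_ge_atTop (max ⌈|g x|⌉₊ ⌈(w x)⁻¹⌉₊)] with k hk
    rw [indicator_of_mem]
    refine ⟨(Nat.le_ceil _).trans (Nat.cast_le.2 ((le_max_left _ _).trans hk)), ?_⟩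
    have h1 : (w x)⁻¹ ≤ k := (Nat.le_ceil _).trans (Nat.cast_le.2 ((le_max_right _ _).trans hk))
    rwa [inv_le_iff_one_le_mul₀ (hw0 x)] at h1
  have hfin : ∫⁻ x, ‖g x‖ₑ ^ p.toReal ∂μ ≤ ‖Λ‖ₑ ^ p.toReal := by
    calc ∫⁻ x, ‖g x‖ₑ ^ p.toReal ∂μ
        = ∫⁻ x, liminf (fun k => (A k).indicator (fun x => ‖g x‖ₑ ^ p.toReal) x) atTop ∂μ :=
          lintegral_congr fun x => (hlim x).liminf_eq.symm
      _ ≤ liminf (fun k => ∫⁻ x, (A k).indicator (fun x => ‖g x‖ₑ ^ p.toReal) x ∂μ) atTop :=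
          lintegral_liminf_le fun k => (by fun_prop : Measurable fun x =>
            ‖g x‖ₑ ^ p.toReal).indicator (hAm k)
      _ ≤ _ := liminf_le_of_le (by isBoundedDefault) fun b hb => by
          obtain ⟨k, hk⟩ := hb.exists
          exact hk.trans (hbound k)
  rw [eLpNorm_lt_top_iff_lintegral_rpow_enorm_lt_top (one_pos.trans_le hp).ne' hp']
  exact hfin.trans_lt (ENNReal.rpow_lt_top_of_nonneg hpq.nonneg enorm_ne_top)

end LpDuality

section EuclDuality

variable {n : ℕ} {p q : ℝ≥0∞}

/-- Every bounded linear functional on `L^q(ℝⁿ)` is given on continuous functions with compact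
support by a function in `L^p(ℝⁿ)`, where `p` is the conjugate exponent. -/
theorem exists_memLp_of_dual_eucl [Fact (1 ≤ q)] (hp' : p ≠ ∞) (hq' : q ≠ ∞)
    (hpq : p.toReal.HolderConjugate q.toReal) (Λ : Lp ℝ q (volume : Measure (Eucl n)) →L[ℝ] ℝ) :
    ∃ g : Eucl n → ℝ, Measurable g ∧ MemLp g p volume ∧ ∀ φ : Eucl n → ℝ, Continuous φ →
      HasCompactSupport φ → ∀ hφ : MemLp φ q volume, Λ (hφ.toLp φ) = ∫ x, φ x * g x := by
  have hq : 1 ≤ q := Fact.out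
  set w : Eucl n → ℝ := fun x => (1 + ‖x‖) ^ (-((n : ℝ) + 1)) with hw
  have hwc : Continuous w := by
    refine Continuous.rpow_const (by fun_prop) fun x => Or.inl ?_
    positivity
  have hw0 : ∀ x, 0 < w x := fun x => by positivity
  have hw1 : ∀ x, w x ≤ 1 := fun x =>
    Real.rpow_le_one_of_one_le_of_nonpos (by linarith [norm_nonneg x])
      (by linarith [n.cast_nonneg (α := ℝ)])
  have hwi : Integrable w volume := integrable_one_add_norm (by simp)
  have hwq : MemLp w q volume := by
    refine ⟨hwc.aestronglyMeasurable, ?_⟩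
    rw [eLpNorm_lt_top_iff_lintegral_rpow_enorm_lt_top (one_pos.trans_le hq).ne' hq']
    refine lt_of_le_of_lt (lintegral_mono fun x => ?_) hwi.2
    have h1 : ‖w x‖ₑ ≤ 1 := by
      rw [Real.enorm_eq_ofReal_abs, abs_of_pos (hw0 x)]
      exact ENNReal.ofReal_le_one.2 (hw1 x)
    calc ‖w x‖ₑ ^ q.toReal ≤ ‖w x‖ₑ ^ (1 : ℝ) :=
          ENNReal.rpow_le_rpow_of_exponent_ge h1 hpq.symm.lt.le
      _ = ‖w x‖ₑ := ENNReal.rpow_one _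
  obtain ⟨g, hgm, hgp, hg⟩ := exists_memLp_of_dual hp' hq' hpq Λ hwc.measurable hw0 hwq
  refine ⟨g, hgm, hgp, fun φ hφc hφs hφ => ?_⟩
  have hFc : Continuous fun x => φ x / w x := hφc.div hwc fun x => (hw0 x).ne'
  have hFs : HasCompactSupport fun x => φ x / w x := by
    simp only [div_eq_mul_inv]
    exact hφs.mul_right
  obtain ⟨C, hC⟩ := hFc.bounded_above_of_compact_support hFs
  have hrep := hg _ hFc.measurable C hC
  have he : ∀ x, φ x / w x * w x = φ x := fun x => div_mul_cancel₀ _ (hw0 x).ne'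
  simp only [he] at hrep
  exact hrep

end EuclDuality

/-! ### Density of Lipschitz functions with compact support -/

section LipschitzDense

open scoped NNReal

variable {α : Type*} [MetricSpace α] [ProperSpace α] [MeasurableSpace α] [BorelSpace α]
  {μ : Measure α} [μ.Regular] {p : ℝ≥0∞}

theorem exists_lipschitz_eLpNorm_sub_indicator_le (hp' : p ≠ ∞) (c : ℝ) {s : Set α}
    (hs : IsCompact s) {ε : ℝ≥0∞} (hε : ε ≠ 0) :
    ∃ g : α → ℝ, eLpNorm (g - s.indicator fun _ => c) p μ ≤ ε ∧
      (∃ K : ℝ≥0, LipschitzWith K g) ∧ HasCompactSupport g := by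
  obtain ⟨η, hη0, hη⟩ := exists_eLpNorm_indicator_le (μ := μ) hp' c hε
  have hη1 : (0 : ℝ≥0∞) < η := ENNReal.coe_pos.2 hη0
  have hfin : μ s ≠ ∞ := hs.measure_lt_top.ne
  have hev : ∀ᶠ r in 𝓝[>] (0 : ℝ), μ (Metric.cthickening r s) < μ s + η :=
    ((tendsto_measure_cthickening_of_isCompact hs).mono_left nhdsWithin_le_nhds).eventually_lt_const
      (ENNReal.lt_add_right hfin hη1.ne')
  obtain ⟨r, hr, hr0⟩ := (hev.and self_mem_nhdsWithin).exists
  have hr0 : 0 < r := hr0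
  have hsub : s ⊆ Metric.cthickening r s := Metric.self_subset_cthickening s
  have hdiff : μ (Metric.cthickening r s \ s) ≤ η := by
    rw [measure_sdiff hsub hs.isClosed.nullMeasurableSet hfin]
    exact tsub_le_iff_left.2 hr.le
  have hzero : ∀ x ∉ Metric.cthickening r s, thickenedIndicator hr0 s x = 0 := fun x hx =>
    thickenedIndicator_zero hr0 s fun h => hx (Metric.thickening_subset_cthickening _ _ h)
  refine ⟨fun x => c * thickenedIndicator hr0 s x, (eLpNorm_mono fun x => ?_).trans (hη _ hdiff),
    ⟨‖c‖₊ * (r.toNNReal)⁻¹, ?_⟩, ?_⟩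
  · have hle : (thickenedIndicator hr0 s x : ℝ) ≤ 1 := thickenedIndicator_le_one hr0 s x
    by_cases hxs : x ∈ s
    · simp only [Pi.sub_apply, thickenedIndicator_one hr0 s hxs, indicator_of_mem hxs]
      simp
    by_cases hxt : x ∈ Metric.cthickening r s
    · have : x ∈ Metric.cthickening r s \ s := ⟨hxt, hxs⟩
      simp only [Pi.sub_apply, indicator_of_notMem hxs, sub_zero, indicator_of_mem this, norm_mul]
      refine mul_le_of_le_one_right (norm_nonneg _) ?_
      rw [Real.norm_eq_abs, abs_of_nonneg (NNReal.coe_nonneg _)]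
      exact hle
    · simp only [Pi.sub_apply, hzero x hxt, indicator_of_notMem hxs]
      simp
  · refine LipschitzWith.of_dist_le_mul fun x y => ?_
    have h1 := (lipschitzWith_thickenedIndicator hr0 s).dist_le_mul x y
    rw [NNReal.dist_eq] at h1
    rw [Real.dist_eq, ← mul_sub, abs_mul]
    push_cast
    rw [mul_assoc]
    exact mul_le_mul_of_nonneg_left (by simpa using h1) (abs_nonneg c)
  · refine HasCompactSupport.intro (K := Metric.cthickening r s) hs.cthickening fun x hx => ?_
    rw [hzero x hx]
    simp

theorem MeasureTheory.MemLp.exists_lipschitz_hasCompactSupport (hp' : p ≠ ∞) {f : α → ℝ}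
    (hf : MemLp f p μ) {ε : ℝ≥0∞} (hε : ε ≠ 0) :
    ∃ g : α → ℝ, eLpNorm (f - g) p μ ≤ ε ∧ (∃ K : ℝ≥0, LipschitzWith K g) ∧
      HasCompactSupport g := by
  refine hf.induction_dense hp'
    (fun g : α → ℝ => (∃ K : ℝ≥0, LipschitzWith K g) ∧ HasCompactSupport g) ?_ ?_ ?_ hε
  · intro c t ht htμ ε hε
    obtain ⟨δ, hδ, hδ2⟩ := exists_Lp_half ℝ μ p hε
    obtain ⟨η, hη0, hη⟩ := exists_eLpNorm_indicator_le (μ := μ) hp' c hδ.ne'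
    obtain ⟨s, hst, hsc, -, hμs⟩ :=
      ht.exists_isCompact_isClosed_sdiff_lt htμ.ne (ENNReal.coe_pos.2 hη0).ne'
    obtain ⟨g, hg, ⟨K, hK⟩, hgc⟩ := exists_lipschitz_eLpNorm_sub_indicator_le hp' c hsc hδ.ne'
      (μ := μ)
    refine ⟨g, ?_, ⟨K, hK⟩, hgc⟩
    have I1 : eLpNorm ((s.indicator fun _ => c) - t.indicator fun _ => c) p μ ≤ δ := by
      rw [← eLpNorm_neg, neg_sub, ← indicator_sdiff hst]
      exact hη _ hμs.le
    have hms := hsc.measurableSet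
    have h := (hδ2 _ _ (hK.continuous.aestronglyMeasurable.sub
      (aestronglyMeasurable_const.indicator hms)) ((aestronglyMeasurable_const.indicator hms).sub
      (aestronglyMeasurable_const.indicator ht)) hg I1).le
    simpa using h
  · rintro f g ⟨⟨K, hK⟩, hf⟩ ⟨⟨L, hL⟩, hg⟩
    exact ⟨⟨K + L, hK.add hL⟩, hf.add hg⟩
  · rintro f ⟨⟨K, hK⟩, -⟩
    exact hK.continuous.aestronglyMeasurable

end LipschitzDense

/-! ### Pairings with difference quotients -/

section Pairing

variable {n : ℕ} {p q : ℝ≥0∞}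

theorem lintegral_enorm_mul_le {α : Type*} [MeasurableSpace α] {μ : Measure α} {P Q : ℝ}
    (hPQ : P.HolderConjugate Q) {f g : α → ℝ} (hf : AEMeasurable f μ) (hg : AEMeasurable g μ) :
    ∫⁻ x, ‖f x * g x‖ₑ ∂μ ≤
      (∫⁻ x, ‖f x‖ₑ ^ P ∂μ) ^ (1 / P) * (∫⁻ x, ‖g x‖ₑ ^ Q ∂μ) ^ (1 / Q) := by
  simp only [enorm_mul]
  exact ENNReal.lintegral_mul_le_Lp_mul_Lq μ hPQ hf.enorm hg.enorm

theorem integrable_mul_of_lintegral_rpow {α : Type*} [MeasurableSpace α] {μ : Measure α} {P Q : ℝ}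
    (hPQ : P.HolderConjugate Q) {f g : α → ℝ} (hf : Measurable f) (hg : Measurable g)
    (hf2 : ∫⁻ x, ‖f x‖ₑ ^ P ∂μ ≠ ∞) (hg2 : ∫⁻ x, ‖g x‖ₑ ^ Q ∂μ ≠ ∞) :
    Integrable (fun x => f x * g x) μ := by
  refine ⟨(hf.mul hg).aestronglyMeasurable, (lintegral_enorm_mul_le hPQ hf.aemeasurable
    hg.aemeasurable).trans_lt (ENNReal.mul_lt_top ?_ ?_)⟩
  · exact ENNReal.rpow_lt_top_of_nonneg (one_div_nonneg.2 hPQ.nonneg) hf2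
  · exact ENNReal.rpow_lt_top_of_nonneg (one_div_nonneg.2 hPQ.symm.nonneg) hg2

/-- The product of Lebesgue measure and the surface measure. -/
noncomputable def bundleMeasure (n : ℕ) : Measure (Eucl n × USphere n) :=
  (volume : Measure (Eucl n)).prod (surfaceMeasure n)

/-- `(x, h) ↦ (x, h / |h|)`. -/
noncomputable def toDir [NeZero n] (z : Eucl n × Eucl n) : Eucl n × USphere n := (z.1, dir z.2)

theorem measurable_toDir [NeZero n] : Measurable (toDir (n := n)) :=
  measurable_fst.prodMk (measurable_dir.comp measurable_snd)

theorem measurePreserving_toDir [NeZero n] {t : ℝ} (ht : 0 < t) :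
    MeasurePreserving toDir (pairMeasure n t) (bundleMeasure n) := by
  have := isFiniteMeasure_radialMeasure (n := n) ht
  exact (MeasurePreserving.id volume).prod (measurePreserving_dir ht)

theorem lintegral_toDir [NeZero n] {t : ℝ} (ht : 0 < t) {f : Eucl n × USphere n → ℝ≥0∞}
    (hf : Measurable f) : ∫⁻ z, f (toDir z) ∂(pairMeasure n t) = ∫⁻ z, f z ∂(bundleMeasure n) :=
  (measurePreserving_toDir ht).lintegral_comp hf

theorem lintegral_fst_pairMeasure [NeZero n] {t : ℝ} (ht : 0 < t) {f : Eucl n → ℝ≥0∞}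
    (hf : Measurable f) :
    ∫⁻ z, f z.1 ∂(pairMeasure n t) = (∫⁻ x, f x) * surfaceMeasure n univ := by
  rw [lintegral_pairMeasure (f := fun z => f z.1) (hf.comp measurable_fst)]
  simp only [lintegral_const, radialMeasure_univ ht]
  exact lintegral_mul_const _ hf

theorem integral_diffQuot_mul {w G : Eucl n → ℝ} (hw : LocallyIntegrable w volume)
    (hG : Continuous G) (hGc : HasCompactSupport G) (h : Eucl n) :
    ∫ x, diffQuot w (x, h) * G x = ∫ x, w x * ((G x - G (x + h)) / ‖h‖) := by
  have i1 : Integrable (fun x => G x * w x) volume :=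
    hw.integrable_smul_left_of_hasCompactSupport hG hGc
  have i2 : Integrable (fun x => G (x + h) * w x) volume :=
    hw.integrable_smul_left_of_hasCompactSupport (by fun_prop)
      (hGc.comp_homeomorph (Homeomorph.addRight h))
  have i3 : Integrable (fun x => G x * w (x - h)) volume := by
    have := i2.comp_sub_right h
    simpa using this
  have e1 : ∫ x, G x * w (x - h) = ∫ x, G (x + h) * w x := by
    rw [← integral_add_right_eq_self (fun x => G x * w (x - h)) h]
    simp
  calc ∫ x, diffQuot w (x, h) * G x = ∫ x, ‖h‖⁻¹ * (G x * w x - G x * w (x - h)) := by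
        refine integral_congr_ae (Eventually.of_forall fun x => ?_)
        simp only [diffQuot, div_eq_inv_mul]
        ring
    _ = ∫ x, ‖h‖⁻¹ * (G x * w x - G (x + h) * w x) := by
        rw [integral_const_mul, integral_const_mul, integral_sub i1 i3, integral_sub i1 i2, e1]
    _ = _ := by
        refine integral_congr_ae (Eventually.of_forall fun x => ?_)
        simp only [div_eq_inv_mul]
        ring

theorem enorm_integral_diffQuot_lipschitz_le [NeZero n] {w : Eucl n → ℝ}
    (hw : LocallyIntegrable w volume) {G : Eucl n × USphere n → ℝ} {K R : ℝ}
    (hGc : Continuous G) (hGK : ∀ x y ω, |G (x, ω) - G (y, ω)| ≤ K * ‖x - y‖)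
    (hGR : ∀ x ω, R ≤ ‖x‖ → G (x, ω) = 0) {t : ℝ} (ht : 0 < t) :
    ‖∫ z, diffQuot w z * G (toDir z) ∂(pairMeasure n t)‖ₑ ≤
      ENNReal.ofReal K * surfaceMeasure n univ *
        ∫⁻ x in Metric.closedBall 0 (R + 1), ‖w x‖ₑ := by
  by_cases hint : Integrable (fun z => diffQuot w z * G (toDir z)) (pairMeasure n t)
  swap
  · rw [integral_undef hint, enorm_zero]
    exact zero_le
  set B := Metric.closedBall (0 : Eucl n) (R + 1) with hB
  have hBm : MeasurableSet B := Metric.isClosed_closedBall.measurableSet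
  have hinner : ∀ᵐ h ∂(radialMeasure n t),
      ‖∫ x, diffQuot w (x, h) * G (toDir (x, h))‖ₑ ≤
        ENNReal.ofReal K * ∫⁻ x in B, ‖w x‖ₑ := by
    filter_upwards [ae_radialMeasure_norm_pos_lt t] with h hh
    have hpos : 0 < ‖h‖ := norm_pos_iff.2 hh.1
    have hcs : HasCompactSupport fun x => G (x, dir h) :=
      HasCompactSupport.intro (isCompact_closedBall (0 : Eucl n) R) fun x hx => hGR x _ (by
        rw [mem_closedBall_zero_iff, not_le] at hx
        exact hx.le)
    have e1 := integral_diffQuot_mul hw (G := fun x => G (x, dir h)) (by fun_prop) hcs h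
    simp only [toDir]
    rw [e1]
    refine (enorm_integral_le_lintegral_enorm _).trans ?_
    rw [← lintegral_const_mul' _ _ ENNReal.ofReal_ne_top, ← lintegral_indicator hBm]
    refine lintegral_mono fun x => ?_
    by_cases hx : x ∈ B
    · rw [indicator_of_mem hx, enorm_mul, mul_comm]
      gcongr
      rw [Real.enorm_eq_ofReal_abs]
      refine ENNReal.ofReal_le_ofReal ?_
      rw [abs_div, abs_norm, div_le_iff₀ hpos]
      simpa using hGK x (x + h) (dir h)
    · rw [indicator_of_notMem hx]
      rw [hB, mem_closedBall_zero_iff, not_le] at hx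
      have h1 : R ≤ ‖x + h‖ := by
        have := norm_sub_le (x + h) h
        rw [add_sub_cancel_right] at this
        linarith [hh.2]
      rw [hGR x _ (by linarith), hGR (x + h) _ h1]
      simp
  have hsw : ∫ z, diffQuot w z * G (toDir z) ∂(pairMeasure n t) =
      ∫ h, ∫ x, diffQuot w (x, h) * G (toDir (x, h)) ∂volume ∂(radialMeasure n t) :=
    integral_prod_symm _ hint
  rw [hsw]
  calc _ ≤ ∫⁻ h, ‖∫ x, diffQuot w (x, h) * G (toDir (x, h))‖ₑ ∂(radialMeasure n t) :=
        enorm_integral_le_lintegral_enorm _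
    _ ≤ ∫⁻ _, (ENNReal.ofReal K * ∫⁻ x in B, ‖w x‖ₑ) ∂(radialMeasure n t) := lintegral_mono_ae hinner
    _ = _ := by
        rw [lintegral_const, radialMeasure_univ ht]
        ring

instance : IsFiniteMeasureOnCompacts (bundleMeasure n) := by
  unfold bundleMeasure; infer_instance

instance : (bundleMeasure n).Regular := by
  have : IsLocallyFiniteMeasure (bundleMeasure n) := inferInstance
  infer_instance

theorem tendsto_lintegral_closedBall_zero {ι : Type*} {l : Filter ι}
    (hp' : p ≠ ∞) (hpq : p.toReal.HolderConjugate q.toReal) {w : ι → Eucl n → ℝ}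
    (hw : ∀ i, Measurable (w i)) (hw0 : Tendsto (fun i => eLpNorm (w i) p volume) l (𝓝 0)) (R : ℝ) :
    Tendsto (fun i => ∫⁻ x in Metric.closedBall (0 : Eucl n) R, ‖w i x‖ₑ) l (𝓝 0) := by
  have hp := one_le_of_holderConjugate hp' hpq
  set B := Metric.closedBall (0 : Eucl n) R
  have hB : volume B ≠ ∞ := (isCompact_closedBall _ _).measure_lt_top.ne
  have hb : ∀ i, ∫⁻ x in B, ‖w i x‖ₑ ≤
      eLpNorm (w i) p volume * volume B ^ (1 / q.toReal) := by
    intro i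
    have h1 := lintegral_enorm_mul_le hpq (f := w i) (g := fun _ => (1 : ℝ))
      (μ := volume.restrict B) (hw i).aemeasurable aemeasurable_const
    simp only [mul_one, enorm_one, ENNReal.one_rpow, lintegral_const, one_mul,
      Measure.restrict_apply_univ] at h1
    refine h1.trans ?_
    rw [eLpNorm_eq_lintegral_rpow_enorm_toReal (one_pos.trans_le hp).ne' hp']
    have := hpq.pos
    gcongr
    exact Measure.restrict_le_self
  have hlim := ENNReal.Tendsto.mul_const hw0 (b := volume B ^ (1 / q.toReal))
    (Or.inr (ENNReal.rpow_ne_top_of_nonneg (one_div_nonneg.2 hpq.symm.nonneg) hB))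
  rw [zero_mul] at hlim
  exact tendsto_of_tendsto_of_tendsto_of_le_of_le tendsto_const_nhds hlim (fun _ => zero_le) hb

/-- Difference quotients that are bounded in `L^p` of functions converging to zero in `L^p`
converge weakly to zero. -/
theorem tendsto_integral_diffQuot_mul_zero [NeZero n] {ι : Type*} {l : Filter ι}
    (hp' : p ≠ ∞) (hq' : q ≠ ∞) (hpq : p.toReal.HolderConjugate q.toReal) {t : ι → ℝ}
    (ht : ∀ i, 0 < t i) {w : ι → Eucl n → ℝ} (hwm : ∀ i, Measurable (w i))
    (hwp : ∀ i, MemLp (w i) p volume)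
    (hw0 : Tendsto (fun i => eLpNorm (w i) p volume) l (𝓝 0)) {K : ℝ≥0∞} (hK : K ≠ ∞)
    (hwK : ∀ i, ∫⁻ z, ‖diffQuot (w i) z‖ₑ ^ p.toReal ∂(pairMeasure n (t i)) ≤ K)
    {G : Eucl n × USphere n → ℝ} (hGm : Measurable G) (hG : MemLp G q (bundleMeasure n)) :
    Tendsto (fun i => ∫ z, diffQuot (w i) z * G (toDir z) ∂(pairMeasure n (t i))) l (𝓝 0) := by
  have hp := one_le_of_holderConjugate hp' hpq
  have hq := one_le_of_holderConjugate hq' hpq.symm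
  rw [tendsto_zero_iff_enorm_tendsto_zero, ENNReal.tendsto_nhds_zero]
  intro ε hε
  have hKP : K ^ (1 / p.toReal) ≠ ∞ :=
    ENNReal.rpow_ne_top_of_nonneg (one_div_nonneg.2 hpq.nonneg) hK
  obtain ⟨η, hη0, hηK⟩ : ∃ η : ℝ≥0∞, η ≠ 0 ∧ K ^ (1 / p.toReal) * η ≤ ε / 2 := by
    refine ⟨ε / 2 / (K ^ (1 / p.toReal) + 1), ?_, ?_⟩
    · exact (ENNReal.div_pos (ENNReal.half_pos hε.ne').ne'
        (ENNReal.add_ne_top.2 ⟨hKP, ENNReal.one_ne_top⟩)).ne'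
    · calc _ ≤ (K ^ (1 / p.toReal) + 1) * (ε / 2 / (K ^ (1 / p.toReal) + 1)) := by
            gcongr; exact le_self_add
        _ ≤ ε / 2 := ENNReal.mul_div_le
  obtain ⟨g, hgG, ⟨L, hL⟩, hgc⟩ := hG.exists_lipschitz_hasCompactSupport hq' hη0
  obtain ⟨R, hR⟩ := hgc.isCompact.isBounded.subset_ball (0, dir 0)
  have hgR : ∀ x ω, R ≤ ‖x‖ → g (x, ω) = 0 := by
    intro x ω hx
    by_contra hne
    have h1 := hR (subset_tsupport _ (Function.mem_support.2 hne))
    rw [Metric.mem_ball, Prod.dist_eq] at h1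
    have h2 := (le_max_left _ _).trans_lt h1
    simp only [dist_zero_right] at h2
    linarith
  have hgK : ∀ x y ω, |g (x, ω) - g (y, ω)| ≤ (L : ℝ) * ‖x - y‖ := by
    intro x y ω
    have := hL.dist_le_mul (x, ω) (y, ω)
    rwa [Real.dist_eq, Prod.dist_eq, dist_self, max_eq_left dist_nonneg, dist_eq_norm] at this
  have hgm : Measurable g := hL.continuous.measurable
  have hsmall : Tendsto (fun i => ENNReal.ofReal L * surfaceMeasure n univ *
      ∫⁻ x in Metric.closedBall 0 (R + 1), ‖w i x‖ₑ) l (𝓝 0) := by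
    have := ENNReal.Tendsto.const_mul (tendsto_lintegral_closedBall_zero hp' hpq hwm hw0 (R + 1))
      (a := ENNReal.ofReal L * surfaceMeasure n univ)
      (Or.inr (ENNReal.mul_ne_top ENNReal.ofReal_ne_top (measure_ne_top _ _)))
    rwa [mul_zero] at this
  have hGg : ∀ i, (∫⁻ z, ‖(G - g) (toDir z)‖ₑ ^ q.toReal ∂(pairMeasure n (t i))) ^ (1 / q.toReal)
      ≤ η := by
    intro i
    rw [lintegral_toDir (ht i) (f := fun z => ‖(G - g) z‖ₑ ^ q.toReal)
      ((hGm.sub hgm).enorm.pow_const _)]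
    rwa [eLpNorm_eq_lintegral_rpow_enorm_toReal (one_pos.trans_le hq).ne' hq'] at hgG
  filter_upwards [ENNReal.tendsto_nhds_zero.1 hsmall _ (ENNReal.half_pos hε.ne')] with i hi
  have hVm := measurable_diffQuot (hwm i)
  have hVfin := ((hwK i).trans_lt hK.lt_top).ne
  have hgq : MemLp g q (bundleMeasure n) := hL.continuous.memLp_of_hasCompactSupport hgc
  have hfin : ∀ {f : Eucl n × USphere n → ℝ}, Measurable f → MemLp f q (bundleMeasure n) →
      ∫⁻ z, ‖f (toDir z)‖ₑ ^ q.toReal ∂(pairMeasure n (t i)) ≠ ∞ := by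
    intro f hfm hf
    rw [lintegral_toDir (ht i) (f := fun z => ‖f z‖ₑ ^ q.toReal) (hfm.enorm.pow_const _)]
    exact (lintegral_rpow_enorm_lt_top hq hq' hf).ne
  have hdm : Measurable (G - g) := hGm.sub hgm
  have i1 : Integrable (fun z => diffQuot (w i) z * (G - g) (toDir z)) (pairMeasure n (t i)) :=
    integrable_mul_of_lintegral_rpow hpq hVm (hdm.comp measurable_toDir) hVfin
      (hfin hdm (hG.sub hgq))
  have i2 : Integrable (fun z => diffQuot (w i) z * g (toDir z)) (pairMeasure n (t i)) :=
    integrable_mul_of_lintegral_rpow hpq hVm (hgm.comp measurable_toDir) hVfin (hfin hgm hgq)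
  have e1 : ∫ z, diffQuot (w i) z * G (toDir z) ∂(pairMeasure n (t i)) =
      (∫ z, diffQuot (w i) z * (G - g) (toDir z) ∂(pairMeasure n (t i))) +
        ∫ z, diffQuot (w i) z * g (toDir z) ∂(pairMeasure n (t i)) := by
    rw [← integral_add i1 i2]
    refine integral_congr_ae (Eventually.of_forall fun z => ?_)
    simp only [Pi.sub_apply]
    ring
  rw [e1]
  refine (enorm_add_le _ _).trans ?_
  rw [← ENNReal.add_halves ε]
  refine add_le_add ?_ ?_
  · refine (enorm_integral_le_lintegral_enorm _).trans ?_
    refine (lintegral_enorm_mul_le hpq hVm.aemeasurable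
      (hdm.comp measurable_toDir).aemeasurable).trans ?_
    refine le_trans ?_ hηK
    refine mul_le_mul' (ENNReal.rpow_le_rpow (hwK i) (one_div_nonneg.2 hpq.nonneg)) (hGg i)
  · exact (enorm_integral_diffQuot_lipschitz_le ((hwp i).locallyIntegrable hp)
      hL.continuous hgK hgR (ht i)).trans hi

end Pairing

/-! ### Existence of the weak gradient -/

section GradientExistence

variable {n : ℕ} {p q : ℝ≥0∞}

/-- The linear map `v ↦ ∫ (ω · v) ω dω`. -/
noncomputable def sphereSecondMoment (n : ℕ) : Eucl n →ₗ[ℝ] Eucl n where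
  toFun v := ∫ ω : USphere n, inner ℝ (ω : Eucl n) v • (ω : Eucl n) ∂(surfaceMeasure n)
  map_add' v w := by
    simp only [inner_add_right, add_smul]
    refine integral_add ?_ ?_ <;>
    · refine Continuous.integrable_of_hasCompactSupport (by fun_prop) ?_
      exact HasCompactSupport.of_compactSpace _
  map_smul' c v := by
    simp only [inner_smul_right, mul_smul, RingHom.id_apply]
    exact integral_smul _ _

theorem integrable_sphere_of_continuous {F : Type*} [NormedAddCommGroup F] {f : USphere n → F}
    (hf : Continuous f) : Integrable f (surfaceMeasure n) :=
  hf.integrable_of_hasCompactSupport (HasCompactSupport.of_compactSpace _)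

theorem clm_sphereSecondMoment (ℓ : Eucl n →L[ℝ] ℝ) (v : Eucl n) :
    ℓ (sphereSecondMoment n v) =
      ∫ ω : USphere n, inner ℝ (ω : Eucl n) v * ℓ (ω : Eucl n) ∂(surfaceMeasure n) := by
  change ℓ (∫ ω : USphere n, inner ℝ (ω : Eucl n) v • (ω : Eucl n) ∂(surfaceMeasure n)) = _
  rw [← ℓ.integral_comp_comm (integrable_sphere_of_continuous (by fun_prop))]
  simp

theorem sphereSecondMoment_injective [NeZero n] : Function.Injective (sphereSecondMoment n) := by
  rw [← LinearMap.ker_eq_bot, LinearMap.ker_eq_bot']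
  intro v hv
  have h1 := clm_sphereSecondMoment (innerSL ℝ v) v
  rw [hv, map_zero] at h1
  have h2 : ∫ ω : USphere n, (inner ℝ (ω : Eucl n) v : ℝ) ^ 2 ∂(surfaceMeasure n) = 0 := by
    rw [h1]
    refine integral_congr_ae (Eventually.of_forall fun ω => ?_)
    simp only [innerSL_apply_apply]
    rw [real_inner_comm (ω : Eucl n) v, sq]
  rw [integral_eq_zero_iff_of_nonneg (fun ω => sq_nonneg _)
    (integrable_sphere_of_continuous (Continuous.pow (by fun_prop) 2))] at h2
  have hopen : IsOpen {x : Eucl n | (inner ℝ x v : ℝ) ≠ 0} :=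
    isOpen_ne_fun (by fun_prop) continuous_const
  have hnull : (volume : Measure (Eucl n)) {x : Eucl n | (inner ℝ x v : ℝ) ≠ 0} = 0 := by
    rw [volume_eq_zero_iff_polar hopen.measurableSet]
    filter_upwards [h2] with ω hω
    refine Eventually.of_forall fun r _ => ?_
    have : (inner ℝ (ω : Eucl n) v : ℝ) = 0 := by simpa using hω
    simp [inner_smul_left, this]
  have hemp := (hopen.measure_eq_zero_iff volume).1 hnull
  by_contra hv0
  have : v ∈ {x : Eucl n | (inner ℝ x v : ℝ) ≠ 0} := by
    change (inner ℝ v v : ℝ) ≠ 0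
    rwa [ne_eq, inner_self_eq_zero]
  rw [hemp] at this
  exact this

theorem sphereSecondMoment_surjective [NeZero n] : Function.Surjective (sphereSecondMoment n) :=
  LinearMap.injective_iff_surjective.1 sphereSecondMoment_injective

theorem integrable_comp_dir [NeZero n] {t : ℝ} (ht : 0 < t) {f : USphere n → ℝ}
    (hf : Continuous f) : Integrable (fun h => f (dir h)) (radialMeasure n t) := by
  have h1 : Integrable f ((radialMeasure n t).map dir) := by
    rw [(measurePreserving_dir ht).map_eq]
    exact integrable_sphere_of_continuous hf
  exact h1.comp_measurable measurable_dir

theorem integral_comp_dir [NeZero n] {t : ℝ} (ht : 0 < t) {f : USphere n → ℝ}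
    (hf : Continuous f) :
    ∫ h, f (dir h) ∂(radialMeasure n t) = ∫ ω, f ω ∂(surfaceMeasure n) := by
  rw [← (measurePreserving_dir ht).map_eq, integral_map measurable_dir.aemeasurable
    hf.aestronglyMeasurable]

theorem exists_taylor_bound {φ : Eucl n → ℝ} (hφ : ContDiff ℝ ((⊤ : ℕ∞) : WithTop ℕ∞) φ)
    (hφc : HasCompactSupport φ) : ∃ C : ℝ, 0 ≤ C ∧ ∀ x h : Eucl n,
      |φ (x + h) - φ x - fderiv ℝ φ x h| ≤ C * ‖h‖ ^ 2 := by
  obtain ⟨C, hC⟩ := ((contDiff_infty.1 hφ 2).fderiv_right (m := 1)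
    (by norm_num)).lipschitzWith_of_hasCompactSupport
    (hφc.fderiv ℝ) (by simp)
  refine ⟨C, C.2, fun x h => ?_⟩
  have h1 : ∀ y ∈ segment ℝ x (x + h), ‖fderiv ℝ φ y - fderiv ℝ φ x‖ ≤ C * ‖h‖ := by
    intro y hy
    have h2 := hC.dist_le_mul y x
    rw [dist_eq_norm, dist_eq_norm] at h2
    refine h2.trans (mul_le_mul_of_nonneg_left ?_ C.2)
    have := norm_sub_le_of_mem_segment hy
    simpa using this
  have h3 := (convex_segment x (x + h)).norm_image_sub_le_of_norm_fderiv_le'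
    (𝕜 := ℝ) (f := φ) (φ := fderiv ℝ φ x) (fun y _ => hφ.differentiable (by simp) y) h1
    (left_mem_segment ℝ x (x + h)) (right_mem_segment ℝ x (x + h))
  rw [add_sub_cancel_left, Real.norm_eq_abs] at h3
  calc _ ≤ C * ‖h‖ * ‖h‖ := h3
    _ = _ := by ring

theorem integrable_smul_fderiv {u : Eucl n → ℝ} (hu : LocallyIntegrable u volume)
    {φ : Eucl n → ℝ} (hφ : ContDiff ℝ ((⊤ : ℕ∞) : WithTop ℕ∞) φ) (hφc : HasCompactSupport φ) :
    Integrable (fun x => u x • fderiv ℝ φ x) volume :=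
  hu.integrable_smul_right_of_hasCompactSupport (hφ.continuous_fderiv (by simp)) (hφc.fderiv ℝ)

theorem integrable_mul_fderiv {u : Eucl n → ℝ} (hu : LocallyIntegrable u volume)
    {φ : Eucl n → ℝ} (hφ : ContDiff ℝ ((⊤ : ℕ∞) : WithTop ℕ∞) φ) (hφc : HasCompactSupport φ)
    (y : Eucl n) : Integrable (fun x => u x * fderiv ℝ φ x y) volume :=
  (integrable_smul_fderiv hu hφ hφc).apply_continuousLinearMap y

/-- First order expansion of the pairing of a difference quotient with a test function. -/
theorem abs_integral_diffQuot_slice_le [NeZero n] {φ : Eucl n → ℝ}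
    (hφ : ContDiff ℝ ((⊤ : ℕ∞) : WithTop ℕ∞) φ) (hφc : HasCompactSupport φ) {C R : ℝ}
    (hC : ∀ x h : Eucl n, |φ (x + h) - φ x - fderiv ℝ φ x h| ≤ C * ‖h‖ ^ 2)
    (hR : tsupport φ ⊆ Metric.closedBall 0 R) {u : Eucl n → ℝ} (hu : LocallyIntegrable u volume)
    {h : Eucl n} (h0 : h ≠ 0) (h1 : ‖h‖ < 1) :
    |(∫ x, diffQuot u (x, h) * φ x) + ∫ x, u x * fderiv ℝ φ x (dir h)| ≤
      (∫ x in Metric.closedBall 0 (R + 1), |u x|) * (C * ‖h‖) := by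
  have hφ0 : ∀ x, R < ‖x‖ → φ x = 0 := by
    intro x hx
    by_contra hne
    have h1 := hR (subset_tsupport _ (Function.mem_support.2 hne))
    rw [mem_closedBall_zero_iff] at h1
    linarith
  have hφ'0 : ∀ x, R < ‖x‖ → fderiv ℝ φ x = 0 := by
    intro x hx
    by_contra hne
    have h1 := hR ((support_fderiv_subset ℝ) (Function.mem_support.2 hne))
    rw [mem_closedBall_zero_iff] at h1
    linarith
  set B := Metric.closedBall (0 : Eucl n) (R + 1) with hB
  have hBm : MeasurableSet B := Metric.isClosed_closedBall.measurableSet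
  have huB : IntegrableOn u B volume := hu.integrableOn_isCompact (isCompact_closedBall _ _)
  have hpos : 0 < ‖h‖ := norm_pos_iff.2 h0
  have hout : ∀ x ∉ B, R < ‖x‖ ∧ R < ‖x + h‖ := by
    intro x hx
    rw [hB, mem_closedBall_zero_iff, not_le] at hx
    have := norm_sub_le (x + h) h
    rw [add_sub_cancel_right] at this
    constructor <;> linarith
  have j1 : Integrable (fun x => u x * ((φ x - φ (x + h)) / ‖h‖)) volume := by
    have hc : Continuous fun x => (φ x - φ (x + h)) / ‖h‖ := by
      have := hφ.continuous
      fun_prop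
    have hcs : HasCompactSupport fun x => (φ x - φ (x + h)) / ‖h‖ := by
      refine HasCompactSupport.intro (isCompact_closedBall (0 : Eucl n) (R + 1)) fun x hx => ?_
      rw [hφ0 x (hout x hx).1, hφ0 _ (hout x hx).2]
      simp
    exact hu.integrable_smul_right_of_hasCompactSupport hc hcs
  rw [integral_diffQuot_mul hu hφ.continuous hφc,
    ← integral_add j1 (integrable_mul_fderiv hu hφ hφc _), ← integral_mul_const,
    ← integral_indicator hBm, ← Real.norm_eq_abs]
  refine norm_integral_le_of_norm_le
    ((integrable_indicator_iff hBm).2 (huB.abs.mul_const _)) (Eventually.of_forall fun x => ?_)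
  by_cases hx : x ∈ B
  · rw [indicator_of_mem hx, ← mul_add, norm_mul, Real.norm_eq_abs]
    gcongr
    have e3 : (φ x - φ (x + h)) / ‖h‖ + fderiv ℝ φ x (dir h) =
        -(φ (x + h) - φ x - fderiv ℝ φ x h) / ‖h‖ := by
      rw [dir_coe h0, map_smul, smul_eq_mul]
      field_simp
      ring
    rw [e3, norm_div, norm_neg, norm_norm, Real.norm_eq_abs, div_le_iff₀ hpos]
    calc _ ≤ C * ‖h‖ ^ 2 := hC x h
      _ = _ := by ring
  · rw [indicator_of_notMem hx, hφ0 x (hout x hx).1, hφ0 _ (hout x hx).2, hφ'0 x (hout x hx).1]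
    simp

theorem integrable_norm_radialMeasure [NeZero n] {t : ℝ} (ht : 0 < t) :
    Integrable (fun h : Eucl n => ‖h‖) (radialMeasure n t) := by
  have := isFiniteMeasure_radialMeasure (n := n) ht
  refine Integrable.of_bound (C := 1) (by fun_prop) ?_
  filter_upwards [ae_radialMeasure_norm_pos_lt t] with h hh
  simpa using hh.2.le

theorem integral_fderiv_sphereSecondMoment [NeZero n] {φ : Eucl n → ℝ}
    (hφ : ContDiff ℝ ((⊤ : ℕ∞) : WithTop ℕ∞) φ) (hφc : HasCompactSupport φ) {u : Eucl n → ℝ}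
    (hu : LocallyIntegrable u volume) (v : Eucl n) {t : ℝ} (ht : 0 < t) :
    Integrable (fun h => inner ℝ (dir h : Eucl n) v * ∫ x, u x * fderiv ℝ φ x (dir h))
        (radialMeasure n t) ∧
      ∫ x, u x * fderiv ℝ φ x (sphereSecondMoment n v) =
        ∫ h, inner ℝ (dir h : Eucl n) v * ∫ x, u x * fderiv ℝ φ x (dir h)
          ∂(volume : Measure (Eucl n)) ∂(radialMeasure n t) := by
  obtain ⟨ℓ, hℓa⟩ : ∃ ℓ : Eucl n →L[ℝ] ℝ, ∀ y, ∫ x, u x * fderiv ℝ φ x y = ℓ y :=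
    ⟨∫ x, u x • fderiv ℝ φ x, fun y =>
      (ContinuousLinearMap.integral_apply (integrable_smul_fderiv hu hφ hφc) y).symm⟩
  have hℓc : Continuous fun ω : USphere n => inner ℝ (ω : Eucl n) v * ℓ (ω : Eucl n) := by
    fun_prop
  have i1 := integrable_comp_dir ht hℓc
  have i2 := integral_comp_dir ht hℓc
  have i3 := clm_sphereSecondMoment ℓ v
  simp only [← hℓa] at i1 i2 i3
  exact ⟨i1, i3.trans i2.symm⟩

theorem abs_integral_diffQuot_test_le [NeZero n] {φ : Eucl n → ℝ}
    (hφ : ContDiff ℝ ((⊤ : ℕ∞) : WithTop ℕ∞) φ) (hφc : HasCompactSupport φ) {C R : ℝ}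
    (hC : ∀ x h : Eucl n, |φ (x + h) - φ x - fderiv ℝ φ x h| ≤ C * ‖h‖ ^ 2)
    (hR : tsupport φ ⊆ Metric.closedBall 0 R) {u : Eucl n → ℝ} (hu : LocallyIntegrable u volume)
    (v : Eucl n) {t : ℝ} (ht : 0 < t)
    (hint : Integrable (fun z => diffQuot u z * (φ z.1 * inner ℝ (dir z.2 : Eucl n) v))
      (pairMeasure n t)) :
    |∫ z, diffQuot u z * (φ z.1 * inner ℝ (dir z.2 : Eucl n) v) ∂(pairMeasure n t) +
      ∫ x, u x * fderiv ℝ φ x (sphereSecondMoment n v)| ≤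
      ‖v‖ * (∫ x in Metric.closedBall 0 (R + 1), |u x|) * C * ∫ h, ‖h‖ ∂(radialMeasure n t) := by
  obtain ⟨i1, e1⟩ := integral_fderiv_sphereSecondMoment hφ hφc hu v ht
  have hsw : ∫ z, diffQuot u z * (φ z.1 * inner ℝ (dir z.2 : Eucl n) v) ∂(pairMeasure n t) =
      ∫ h, ∫ x, diffQuot u (x, h) * (φ x * inner ℝ (dir h : Eucl n) v)
        ∂(volume : Measure (Eucl n)) ∂(radialMeasure n t) := integral_prod_symm _ hint
  have hswi : Integrable (fun h => ∫ x, diffQuot u (x, h) * (φ x * inner ℝ (dir h : Eucl n) v))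
      (radialMeasure n t) := Integrable.integral_prod_right hint
  rw [e1, hsw, ← integral_add hswi i1, ← Real.norm_eq_abs, ← integral_const_mul]
  refine norm_integral_le_of_norm_le ((integrable_norm_radialMeasure ht).const_mul _) ?_
  filter_upwards [ae_radialMeasure_norm_pos_lt t] with h hh
  have e2 : ∫ x, diffQuot u (x, h) * (φ x * inner ℝ (dir h : Eucl n) v) =
      inner ℝ (dir h : Eucl n) v * ∫ x, diffQuot u (x, h) * φ x := by
    rw [← integral_const_mul]
    refine integral_congr_ae (Eventually.of_forall fun x => ?_)
    ring
  have hd : ‖(inner ℝ (dir h : Eucl n) v : ℝ)‖ ≤ ‖v‖ := by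
    refine (norm_inner_le_norm _ _).trans ?_
    simp
  rw [e2, ← mul_add, norm_mul, Real.norm_eq_abs (_ + _)]
  calc _ ≤ ‖v‖ * ((∫ x in Metric.closedBall 0 (R + 1), |u x|) * (C * ‖h‖)) :=
        mul_le_mul hd (abs_integral_diffQuot_slice_le hφ hφc hC hR hu hh.1 hh.2)
          (abs_nonneg _) (norm_nonneg _)
    _ = _ := by ring

end GradientExistence

section GradientExistence

variable {n : ℕ} {p q : ℝ≥0∞}

theorem fst_ae_pairMeasure {t : ℝ} {P : Eucl n → Prop} (h : ∀ᵐ x, P x) :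
    ∀ᵐ z ∂(pairMeasure n t), P z.1 :=
  Measure.quasiMeasurePreserving_fst.ae h

/-- A function in `L^p` on pairs induces a functional on `L^q(ℝⁿ)`. -/
theorem exists_pairing_functional [NeZero n] [Fact (1 ≤ q)] (hq' : q ≠ ∞)
    (hpq : p.toReal.HolderConjugate q.toReal) {t : ℝ} (ht : 0 < t) {A : Eucl n × Eucl n → ℝ}
    (hA : Measurable A) {K : ℝ≥0∞} (hK : K ≠ ∞)
    (hAK : ∫⁻ z, ‖A z‖ₑ ^ p.toReal ∂(pairMeasure n t) ≤ K) :
    ∃ Λ : Lp ℝ q (volume : Measure (Eucl n)) →L[ℝ] ℝ,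
      ‖Λ‖ ≤ (K ^ (1 / p.toReal) * surfaceMeasure n univ ^ (1 / q.toReal)).toReal ∧
      ∀ F : Lp ℝ q (volume : Measure (Eucl n)), Λ F = ∫ z, A z * F z.1 ∂(pairMeasure n t) := by
  have hq : 1 ≤ q := Fact.out
  have hσ : surfaceMeasure n univ ≠ ∞ := measure_ne_top _ _
  set D := K ^ (1 / p.toReal) * surfaceMeasure n univ ^ (1 / q.toReal) with hD
  have hDtop : D ≠ ∞ := ENNReal.mul_ne_top
    (ENNReal.rpow_ne_top_of_nonneg (one_div_nonneg.2 hpq.nonneg) hK)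
    (ENNReal.rpow_ne_top_of_nonneg (one_div_nonneg.2 hpq.symm.nonneg) hσ)
  have hFm : ∀ F : Lp ℝ q (volume : Measure (Eucl n)), Measurable (F : Eucl n → ℝ) := fun F =>
    (Lp.stronglyMeasurable F).measurable
  have hFq : ∀ F : Lp ℝ q (volume : Measure (Eucl n)),
      ∫⁻ z, ‖F z.1‖ₑ ^ q.toReal ∂(pairMeasure n t) =
        (∫⁻ x, ‖F x‖ₑ ^ q.toReal) * surfaceMeasure n univ := fun F =>
    lintegral_fst_pairMeasure ht (f := fun x => ‖F x‖ₑ ^ q.toReal) ((hFm F).enorm.pow_const _)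
  have hint : ∀ F : Lp ℝ q (volume : Measure (Eucl n)),
      Integrable (fun z => A z * F z.1) (pairMeasure n t) := by
    intro F
    refine integrable_mul_of_lintegral_rpow hpq hA ((hFm F).comp measurable_fst)
      (hAK.trans_lt hK.lt_top).ne ?_
    rw [hFq F]
    exact ENNReal.mul_ne_top (lintegral_rpow_enorm_lt_top hq hq' (Lp.memLp F)).ne hσ
  let Λ₀ : Lp ℝ q (volume : Measure (Eucl n)) →ₗ[ℝ] ℝ :=
    { toFun := fun F => ∫ z, A z * F z.1 ∂(pairMeasure n t)
      map_add' := fun F G => by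
        rw [← integral_add (hint F) (hint G)]
        refine integral_congr_ae ?_
        filter_upwards [fst_ae_pairMeasure (Lp.coeFn_add F G)] with z hz
        rw [hz, Pi.add_apply, mul_add]
      map_smul' := fun c F => by
        rw [RingHom.id_apply, smul_eq_mul, ← integral_const_mul]
        refine integral_congr_ae ?_
        filter_upwards [fst_ae_pairMeasure (Lp.coeFn_smul c F)] with z hz
        rw [hz, Pi.smul_apply, smul_eq_mul]
        ring }
  have hbound : ∀ F, ‖Λ₀ F‖ ≤ D.toReal * ‖F‖ := by
    intro F
    have h1 : ‖Λ₀ F‖ₑ ≤ D * ‖F‖ₑ := by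
      refine (enorm_integral_le_lintegral_enorm _).trans ?_
      refine (lintegral_enorm_mul_le hpq hA.aemeasurable
        ((hFm F).comp measurable_fst).aemeasurable).trans ?_
      simp only [Function.comp_apply]
      rw [hFq F, ENNReal.mul_rpow_of_nonneg _ _ (one_div_nonneg.2 hpq.symm.nonneg),
        Lp.enorm_def, eLpNorm_eq_lintegral_rpow_enorm_toReal (one_pos.trans_le hq).ne' hq', hD,
        mul_assoc, mul_comm (surfaceMeasure n univ ^ (1 / q.toReal))]
      have := hpq.pos
      gcongr
    have h2 := ENNReal.toReal_mono (ENNReal.mul_ne_top hDtop enorm_ne_top) h1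
    rwa [ENNReal.toReal_mul, toReal_enorm, toReal_enorm] at h2
  exact ⟨Λ₀.mkContinuous D.toReal hbound,
    Λ₀.mkContinuous_norm_le ENNReal.toReal_nonneg hbound, fun F => rfl⟩

theorem integral_norm_radialMeasure_le [NeZero n] {t : ℝ} (ht : 0 < t) :
    ∫ h, ‖h‖ ∂(radialMeasure n t) ≤ t * (surfaceMeasure n univ).toReal := by
  rw [integral_eq_lintegral_of_nonneg_ae (Eventually.of_forall fun h => norm_nonneg _)
    (by fun_prop)]
  have h1 := ENNReal.toReal_mono (ENNReal.mul_ne_top ENNReal.ofReal_ne_top (measure_ne_top _ _))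
    (lintegral_norm_radialMeasure_le (n := n) ht)
  rwa [ENNReal.toReal_mul, ENNReal.toReal_ofReal ht.le] at h1

theorem tendsto_setIntegral_abs_sub_zero {ι : Type*} {l : Filter ι}
    (hp' : p ≠ ∞) (hpq : p.toReal.HolderConjugate q.toReal) {u : ι → Eucl n → ℝ} {u₀ : Eucl n → ℝ}
    (hu : ∀ i, Measurable (u i)) (hu₀ : Measurable u₀)
    (hlim : Tendsto (fun i => eLpNorm (u i - u₀) p volume) l (𝓝 0)) (R : ℝ) :
    Tendsto (fun i => ∫ x in Metric.closedBall (0 : Eucl n) R, |u i x - u₀ x|) l (𝓝 0) := by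
  have h1 := tendsto_lintegral_closedBall_zero hp' hpq (fun i => (hu i).sub hu₀) hlim R
  have h2 := (ENNReal.tendsto_toReal ENNReal.zero_ne_top).comp h1
  rw [ENNReal.toReal_zero] at h2
  refine h2.congr fun i => ?_
  have hm : Measurable fun x => |u i x - u₀ x| := ((hu i).sub hu₀).abs
  rw [integral_eq_lintegral_of_nonneg_ae (Eventually.of_forall fun h => abs_nonneg _)
    hm.aestronglyMeasurable]
  simp only [Function.comp_apply, Real.enorm_eq_ofReal_abs, Pi.sub_apply]

theorem tendsto_integral_mul_fderiv {ι : Type*} {l : Filter ι}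
    {u : ι → Eucl n → ℝ} {u₀ : Eucl n → ℝ}
    (hu : ∀ i, LocallyIntegrable (u i) volume) (hu₀ : LocallyIntegrable u₀ volume)
    (hlim : ∀ R, Tendsto (fun i => ∫ x in Metric.closedBall (0 : Eucl n) R, |u i x - u₀ x|) l (𝓝 0))
    {φ : Eucl n → ℝ} (hφ : ContDiff ℝ ((⊤ : ℕ∞) : WithTop ℕ∞) φ) (hφc : HasCompactSupport φ)
    (y : Eucl n) :
    Tendsto (fun i => ∫ x, u i x * fderiv ℝ φ x y) l (𝓝 (∫ x, u₀ x * fderiv ℝ φ x y)) := by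
  obtain ⟨R, hR⟩ := hφc.isCompact.isBounded.subset_closedBall (0 : Eucl n)
  obtain ⟨C, hC⟩ := (hφ.continuous_fderiv (by simp)).bounded_above_of_compact_support
    (hφc.fderiv ℝ)
  set B := Metric.closedBall (0 : Eucl n) R with hB
  have hBm : MeasurableSet B := Metric.isClosed_closedBall.measurableSet
  rw [tendsto_iff_norm_sub_tendsto_zero]
  refine squeeze_zero (fun _ => norm_nonneg _) (fun i => ?_)
    (by simpa using (hlim R).mul_const (C * ‖y‖))
  rw [← integral_sub (integrable_mul_fderiv (hu i) hφ hφc y) (integrable_mul_fderiv hu₀ hφ hφc y),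
    ← integral_mul_const, ← integral_indicator hBm]
  have hi : IntegrableOn (fun x => |u i x - u₀ x| * (C * ‖y‖)) B volume :=
    (((hu i).sub hu₀).integrableOn_isCompact (isCompact_closedBall _ _)).abs.mul_const _
  refine norm_integral_le_of_norm_le ((integrable_indicator_iff hBm).2 hi)
    (Eventually.of_forall fun x => ?_)
  by_cases hx : x ∈ B
  · rw [indicator_of_mem hx, ← sub_mul, norm_mul, Real.norm_eq_abs]
    gcongr
    exact (ContinuousLinearMap.le_opNorm _ _).trans (by gcongr; exact hC x)
  · have h0 : fderiv ℝ φ x = 0 := by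
      by_contra hne
      exact hx (hR ((support_fderiv_subset ℝ) (Function.mem_support.2 hne)))
    rw [indicator_of_notMem hx, h0]
    simp

theorem tendsto_integral_diffQuot_test [NeZero n] {ι : Type*} {l : Filter ι}
    {t : ι → ℝ} (ht : ∀ i, 0 < t i) (ht0 : Tendsto t l (𝓝 0))
    {u : ι → Eucl n → ℝ} {u₀ : Eucl n → ℝ}
    (hu : ∀ i, LocallyIntegrable (u i) volume) (hu₀ : LocallyIntegrable u₀ volume)
    (hlim : ∀ R, Tendsto (fun i => ∫ x in Metric.closedBall (0 : Eucl n) R, |u i x - u₀ x|) l (𝓝 0))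
    {φ : Eucl n → ℝ} (hφ : ContDiff ℝ ((⊤ : ℕ∞) : WithTop ℕ∞) φ) (hφc : HasCompactSupport φ)
    (v : Eucl n)
    (hint : ∀ i, Integrable (fun z => diffQuot (u i) z * (φ z.1 * inner ℝ (dir z.2 : Eucl n) v))
      (pairMeasure n (t i))) :
    Tendsto (fun i => ∫ z, diffQuot (u i) z * (φ z.1 * inner ℝ (dir z.2 : Eucl n) v)
      ∂(pairMeasure n (t i))) l (𝓝 (- ∫ x, u₀ x * fderiv ℝ φ x (sphereSecondMoment n v))) := by
  obtain ⟨C, hC0, hC⟩ := exists_taylor_bound hφ hφc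
  obtain ⟨R, hR⟩ := hφc.isCompact.isBounded.subset_closedBall (0 : Eucl n)
  set B := Metric.closedBall (0 : Eucl n) (R + 1) with hB
  have huB : ∀ {w : Eucl n → ℝ}, LocallyIntegrable w volume → IntegrableOn w B volume := fun hw =>
    hw.integrableOn_isCompact (isCompact_closedBall _ _)
  set σ := (surfaceMeasure n univ).toReal with hσ
  have hbound : ∀ i, |∫ z, diffQuot (u i) z * (φ z.1 * inner ℝ (dir z.2 : Eucl n) v)
      ∂(pairMeasure n (t i)) + ∫ x, u i x * fderiv ℝ φ x (sphereSecondMoment n v)| ≤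
      ‖v‖ * ((∫ x in B, |u i x - u₀ x|) + ∫ x in B, |u₀ x|) * C * (t i * σ) := by
    intro i
    refine (abs_integral_diffQuot_test_le hφ hφc hC hR (hu i) v (ht i) (hint i)).trans ?_
    have h1 : ∫ x in B, |u i x| ≤ (∫ x in B, |u i x - u₀ x|) + ∫ x in B, |u₀ x| := by
      have i1 : IntegrableOn (fun x => |u i x - u₀ x|) B volume := (huB ((hu i).sub hu₀)).abs
      rw [← integral_add i1 (huB hu₀).abs]
      refine integral_mono (huB (hu i)).abs (i1.add (huB hu₀).abs) fun x => ?_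
      simpa using abs_add_le (u i x - u₀ x) (u₀ x)
    have h2 : 0 ≤ ∫ x in B, |u i x| := integral_nonneg fun _ => abs_nonneg _
    have h3 : 0 ≤ ∫ h, ‖h‖ ∂(radialMeasure n (t i)) := integral_nonneg fun _ => norm_nonneg _
    have h4 := integral_norm_radialMeasure_le (n := n) (ht i)
    gcongr
  have herr : Tendsto (fun i => ∫ z, diffQuot (u i) z * (φ z.1 * inner ℝ (dir z.2 : Eucl n) v)
      ∂(pairMeasure n (t i)) + ∫ x, u i x * fderiv ℝ φ x (sphereSecondMoment n v)) l (𝓝 0) := by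
    rw [tendsto_zero_iff_norm_tendsto_zero]
    refine squeeze_zero (fun _ => norm_nonneg _) hbound ?_
    have h1 := ((((hlim (R + 1)).add_const (∫ x in B, |u₀ x|)).const_mul ‖v‖).mul_const C).mul
      (ht0.mul_const σ)
    simpa using h1
  have h2 := herr.sub (tendsto_integral_mul_fderiv hu hu₀ hlim hφ hφc (sphereSecondMoment n v))
  simpa using h2

/-- A limit in `L^p` of functions with bounded nonlocal energies has weak derivatives in `L^p`. -/
theorem exists_weak_derivative [NeZero n] {ι : Type*} {l : Filter ι} [l.NeBot]
    (hp' : p ≠ ∞) (hq' : q ≠ ∞) (hpq : p.toReal.HolderConjugate q.toReal) {t : ι → ℝ}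
    (ht : ∀ i, 0 < t i) (ht0 : Tendsto t l (𝓝 0)) {u : ι → Eucl n → ℝ} {u₀ : Eucl n → ℝ}
    (hum : ∀ i, Measurable (u i)) (hum₀ : Measurable u₀) (hup : ∀ i, MemLp (u i) p volume)
    (hup₀ : MemLp u₀ p volume) (hlim : Tendsto (fun i => eLpNorm (u i - u₀) p volume) l (𝓝 0))
    {K : ℝ≥0∞} (hK : K ≠ ∞)
    (huK : ∀ i, ∫⁻ z, ‖diffQuot (u i) z‖ₑ ^ p.toReal ∂(pairMeasure n (t i)) ≤ K) (v : Eucl n) :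
    ∃ g : Eucl n → ℝ, Measurable g ∧ MemLp g p volume ∧ ∀ φ : Eucl n → ℝ,
      ContDiff ℝ ((⊤ : ℕ∞) : WithTop ℕ∞) φ → HasCompactSupport φ →
      ∫ x, φ x * g x = - ∫ x, u₀ x * fderiv ℝ φ x (sphereSecondMoment n v) := by
  have hp := one_le_of_holderConjugate hp' hpq
  have hq := one_le_of_holderConjugate hq' hpq.symm
  have : Fact (1 ≤ q) := ⟨hq⟩
  have hdm : Measurable fun z : Eucl n × Eucl n => (inner ℝ (dir z.2 : Eucl n) v : ℝ) := by
    have h1 : Measurable fun z : Eucl n × Eucl n => (dir z.2 : Eucl n) :=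
      measurable_subtype_coe.comp (measurable_dir.comp measurable_snd)
    exact h1.inner measurable_const
  set A : ι → Eucl n × Eucl n → ℝ := fun i z =>
    diffQuot (u i) z * inner ℝ (dir z.2 : Eucl n) v with hA
  have hAm : ∀ i, Measurable (A i) := fun i => (measurable_diffQuot (hum i)).mul hdm
  have hAK : ∀ i, ∫⁻ z, ‖A i z‖ₑ ^ p.toReal ∂(pairMeasure n (t i)) ≤ K * ‖v‖ₑ ^ p.toReal := by
    intro i
    calc _ ≤ ∫⁻ z, ‖diffQuot (u i) z‖ₑ ^ p.toReal * ‖v‖ₑ ^ p.toReal ∂(pairMeasure n (t i)) := by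
          refine lintegral_mono fun z => ?_
          simp only [hA]
          rw [enorm_mul, ENNReal.mul_rpow_of_nonneg _ _ hpq.nonneg]
          have := hpq.nonneg
          gcongr
          rw [← ofReal_norm, ← ofReal_norm]
          refine ENNReal.ofReal_le_ofReal ((norm_inner_le_norm _ _).trans ?_)
          simp
      _ ≤ _ := by
          rw [lintegral_mul_const' _ _ (ENNReal.rpow_ne_top_of_nonneg hpq.nonneg enorm_ne_top)]
          gcongr
          exact huK i
  have hKv : K * ‖v‖ₑ ^ p.toReal ≠ ∞ :=
    ENNReal.mul_ne_top hK (ENNReal.rpow_ne_top_of_nonneg hpq.nonneg enorm_ne_top)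
  choose Λ hΛn hΛ using fun i => exists_pairing_functional hq' hpq (ht i) (hAm i) hKv (hAK i)
  obtain ⟨Λ₀, hΛ₀⟩ : ∃ Λ₀ : Lp ℝ q (volume : Measure (Eucl n)) →L[ℝ] ℝ,
      ∀ F, Tendsto (fun i => Λ i F) (Ultrafilter.of l) (𝓝 (Λ₀ F)) := by
    set D := ((K * ‖v‖ₑ ^ p.toReal) ^ (1 / p.toReal) *
      surfaceMeasure n univ ^ (1 / q.toReal)).toReal
    have hcpt := WeakDual.isCompact_closedBall (𝕜 := ℝ)
      (0 : StrongDual ℝ (Lp ℝ q (volume : Measure (Eucl n)))) D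
    obtain ⟨Λ₀, -, h⟩ := hcpt.ultrafilter_le_nhds
      ((Ultrafilter.of l).map fun i => StrongDual.toWeakDual (Λ i)) (by
        rw [Ultrafilter.coe_map, le_principal_iff]
        refine Filter.mem_map.2 (Filter.univ_mem' fun i => ?_)
        have := hΛn i
        simpa using this)
    refine ⟨WeakDual.toStrongDual Λ₀, fun F => ?_⟩
    have h1 : Tendsto (fun i => StrongDual.toWeakDual (Λ i)) (Ultrafilter.of l) (𝓝 Λ₀) := h
    exact (WeakDual.eval_continuous F).continuousAt.tendsto.comp h1
  obtain ⟨g, hgm, hgp, hg⟩ := exists_memLp_of_dual_eucl hp' hq' hpq Λ₀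
  refine ⟨g, hgm, hgp, fun φ hφ hφc => ?_⟩
  have hφq : MemLp φ q volume := hφ.continuous.memLp_of_hasCompactSupport hφc
  rw [← hg φ hφ.continuous hφc hφq]
  have hΛφ : ∀ i, Λ i (hφq.toLp φ) = ∫ z, diffQuot (u i) z *
      (φ z.1 * inner ℝ (dir z.2 : Eucl n) v) ∂(pairMeasure n (t i)) := by
    intro i
    rw [hΛ i]
    refine integral_congr_ae ?_
    filter_upwards [fst_ae_pairMeasure hφq.coeFn_toLp] with z hz
    simp only [hA]
    rw [hz]
    ring
  have hint : ∀ i, Integrable (fun z => diffQuot (u i) z *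
      (φ z.1 * inner ℝ (dir z.2 : Eucl n) v)) (pairMeasure n (t i)) := by
    intro i
    have hφm := hφ.continuous.measurable
    have h1 : Integrable (fun z => A i z * φ z.1) (pairMeasure n (t i)) := by
      refine integrable_mul_of_lintegral_rpow hpq (hAm i) (hφm.comp measurable_fst)
        ((hAK i).trans_lt hKv.lt_top).ne ?_
      have h2 := lintegral_fst_pairMeasure (ht i) (f := fun x => ‖φ x‖ₑ ^ q.toReal)
        (hφm.enorm.pow_const _)
      rw [h2]
      exact ENNReal.mul_ne_top (lintegral_rpow_enorm_lt_top hq hq' hφq).ne (measure_ne_top _ _)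
    refine h1.congr (Eventually.of_forall fun z => ?_)
    simp only [hA]
    ring
  have hl := tendsto_integral_diffQuot_test ht ht0 (fun i => (hup i).locallyIntegrable hp)
    (hup₀.locallyIntegrable hp) (tendsto_setIntegral_abs_sub_zero hp' hpq hum hum₀ hlim)
    hφ hφc v hint
  have h3 := (hΛ₀ (hφq.toLp φ))
  simp only [hΛφ] at h3
  exact tendsto_nhds_unique h3 (hl.mono_left (Ultrafilter.of_le l))

theorem exists_hasWeakGradient [NeZero n] {ι : Type*} {l : Filter ι} [l.NeBot]
    (hp' : p ≠ ∞) (hq' : q ≠ ∞) (hpq : p.toReal.HolderConjugate q.toReal) {t : ι → ℝ}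
    (ht : ∀ i, 0 < t i) (ht0 : Tendsto t l (𝓝 0)) {u : ι → Eucl n → ℝ} {u₀ : Eucl n → ℝ}
    (hum : ∀ i, Measurable (u i)) (hum₀ : Measurable u₀) (hup : ∀ i, MemLp (u i) p volume)
    (hup₀ : MemLp u₀ p volume) (hlim : Tendsto (fun i => eLpNorm (u i - u₀) p volume) l (𝓝 0))
    {K : ℝ≥0∞} (hK : K ≠ ∞)
    (huK : ∀ i, ∫⁻ z, ‖diffQuot (u i) z‖ₑ ^ p.toReal ∂(pairMeasure n (t i)) ≤ K) :
    ∃ g : Eucl n → Eucl n, HasWeakGradient u₀ g ∧ Measurable g ∧ MemLp g p volume := by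
  have hp := one_le_of_holderConjugate hp' hpq
  let e : Fin n → Eucl n := fun i => EuclideanSpace.single i 1
  choose w hw using fun i => sphereSecondMoment_surjective (n := n) (e i)
  choose g hgm hgp hg using fun i =>
    exists_weak_derivative hp' hq' hpq ht ht0 hum hum₀ hup hup₀ hlim hK huK (w i)
  have hGp : MemLp (fun x => ∑ i, g i x • e i) p volume :=
    memLp_finsetSum _ fun i _ =>
      ((ContinuousLinearMap.id ℝ ℝ).smulRight (e i)).comp_memLp' (hgp i)
  refine ⟨fun x => ∑ i, g i x • e i, ⟨hup₀.locallyIntegrable hp, hGp.locallyIntegrable hp,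
    fun φ hφ hφc v => ?_⟩, ?_, hGp⟩
  swap
  · exact Finset.measurable_sum _ fun i _ => (hgm i).smul_const _
  have hv : v = ∑ i, v i • e i := by
    ext j
    simp [e, Finset.sum_apply, Pi.single_apply]
  have hu₀l := hup₀.locallyIntegrable hp
  have e1 : ∀ x, u₀ x * fderiv ℝ φ x v = ∑ i, v i * (u₀ x * fderiv ℝ φ x (e i)) := by
    intro x
    conv_lhs => rw [hv]
    rw [map_sum, Finset.mul_sum]
    refine Finset.sum_congr rfl fun i _ => ?_
    rw [map_smul, smul_eq_mul]
    ring
  have e2 : ∀ x, φ x * inner ℝ (∑ i, g i x • e i) v = ∑ i, v i * (φ x * g i x) := by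
    intro x
    rw [sum_inner, Finset.mul_sum]
    refine Finset.sum_congr rfl fun i _ => ?_
    rw [inner_smul_left]
    simp only [e, EuclideanSpace.inner_single_left, conj_trivial, one_mul]
    ring
  simp only [e1, e2]
  have hφg : ∀ i, Integrable (fun x => φ x * g i x) volume := fun i =>
    ((hgp i).locallyIntegrable hp).integrable_smul_left_of_hasCompactSupport hφ.continuous hφc
  rw [integral_finsetSum _ fun i _ => (integrable_mul_fderiv hu₀l hφ hφc _).const_mul _,
    integral_finsetSum _ fun i _ => (hφg i).const_mul _, ← Finset.sum_neg_distrib]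
  refine Finset.sum_congr rfl fun i _ => ?_
  rw [integral_const_mul, integral_const_mul, hg i φ hφ hφc, hw]
  ring

end GradientExistence

/-! ### Asymptotics of the energies for regular kernels -/

section RegularKernel

variable {n : ℕ} {p q : ℝ≥0∞}

/-- The pairing `∇u(x) · ω`. -/
noncomputable def sphGrad (g : Eucl n → Eucl n) (z : Eucl n × USphere n) : ℝ :=
  inner ℝ (g z.1) (z.2 : Eucl n)

theorem measurable_sphGrad {g : Eucl n → Eucl n} (hg : Measurable g) : Measurable (sphGrad g) := by
  have h1 : Measurable fun z : Eucl n × USphere n => (z.2 : Eucl n) :=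
    measurable_subtype_coe.comp measurable_snd
  exact (hg.comp measurable_fst).inner h1

theorem gradDir_eq [NeZero n] (g : Eucl n → Eucl n) (z : Eucl n × Eucl n) :
    gradDir g z = sphGrad g (toDir z) := rfl

theorem enorm_sphGrad_le (g : Eucl n → Eucl n) (z : Eucl n × USphere n) :
    ‖sphGrad g z‖ₑ ≤ ‖g z.1‖ₑ := by
  rw [← ofReal_norm, ← ofReal_norm]
  refine ENNReal.ofReal_le_ofReal ((norm_inner_le_norm _ _).trans ?_)
  simp

theorem lintegral_bundleMeasure_fst {f : Eucl n → ℝ≥0∞} (hf : Measurable f) :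
    ∫⁻ z, f z.1 ∂(bundleMeasure n) = (∫⁻ x, f x) * surfaceMeasure n univ := by
  have hm : Measurable fun z : Eucl n × USphere n => f z.1 := hf.comp measurable_fst
  rw [bundleMeasure, lintegral_prod _ hm.aemeasurable]
  simp only [lintegral_const]
  exact lintegral_mul_const _ hf

theorem lintegral_sphGrad_lt_top (hp : 1 ≤ p) (hp' : p ≠ ∞) {g : Eucl n → Eucl n}
    (hgm : Measurable g) (hg : MemLp g p volume) :
    ∫⁻ z, ‖sphGrad g z‖ₑ ^ p.toReal ∂(bundleMeasure n) < ∞ := by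
  refine lt_of_le_of_lt (lintegral_mono fun z => ENNReal.rpow_le_rpow (enorm_sphGrad_le g z)
    ENNReal.toReal_nonneg) ?_
  rw [lintegral_bundleMeasure_fst (f := fun x => ‖g x‖ₑ ^ p.toReal) (hgm.enorm.pow_const _)]
  exact ENNReal.mul_lt_top (lintegral_rpow_enorm_lt_top hp hp' hg) (measure_lt_top _ _)

theorem ofReal_mul_abs_rpow {c v P : ℝ} (hc : 0 ≤ c) (hP : 0 ≤ P) :
    ENNReal.ofReal (c * |v| ^ P) = ENNReal.ofReal c * ‖v‖ₑ ^ P := by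
  rw [ENNReal.ofReal_mul hc, Real.enorm_eq_ofReal_abs, ENNReal.ofReal_rpow_of_nonneg
    (abs_nonneg _) hP]

/-- The limit energy `∬ a(x,ω) |∇u(x) · ω|^p dω dx`. -/
noncomputable def sphereEnergy (a : Eucl n × USphere n → ℝ) (p : ℝ≥0∞) (g : Eucl n → Eucl n) :
    ℝ≥0∞ :=
  ∫⁻ z, ENNReal.ofReal (a z) * ‖sphGrad g z‖ₑ ^ p.toReal ∂(bundleMeasure n)

/-- The energy `∬ m(x,h) |V(x,h)|^p dπ_t`. -/
noncomputable def pairEnergy (m : Eucl n × Eucl n → ℝ) (p : ℝ≥0∞) (t : ℝ)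
    (V : Eucl n × Eucl n → ℝ) : ℝ≥0∞ :=
  ∫⁻ z, ENNReal.ofReal (m z) * ‖V z‖ₑ ^ p.toReal ∂(pairMeasure n t)

variable [NeZero n] {m : Eucl n × Eucl n → ℝ} {a : Eucl n × USphere n → ℝ} {lo up : ℝ}

theorem IsRegularKernel.enorm_sub_le (hK : IsRegularKernel m a lo up) (z : Eucl n × Eucl n) :
    ‖m z - a (toDir z)‖ₑ ≤ ENNReal.ofReal up := by
  rw [Real.enorm_eq_ofReal_abs]
  refine ENNReal.ofReal_le_ofReal (abs_le.2 ⟨?_, ?_⟩)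
  · linarith [hK.lo_le_m z, hK.a_le_up (toDir z), hK.lo_pos]
  · linarith [hK.m_le_up z, hK.lo_le_a (toDir z), hK.lo_pos]

theorem IsRegularKernel.measurable_sub (hK : IsRegularKernel m a lo up) :
    Measurable fun z => m z - a (toDir z) :=
  hK.measurable_m.sub (hK.measurable_a.comp measurable_toDir)

theorem IsRegularKernel.tendsto_lintegral_sub (hK : IsRegularKernel m a lo up) {ι : Type*}
    {l : Filter ι} [l.IsCountablyGenerated] {t : ι → ℝ} (ht : ∀ i, 0 < t i)
    (ht0 : Tendsto t l (𝓝 0)) {r : ℝ} (hr : 1 ≤ r) {f : Eucl n → ℝ≥0∞} (hf : Measurable f)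
    (hfi : ∫⁻ x, f x ≠ ∞) :
    Tendsto (fun i => ∫⁻ z, f z.1 * ‖m z - a (toDir z)‖ₑ ^ r ∂(pairMeasure n (t i))) l (𝓝 0) := by
  have hr0 : 0 ≤ r - 1 := by linarith
  have hdm := hK.measurable_sub.enorm.pow_const r
  set b : ℝ≥0∞ := ENNReal.ofReal up ^ r with hb
  have hbtop : b ≠ ∞ := ENNReal.rpow_ne_top_of_nonneg (by linarith) ENNReal.ofReal_ne_top
  have hσ : surfaceMeasure n univ ≠ ∞ := measure_ne_top _ _
  set I : ι → Eucl n → ℝ≥0∞ := fun i x =>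
    ∫⁻ h, ‖m (x, h) - a (toDir (x, h))‖ₑ ^ r ∂(radialMeasure n (t i)) with hI
  have hIm : ∀ i, Measurable (I i) := fun i => hdm.lintegral_prod_right'
  have e1 : ∀ i, ∫⁻ z, f z.1 * ‖m z - a (toDir z)‖ₑ ^ r ∂(pairMeasure n (t i)) =
      ∫⁻ x, f x * I i x := by
    intro i
    have hfd : Measurable fun z : Eucl n × Eucl n => f z.1 * ‖m z - a (toDir z)‖ₑ ^ r :=
      (hf.comp measurable_fst).mul hdm
    rw [lintegral_pairMeasure hfd]
    refine lintegral_congr fun x => ?_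
    exact lintegral_const_mul (μ := radialMeasure n (t i)) (f x)
      (f := fun h => ‖m (x, h) - a (toDir (x, h))‖ₑ ^ r) (hdm.comp measurable_prodMk_left)
  simp only [e1]
  have hIb : ∀ i x, I i x ≤ b * surfaceMeasure n univ := by
    intro i x
    rw [← radialMeasure_univ (ht i), ← lintegral_const]
    refine lintegral_mono fun h => ENNReal.rpow_le_rpow (hK.enorm_sub_le _) (by linarith)
  have hI0 : ∀ᵐ x, Tendsto (fun i => I i x) l (𝓝 0) := by
    filter_upwards [hK.radial] with x hx
    obtain ⟨C, hC⟩ := hx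
    set c : ℝ≥0∞ := ENNReal.ofReal up ^ (r - 1) * ENNReal.ofReal C with hc
    have hctop : c ≠ ∞ := ENNReal.mul_ne_top
      (ENNReal.rpow_ne_top_of_nonneg hr0 ENNReal.ofReal_ne_top) ENNReal.ofReal_ne_top
    have hle : ∀ i, I i x ≤ c * (ENNReal.ofReal (t i) * surfaceMeasure n univ) := by
      intro i
      calc I i x ≤ ∫⁻ h, c * ENNReal.ofReal ‖h‖ ∂(radialMeasure n (t i)) := by
            refine lintegral_mono_ae ?_
            filter_upwards [(radialMeasure_ac (t i)).ae_le hC] with h hh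
            have h1 : ‖m (x, h) - a (toDir (x, h))‖ₑ ≤ ENNReal.ofReal C * ENNReal.ofReal ‖h‖ := by
              rw [← ENNReal.ofReal_mul' (norm_nonneg h), Real.enorm_eq_ofReal_abs]
              exact ENNReal.ofReal_le_ofReal hh
            calc ‖m (x, h) - a (toDir (x, h))‖ₑ ^ r
                = ‖m (x, h) - a (toDir (x, h))‖ₑ ^ (r - 1) *
                  ‖m (x, h) - a (toDir (x, h))‖ₑ := by
                  conv_rhs => rw [← ENNReal.rpow_one ‖m (x, h) - a (toDir (x, h))‖ₑ,
                    ← ENNReal.rpow_mul, one_mul]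
                  rw [← ENNReal.rpow_add_of_nonneg _ _ hr0 zero_le_one, sub_add_cancel]
              _ ≤ ENNReal.ofReal up ^ (r - 1) * (ENNReal.ofReal C * ENNReal.ofReal ‖h‖) := by
                  gcongr
                  exact hK.enorm_sub_le _
              _ = _ := by rw [hc, mul_assoc]
        _ = c * ∫⁻ h, ENNReal.ofReal ‖h‖ ∂(radialMeasure n (t i)) :=
            lintegral_const_mul _ (by fun_prop)
        _ ≤ _ := by gcongr; exact lintegral_norm_radialMeasure_le (ht i)
    have hlim : Tendsto (fun i => c * (ENNReal.ofReal (t i) * surfaceMeasure n univ)) l (𝓝 0) := by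
      have h1 : Tendsto (fun i => ENNReal.ofReal (t i)) l (𝓝 0) := by
        simpa using ENNReal.tendsto_ofReal ht0
      have h2 := ENNReal.Tendsto.mul_const h1 (b := surfaceMeasure n univ) (Or.inr hσ)
      simpa using ENNReal.Tendsto.const_mul h2 (a := c) (Or.inr hctop)
    exact tendsto_of_tendsto_of_tendsto_of_le_of_le tendsto_const_nhds hlim (fun _ => zero_le) hle
  have hfin : ∀ᵐ x, f x < ∞ := ae_lt_top hf hfi
  have hdct : Tendsto (fun i => ∫⁻ x, f x * I i x) l (𝓝 (∫⁻ _ : Eucl n, 0)) := by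
    refine tendsto_lintegral_filter_of_dominated_convergence
      (fun x => f x * (b * surfaceMeasure n univ))
      (Eventually.of_forall fun i => hf.mul (hIm i))
      (Eventually.of_forall fun i => Eventually.of_forall fun x => by gcongr; exact hIb i x) ?_ ?_
    · rw [lintegral_mul_const _ hf]
      exact ENNReal.mul_ne_top hfi (ENNReal.mul_ne_top hbtop hσ)
    · filter_upwards [hI0, hfin] with x hx hfx
      simpa using ENNReal.Tendsto.const_mul hx (a := f x) (Or.inr hfx.ne)
  simpa using hdct

theorem IsRegularKernel.sphereEnergy_ne_top (hK : IsRegularKernel m a lo up) (hp : 1 ≤ p)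
    (hp' : p ≠ ∞) {g : Eucl n → Eucl n} (hgm : Measurable g) (hg : MemLp g p volume) :
    sphereEnergy a p g ≠ ∞ := by
  refine ne_top_of_le_ne_top (ENNReal.mul_ne_top (ENNReal.ofReal_ne_top (r := up))
    (lintegral_sphGrad_lt_top hp hp' hgm hg).ne) ?_
  rw [← lintegral_const_mul _ ((measurable_sphGrad hgm).enorm.pow_const _)]
  refine lintegral_mono fun z => ?_
  gcongr
  exact hK.a_le_up z

/-- The energies of the limit profile converge, up to an error. -/
theorem IsRegularKernel.exists_pairEnergy_gradDir_le (hK : IsRegularKernel m a lo up) {ι : Type*}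
    {l : Filter ι} [l.IsCountablyGenerated] {t : ι → ℝ} (ht : ∀ i, 0 < t i)
    (ht0 : Tendsto t l (𝓝 0)) (hp : 1 ≤ p) (hp' : p ≠ ∞) {g : Eucl n → Eucl n}
    (hgm : Measurable g) (hg : MemLp g p volume) :
    ∃ e : ι → ℝ≥0∞, Tendsto e l (𝓝 0) ∧
      ∀ i, pairEnergy m p (t i) (gradDir g) ≤ sphereEnergy a p g + e i := by
  have hfm : Measurable fun x => ‖g x‖ₑ ^ p.toReal := hgm.enorm.pow_const _
  refine ⟨_, hK.tendsto_lintegral_sub ht ht0 le_rfl hfm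
    (lintegral_rpow_enorm_lt_top hp hp' hg).ne, fun i => ?_⟩
  have hm1 : Measurable fun z => ENNReal.ofReal (a z) * ‖sphGrad g z‖ₑ ^ p.toReal :=
    hK.measurable_a.ennreal_ofReal.mul ((measurable_sphGrad hgm).enorm.pow_const _)
  have hm2 : Measurable fun z : Eucl n × Eucl n =>
      ENNReal.ofReal (a (toDir z)) * ‖sphGrad g (toDir z)‖ₑ ^ p.toReal :=
    hm1.comp measurable_toDir
  rw [sphereEnergy, ← lintegral_toDir (ht i) hm1, pairEnergy, ← lintegral_add_left hm2]
  refine lintegral_mono fun z => ?_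
  rw [gradDir_eq, ENNReal.rpow_one, mul_comm (‖g z.1‖ₑ ^ p.toReal)]
  have h1 : ENNReal.ofReal (m z) ≤ ENNReal.ofReal (a (toDir z)) + ‖m z - a (toDir z)‖ₑ := by
    rw [Real.enorm_eq_ofReal_abs, ← ENNReal.ofReal_add (hK.lo_pos.le.trans (hK.lo_le_a _))
      (abs_nonneg _)]
    refine ENNReal.ofReal_le_ofReal ?_
    linarith [le_abs_self (m z - a (toDir z))]
  calc _ ≤ (ENNReal.ofReal (a (toDir z)) + ‖m z - a (toDir z)‖ₑ) *
        ‖sphGrad g (toDir z)‖ₑ ^ p.toReal := by gcongr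
    _ ≤ _ := by
      rw [add_mul]
      gcongr
      exact enorm_sphGrad_le g (toDir z)

/-- The energies of a fixed Sobolev function are asymptotically at most the limit energy. -/
theorem IsRegularKernel.exists_pairEnergy_diffQuot_le (hK : IsRegularKernel m a lo up) {ι : Type*}
    {l : Filter ι} [l.IsCountablyGenerated] {t : ι → ℝ} (ht : ∀ i, 0 < t i)
    (ht0 : Tendsto t l (𝓝 0)) (hp : 1 ≤ p) (hp' : p ≠ ∞) {u : Eucl n → ℝ} {g : Eucl n → Eucl n}
    (hw : HasWeakGradient u g) (hum : Measurable u) (hgm : Measurable g) (hu : MemLp u p volume)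
    (hg : MemLp g p volume) :
    ∃ e : ι → ℝ≥0∞, Tendsto e l (𝓝 (sphereEnergy a p g)) ∧
      ∀ i, pairEnergy m p (t i) (diffQuot u) ≤ e i := by
  have hP := toReal_pos_of_one_le hp hp'
  have hP1 : 1 ≤ p.toReal := by simpa using (ENNReal.toReal_le_toReal (by simp) hp').2 hp
  obtain ⟨e, he, hle⟩ := hK.exists_pairEnergy_gradDir_le ht ht0 hp hp' hgm hg
  have ht' : Tendsto t l (𝓝[>] 0) :=
    tendsto_nhdsWithin_iff.2 ⟨ht0, Eventually.of_forall fun i => ht i⟩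
  have hd := hw.tendsto_lintegral_diffQuot_sub hum hgm hp hp' hu hg ht'
  set d : ι → ℝ≥0∞ := fun i =>
    ∫⁻ z, ‖diffQuot u z - gradDir g z‖ₑ ^ p.toReal ∂(pairMeasure n (t i)) with hdd
  refine ⟨fun i => ((ENNReal.ofReal up * d i) ^ (1 / p.toReal) +
    (sphereEnergy a p g + e i) ^ (1 / p.toReal)) ^ p.toReal, ?_, fun i => ?_⟩
  · have h1 : Tendsto (fun i => ENNReal.ofReal up * d i) l (𝓝 0) := by
      simpa using ENNReal.Tendsto.const_mul hd (a := ENNReal.ofReal up)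
        (Or.inr ENNReal.ofReal_ne_top)
    have h2 : Tendsto (fun i => sphereEnergy a p g + e i) l (𝓝 (sphereEnergy a p g)) := by
      simpa using tendsto_const_nhds.add he
    have h3 := ((h1.ennrpow_const (1 / p.toReal)).add
      (h2.ennrpow_const (1 / p.toReal))).ennrpow_const p.toReal
    have h4 : ((0 : ℝ≥0∞) ^ (1 / p.toReal) + sphereEnergy a p g ^ (1 / p.toReal)) ^ p.toReal =
        sphereEnergy a p g := by
      rw [ENNReal.zero_rpow_of_pos (one_div_pos.2 hP), zero_add, ← ENNReal.rpow_mul, one_div,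
        inv_mul_cancel₀ hP.ne', ENNReal.rpow_one]
    rwa [h4] at h3
  · set M : Eucl n × Eucl n → ℝ≥0∞ := fun z => ENNReal.ofReal (m z) ^ (1 / p.toReal) with hM
    have hMP : ∀ z, M z ^ p.toReal = ENNReal.ofReal (m z) := fun z => by
      simp only [hM]
      rw [← ENNReal.rpow_mul, one_div, inv_mul_cancel₀ hP.ne', ENNReal.rpow_one]
    have hMm : Measurable M := hK.measurable_m.ennreal_ofReal.pow_const _
    have hVm := measurable_diffQuot hum
    have hγm := measurable_gradDir hgm
    have hE : ∀ V : Eucl n × Eucl n → ℝ, pairEnergy m p (t i) V =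
        ∫⁻ z, (M z * ‖V z‖ₑ) ^ p.toReal ∂(pairMeasure n (t i)) := fun V => by
      refine lintegral_congr fun z => ?_
      rw [ENNReal.mul_rpow_of_nonneg _ _ hP.le, hMP]
    have hmin := ENNReal.lintegral_Lp_add_le (μ := pairMeasure n (t i)) (p := p.toReal)
      (f := fun z => M z * ‖diffQuot u z - gradDir g z‖ₑ) (g := fun z => M z * ‖gradDir g z‖ₑ)
      (hMm.mul (hVm.sub hγm).enorm).aemeasurable (hMm.mul hγm.enorm).aemeasurable hP1
    have h1 : pairEnergy m p (t i) (diffQuot u) ≤ ∫⁻ z, ((fun z => M z *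
        ‖diffQuot u z - gradDir g z‖ₑ) + fun z => M z * ‖gradDir g z‖ₑ) z ^ p.toReal
        ∂(pairMeasure n (t i)) := by
      rw [hE]
      refine lintegral_mono fun z => ?_
      simp only [Pi.add_apply]
      rw [← mul_add]
      gcongr
      simpa using enorm_add_le (diffQuot u z - gradDir g z) (gradDir g z)
    have h2 : ∫⁻ z, (M z * ‖diffQuot u z - gradDir g z‖ₑ) ^ p.toReal ∂(pairMeasure n (t i)) ≤
        ENNReal.ofReal up * d i := by
      have hdm : Measurable fun z => ‖diffQuot u z - gradDir g z‖ₑ ^ p.toReal :=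
        (hVm.sub hγm).enorm.pow_const _
      simp only [hdd]
      rw [← lintegral_const_mul _ hdm]
      refine lintegral_mono fun z => ?_
      rw [ENNReal.mul_rpow_of_nonneg _ _ hP.le, hMP]
      gcongr
      exact hK.m_le_up z
    calc pairEnergy m p (t i) (diffQuot u)
        = (pairEnergy m p (t i) (diffQuot u) ^ (1 / p.toReal)) ^ p.toReal := by
          rw [← ENNReal.rpow_mul, one_div, inv_mul_cancel₀ hP.ne', ENNReal.rpow_one]
      _ ≤ _ := by
          refine ENNReal.rpow_le_rpow ?_ hP.le
          refine (ENNReal.rpow_le_rpow h1 (one_div_nonneg.2 hP.le)).trans (hmin.trans ?_)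
          rw [← hE (gradDir g)]
          have := one_div_nonneg.2 hP.le
          gcongr
          exact hle i

end RegularKernel

/-! ### The lower bound for regular kernels -/

theorem tendsto_integral_mul_zero {α ι : Type*} [MeasurableSpace α] {l : Filter ι}
    {μ : ι → Measure α} {P Q : ℝ} (hPQ : P.HolderConjugate Q) {f g : ι → α → ℝ}
    (hf : ∀ i, Measurable (f i)) (hg : ∀ i, Measurable (g i)) {K : ℝ≥0∞} (hK : K ≠ ∞)
    (hfK : ∀ i, ∫⁻ x, ‖f i x‖ₑ ^ P ∂(μ i) ≤ K)
    (hg0 : Tendsto (fun i => ∫⁻ x, ‖g i x‖ₑ ^ Q ∂(μ i)) l (𝓝 0)) :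
    Tendsto (fun i => ∫ x, f i x * g i x ∂(μ i)) l (𝓝 0) := by
  have hP := one_div_nonneg.2 hPQ.nonneg
  have hQ := one_div_pos.2 hPQ.symm.pos
  have h1 : Tendsto (fun i => K ^ (1 / P) * (∫⁻ x, ‖g i x‖ₑ ^ Q ∂(μ i)) ^ (1 / Q)) l (𝓝 0) := by
    have h2 := hg0.ennrpow_const (1 / Q)
    rw [ENNReal.zero_rpow_of_pos hQ] at h2
    simpa using ENNReal.Tendsto.const_mul h2 (a := K ^ (1 / P))
      (Or.inr (ENNReal.rpow_ne_top_of_nonneg hP hK))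
  have h3 : Tendsto (fun i => ‖∫ x, f i x * g i x ∂(μ i)‖ₑ) l (𝓝 0) := by
    refine tendsto_of_tendsto_of_tendsto_of_le_of_le tendsto_const_nhds h1 (fun _ => zero_le)
      fun i => ?_
    refine (enorm_integral_le_lintegral_enorm _).trans
      ((lintegral_enorm_mul_le hPQ (hf i).aemeasurable (hg i).aemeasurable).trans ?_)
    gcongr
    exact hfK i
  rw [tendsto_zero_iff_norm_tendsto_zero]
  simpa [Function.comp_def] using (ENNReal.tendsto_toReal ENNReal.zero_ne_top).comp h3

theorem diffQuot_sub {n : ℕ} (u v : Eucl n → ℝ) (z : Eucl n × Eucl n) :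
    diffQuot (u - v) z = diffQuot u z - diffQuot v z := by
  simp only [diffQuot, Pi.sub_apply]
  ring

section RegularKernel

variable {n : ℕ} {p q : ℝ≥0∞} [NeZero n] {m : Eucl n × Eucl n → ℝ} {a : Eucl n × USphere n → ℝ}
  {lo up : ℝ}

theorem measurable_dualPow_gradDir {g : Eucl n → Eucl n} (hg : Measurable g) (P : ℝ) :
    Measurable fun z => dualPow P (gradDir g z) :=
  (measurable_dualPow P).comp (measurable_gradDir hg)

theorem lintegral_enorm_dualPow_gradDir
    (hpq : p.toReal.HolderConjugate q.toReal) {t : ℝ} (ht : 0 < t) {g : Eucl n → Eucl n}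
    (hgm : Measurable g) :
    ∫⁻ z, ‖dualPow p.toReal (gradDir g z)‖ₑ ^ q.toReal ∂(pairMeasure n t) =
      ∫⁻ z, ‖sphGrad g z‖ₑ ^ p.toReal ∂(bundleMeasure n) := by
  rw [← lintegral_toDir ht ((measurable_sphGrad hgm).enorm.pow_const _)]
  refine lintegral_congr fun z => ?_
  rw [enorm_dualPow_rpow hpq, gradDir_eq]

theorem IsRegularKernel.integral_gradDir_mul_dualPow (hK : IsRegularKernel m a lo up) (hp : 1 ≤ p)
    (hp' : p ≠ ∞) {t : ℝ} (ht : 0 < t) {g : Eucl n → Eucl n} (hgm : Measurable g) :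
    ∫ z, gradDir g z * (a (toDir z) * dualPow p.toReal (gradDir g z)) ∂(pairMeasure n t) =
      (sphereEnergy a p g).toReal := by
  have hP := toReal_pos_of_one_le hp hp'
  have ha0 : ∀ z, 0 ≤ a z := fun z => hK.lo_pos.le.trans (hK.lo_le_a z)
  have e1 : ∀ z, gradDir g z * (a (toDir z) * dualPow p.toReal (gradDir g z)) =
      a (toDir z) * |gradDir g z| ^ p.toReal := fun z => by
    rw [← dualPow_mul_self hP]; ring
  simp only [e1]
  have hm : Measurable fun z => a (toDir z) * |gradDir g z| ^ p.toReal :=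
    (hK.measurable_a.comp measurable_toDir).mul ((measurable_gradDir hgm).abs.pow_const _)
  have hm2 : Measurable fun z => ENNReal.ofReal (a z) * ‖sphGrad g z‖ₑ ^ p.toReal :=
    hK.measurable_a.ennreal_ofReal.mul ((measurable_sphGrad hgm).enorm.pow_const _)
  rw [integral_eq_lintegral_of_nonneg_ae (Eventually.of_forall fun z =>
    mul_nonneg (ha0 _) (by positivity)) hm.aestronglyMeasurable, sphereEnergy,
    ← lintegral_toDir ht hm2]
  congr 1
  refine lintegral_congr fun z => ?_
  rw [ofReal_mul_abs_rpow (ha0 _) hP.le, gradDir_eq]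

/-- Pairing the difference quotients of a converging sequence with the dual of the limit profile
recovers the limit energy. -/
theorem IsRegularKernel.tendsto_integral_diffQuot_mul_dualPow (hK : IsRegularKernel m a lo up)
    {ι : Type*} {l : Filter ι} [l.IsCountablyGenerated] (hp' : p ≠ ∞) (hq' : q ≠ ∞)
    (hpq : p.toReal.HolderConjugate q.toReal) {t : ι → ℝ} (ht : ∀ i, 0 < t i)
    (ht0 : Tendsto t l (𝓝 0)) {u : ι → Eucl n → ℝ} {u₀ : Eucl n → ℝ}
    (hum : ∀ i, Measurable (u i)) (hum₀ : Measurable u₀) (hup : ∀ i, MemLp (u i) p volume)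
    (hup₀ : MemLp u₀ p volume) (hlim : Tendsto (fun i => eLpNorm (u i - u₀) p volume) l (𝓝 0))
    {K : ℝ≥0∞} (hKtop : K ≠ ∞)
    (huK : ∀ i, ∫⁻ z, ‖diffQuot (u i) z‖ₑ ^ p.toReal ∂(pairMeasure n (t i)) ≤ K)
    {g : Eucl n → Eucl n} (hw : HasWeakGradient u₀ g) (hgm : Measurable g)
    (hg : MemLp g p volume) :
    Tendsto (fun i => ∫ z, diffQuot (u i) z * (m z * dualPow p.toReal (gradDir g z))
      ∂(pairMeasure n (t i))) l (𝓝 (sphereEnergy a p g).toReal) := by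
  have hp := one_le_of_holderConjugate hp' hpq
  have hq := one_le_of_holderConjugate hq' hpq.symm
  have hP := toReal_pos_of_one_le hp hp'
  have hQ := toReal_pos_of_one_le hq hq'
  have hQ1 : 1 ≤ q.toReal := hpq.symm.lt.le
  set G : Eucl n × USphere n → ℝ := fun z => a z * dualPow p.toReal (sphGrad g z) with hG
  have hGm : Measurable G :=
    hK.measurable_a.mul ((measurable_dualPow _).comp (measurable_sphGrad hgm))
  set N : ℝ≥0∞ := ∫⁻ z, ‖sphGrad g z‖ₑ ^ p.toReal ∂(bundleMeasure n) with hN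
  have hNtop : N ≠ ∞ := (lintegral_sphGrad_lt_top hp hp' hgm hg).ne
  have hGint : ∫⁻ z, ‖G z‖ₑ ^ q.toReal ∂(bundleMeasure n) ≤ ENNReal.ofReal up ^ q.toReal * N := by
    rw [hN, ← lintegral_const_mul _ ((measurable_sphGrad hgm).enorm.pow_const _)]
    refine lintegral_mono fun z => ?_
    rw [hG, enorm_mul, ENNReal.mul_rpow_of_nonneg _ _ hQ.le, enorm_dualPow_rpow hpq,
      Real.enorm_eq_ofReal (hK.lo_pos.le.trans (hK.lo_le_a z))]
    gcongr
    exact hK.a_le_up z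
  have hGtop : ENNReal.ofReal up ^ q.toReal * N ≠ ∞ :=
    ENNReal.mul_ne_top (ENNReal.rpow_ne_top_of_nonneg hQ.le ENNReal.ofReal_ne_top) hNtop
  have hGLp : MemLp G q (bundleMeasure n) := by
    refine ⟨hGm.aestronglyMeasurable, ?_⟩
    rw [eLpNorm_lt_top_iff_lintegral_rpow_enorm_lt_top (one_pos.trans_le hq).ne' hq']
    exact hGint.trans_lt hGtop.lt_top
  have hGd : ∀ i, ∫⁻ z, ‖G (toDir z)‖ₑ ^ q.toReal ∂(pairMeasure n (t i)) ≤
      ENNReal.ofReal up ^ q.toReal * N := fun i => by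
    rw [lintegral_toDir (ht i) (f := fun z => ‖G z‖ₑ ^ q.toReal) (hGm.enorm.pow_const _)]
    exact hGint
  have hGtm : Measurable fun z => G (toDir z) := hGm.comp measurable_toDir
  set D : Eucl n × Eucl n → ℝ :=
    fun z => (m z - a (toDir z)) * dualPow p.toReal (gradDir g z) with hD
  have hDm : Measurable D := hK.measurable_sub.mul (measurable_dualPow_gradDir hgm _)
  have hD0 : Tendsto (fun i => ∫⁻ z, ‖D z‖ₑ ^ q.toReal ∂(pairMeasure n (t i))) l (𝓝 0) := by
    refine tendsto_of_tendsto_of_tendsto_of_le_of_le tendsto_const_nhds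
      (hK.tendsto_lintegral_sub ht ht0 hQ1 (f := fun x => ‖g x‖ₑ ^ p.toReal)
        (hgm.enorm.pow_const _) (lintegral_rpow_enorm_lt_top hp hp' hg).ne)
      (fun _ => zero_le) fun i => lintegral_mono fun z => ?_
    rw [hD, enorm_mul, ENNReal.mul_rpow_of_nonneg _ _ hQ.le, enorm_dualPow_rpow hpq, mul_comm]
    gcongr
    exact enorm_sphGrad_le g (toDir z)
  have hDtop : ∀ i, ∫⁻ z, ‖D z‖ₑ ^ q.toReal ∂(pairMeasure n (t i)) ≠ ∞ := fun i => by
    refine ne_top_of_le_ne_top hGtop ?_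
    rw [hN, ← lintegral_enorm_dualPow_gradDir hpq (ht i) hgm,
      ← lintegral_const_mul _ ((measurable_dualPow_gradDir hgm _).enorm.pow_const _)]
    refine lintegral_mono fun z => ?_
    rw [hD, enorm_mul, ENNReal.mul_rpow_of_nonneg _ _ hQ.le]
    gcongr
    exact hK.enorm_sub_le z
  have hVm : ∀ i, Measurable (diffQuot (u i)) := fun i => measurable_diffQuot (hum i)
  have hWm := measurable_diffQuot hum₀
  have hγm := measurable_gradDir hgm
  obtain ⟨M, hMtop, hM⟩ := hw.lintegral_diffQuot_sub_le_const hum₀ hgm hp hp' hup₀ hg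
  have hγN : ∀ i, ∫⁻ z, ‖gradDir g z‖ₑ ^ p.toReal ∂(pairMeasure n (t i)) = N := fun i => by
    rw [hN, ← lintegral_toDir (ht i) ((measurable_sphGrad hgm).enorm.pow_const _)]
    rfl
  have hsplit : ∀ (i : ι) (f₁ f₂ : Eucl n × Eucl n → ℝ) (K₁ K₂ : ℝ≥0∞), Measurable f₁ →
      ∫⁻ z, ‖f₁ z‖ₑ ^ p.toReal ∂(pairMeasure n (t i)) ≤ K₁ →
      ∫⁻ z, ‖f₂ z‖ₑ ^ p.toReal ∂(pairMeasure n (t i)) ≤ K₂ →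
      ∀ f : Eucl n × Eucl n → ℝ, (∀ z, ‖f z‖ₑ ≤ ‖f₁ z‖ₑ + ‖f₂ z‖ₑ) →
      ∫⁻ z, ‖f z‖ₑ ^ p.toReal ∂(pairMeasure n (t i)) ≤ 2 ^ p.toReal * (K₁ + K₂) := by
    intro i f₁ f₂ K₁ K₂ hf₁ h₁ h₂ f hf
    calc _ ≤ ∫⁻ z, 2 ^ p.toReal * (‖f₁ z‖ₑ ^ p.toReal + ‖f₂ z‖ₑ ^ p.toReal)
          ∂(pairMeasure n (t i)) := by
          refine lintegral_mono fun z => ?_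
          exact (ENNReal.rpow_le_rpow (hf z) hP.le).trans (ennreal_add_rpow_le hP.le _ _)
      _ = 2 ^ p.toReal * (∫⁻ z, ‖f₁ z‖ₑ ^ p.toReal ∂(pairMeasure n (t i)) +
          ∫⁻ z, ‖f₂ z‖ₑ ^ p.toReal ∂(pairMeasure n (t i))) := by
          rw [lintegral_const_mul' _ _ (by simp), lintegral_add_left (hf₁.enorm.pow_const _)]
      _ ≤ _ := by gcongr
  have hWK : ∀ i, ∫⁻ z, ‖diffQuot u₀ z‖ₑ ^ p.toReal ∂(pairMeasure n (t i)) ≤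
      2 ^ p.toReal * (M + N) := fun i =>
    hsplit i _ _ M N (hWm.sub hγm) (hM _ (ht i)) (hγN i).le _ fun z => by
      simpa using enorm_add_le (diffQuot u₀ z - gradDir g z) (gradDir g z)
  have hwK : ∀ i, ∫⁻ z, ‖diffQuot (u i - u₀) z‖ₑ ^ p.toReal ∂(pairMeasure n (t i)) ≤
      2 ^ p.toReal * (K + 2 ^ p.toReal * (M + N)) := fun i =>
    hsplit i _ _ _ _ (hVm i) (huK i) (hWK i) _ fun z => by
      rw [diffQuot_sub]
      exact _root_.enorm_sub_le
  have h2P : (2 : ℝ≥0∞) ^ p.toReal ≠ ∞ := ENNReal.rpow_ne_top_of_nonneg hP.le (by simp)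
  have hwtop : 2 ^ p.toReal * (K + 2 ^ p.toReal * (M + N)) ≠ ∞ :=
    ENNReal.mul_ne_top h2P (ENNReal.add_ne_top.2 ⟨hKtop,
      ENNReal.mul_ne_top h2P (ENNReal.add_ne_top.2 ⟨hMtop, hNtop⟩)⟩)
  have ht' : Tendsto t l (𝓝[>] 0) :=
    tendsto_nhdsWithin_iff.2 ⟨ht0, Eventually.of_forall fun i => ht i⟩
  have T1 := tendsto_integral_mul_zero (μ := fun i => pairMeasure n (t i)) hpq hVm
    (fun _ => hDm) hKtop huK hD0
  have T2 := tendsto_integral_diffQuot_mul_zero hp' hq' hpq ht (fun i => (hum i).sub hum₀)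
    (fun i => (hup i).sub hup₀) hlim hwtop hwK hGm hGLp
  have T3 := tendsto_integral_mul_zero (μ := fun i => pairMeasure n (t i)) hpq.symm
    (fun _ => hGtm) (fun _ => hWm.sub hγm) hGtop hGd
    (hw.tendsto_lintegral_diffQuot_sub hum₀ hgm hp hp' hup₀ hg ht')
  have hsum := ((T1.add T2).add T3).add
    (tendsto_const_nhds (x := (sphereEnergy a p g).toReal))
  rw [zero_add, zero_add, zero_add] at hsum
  refine hsum.congr fun i => ?_
  have hGi := ne_top_of_le_ne_top hGtop (hGd i)
  have I1 := integrable_mul_of_lintegral_rpow hpq (hVm i) hDm (ne_top_of_le_ne_top hKtop (huK i))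
    (hDtop i)
  have I2 := integrable_mul_of_lintegral_rpow hpq (measurable_diffQuot ((hum i).sub hum₀)) hGtm
    (ne_top_of_le_ne_top hwtop (hwK i)) hGi
  have I3 := integrable_mul_of_lintegral_rpow hpq.symm hGtm (hWm.sub hγm) hGi
    (ne_top_of_le_ne_top hMtop (hM _ (ht i)))
  have I4 := integrable_mul_of_lintegral_rpow hpq hγm hGtm ((hγN i).trans_ne hNtop) hGi
  rw [← hK.integral_gradDir_mul_dualPow hp hp' (ht i) hgm]
  have e4 : ∫ z, gradDir g z * (a (toDir z) * dualPow p.toReal (gradDir g z))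
      ∂(pairMeasure n (t i)) = ∫ z, gradDir g z * G (toDir z) ∂(pairMeasure n (t i)) := rfl
  have e5 := integral_add' ((I1.add I2).add I3) I4
  rw [integral_add' (I1.add I2) I3, integral_add' I1 I2] at e5
  rw [e4]
  refine e5.symm.trans ?_
  refine integral_congr_ae (Eventually.of_forall fun z => ?_)
  simp only [Pi.add_apply, Pi.sub_apply, diffQuot_sub, hD, hG, gradDir_eq]
  ring

/-- Young's inequality for the weighted pairing. -/
theorem IsRegularKernel.integral_diffQuot_mul_dualPow_le (hK : IsRegularKernel m a lo up)
    (hp : 1 ≤ p) (hp' : p ≠ ∞) (hpq : p.toReal.HolderConjugate q.toReal) {t : ℝ}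
    {V W : Eucl n × Eucl n → ℝ} (hV : Measurable V) (hW : Measurable W)
    (hVtop : pairEnergy m p t V ≠ ∞) (hWtop : pairEnergy m p t W ≠ ∞) :
    ∫ z, V z * (m z * dualPow p.toReal (W z)) ∂(pairMeasure n t) ≤
      (pairEnergy m p t V).toReal / p.toReal + (pairEnergy m p t W).toReal / q.toReal := by
  have hP := toReal_pos_of_one_le hp hp'
  have hm0 : ∀ z, 0 ≤ m z := fun z => hK.lo_pos.le.trans (hK.lo_le_m z)
  have hint : ∀ U : Eucl n × Eucl n → ℝ, Measurable U → pairEnergy m p t U ≠ ∞ →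
      Integrable (fun z => m z * |U z| ^ p.toReal) (pairMeasure n t) ∧
      ∫ z, m z * |U z| ^ p.toReal ∂(pairMeasure n t) = (pairEnergy m p t U).toReal := by
    intro U hU hUtop
    have hUm : Measurable fun z => m z * |U z| ^ p.toReal :=
      hK.measurable_m.mul (hU.abs.pow_const _)
    have h0 : ∀ z, 0 ≤ m z * |U z| ^ p.toReal := fun z => mul_nonneg (hm0 z) (by positivity)
    have e : ∫⁻ z, ENNReal.ofReal (m z * |U z| ^ p.toReal) ∂(pairMeasure n t) =
        pairEnergy m p t U :=
      lintegral_congr fun z => ofReal_mul_abs_rpow (hm0 z) hP.le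
    constructor
    · rw [← lintegral_ofReal_ne_top_iff_integrable hUm.aestronglyMeasurable
        (Eventually.of_forall h0), e]
      exact hUtop
    · rw [integral_eq_lintegral_of_nonneg_ae (Eventually.of_forall h0) hUm.aestronglyMeasurable, e]
  obtain ⟨iV, eV⟩ := hint V hV hVtop
  obtain ⟨iW, eW⟩ := hint W hW hWtop
  rw [← eV, ← eW, ← integral_div, ← integral_div,
    ← integral_add (iV.div_const _) (iW.div_const _)]
  have hpt : ∀ z, |V z * (m z * dualPow p.toReal (W z))| ≤
      m z * |V z| ^ p.toReal / p.toReal + m z * |W z| ^ p.toReal / q.toReal := fun z => by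
    have h1 := Real.young_inequality_of_nonneg (abs_nonneg (V z))
      (abs_nonneg (dualPow p.toReal (W z))) hpq
    rw [abs_dualPow_rpow hpq] at h1
    have h2 := mul_le_mul_of_nonneg_left h1 (hm0 z)
    rw [abs_mul, abs_mul, abs_of_nonneg (hm0 z)]
    calc _ = m z * (|V z| * |dualPow p.toReal (W z)|) := by ring
      _ ≤ _ := h2
      _ = _ := by ring
  refine (le_abs_self _).trans (abs_integral_le_integral_abs.trans ?_)
  exact integral_mono_of_nonneg (Eventually.of_forall fun z => abs_nonneg _)
    ((iV.div_const _).add (iW.div_const _)) (Eventually.of_forall hpt)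

/-- The lower bound: energies of converging sequences are asymptotically at least the limit
energy. -/
theorem IsRegularKernel.sphereEnergy_le_of_tendsto (hK : IsRegularKernel m a lo up)
    {ι : Type*} {l : Filter ι} [l.NeBot] [l.IsCountablyGenerated] (hp' : p ≠ ∞) (hq' : q ≠ ∞)
    (hpq : p.toReal.HolderConjugate q.toReal) {t : ι → ℝ} (ht : ∀ i, 0 < t i)
    (ht0 : Tendsto t l (𝓝 0)) {u : ι → Eucl n → ℝ} {u₀ : Eucl n → ℝ}
    (hum : ∀ i, Measurable (u i)) (hum₀ : Measurable u₀) (hup : ∀ i, MemLp (u i) p volume)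
    (hup₀ : MemLp u₀ p volume) (hlim : Tendsto (fun i => eLpNorm (u i - u₀) p volume) l (𝓝 0))
    {c : ι → ℝ≥0∞} {c₀ K : ℝ≥0∞} (hKtop : K ≠ ∞) (hcK : ∀ i, c i ≤ K)
    (hc : Tendsto c l (𝓝 c₀)) (huc : ∀ i, pairEnergy m p (t i) (diffQuot (u i)) ≤ c i) :
    ∃ g, HasWeakGradient u₀ g ∧ Measurable g ∧ MemLp g p volume ∧ sphereEnergy a p g ≤ c₀ := by
  have hp := one_le_of_holderConjugate hp' hpq
  have hP := toReal_pos_of_one_le hp hp'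
  have hVm : ∀ i, Measurable (diffQuot (u i)) := fun i => measurable_diffQuot (hum i)
  set K' : ℝ≥0∞ := (ENNReal.ofReal lo)⁻¹ * K with hK'
  have hlo : ENNReal.ofReal lo ≠ 0 := (ENNReal.ofReal_pos.2 hK.lo_pos).ne'
  have hK'top : K' ≠ ∞ := ENNReal.mul_ne_top (ENNReal.inv_ne_top.2 hlo) hKtop
  have huK : ∀ i, ∫⁻ z, ‖diffQuot (u i) z‖ₑ ^ p.toReal ∂(pairMeasure n (t i)) ≤ K' := fun i => by
    have h1 : ENNReal.ofReal lo * ∫⁻ z, ‖diffQuot (u i) z‖ₑ ^ p.toReal ∂(pairMeasure n (t i)) ≤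
        K := by
      rw [← lintegral_const_mul _ ((hVm i).enorm.pow_const _)]
      refine le_trans (lintegral_mono fun z => ?_) ((huc i).trans (hcK i))
      gcongr
      exact hK.lo_le_m z
    exact (ENNReal.mul_le_iff_le_inv hlo ENNReal.ofReal_ne_top).1 h1
  obtain ⟨g, hw, hgm, hg⟩ := exists_hasWeakGradient hp' hq' hpq ht ht0 hum hum₀ hup hup₀ hlim
    hK'top huK
  refine ⟨g, hw, hgm, hg, ?_⟩
  have hBtop := hK.sphereEnergy_ne_top hp hp' hgm hg
  have hc₀ : c₀ ≠ ∞ := ne_top_of_le_ne_top hKtop (le_of_tendsto hc (Eventually.of_forall hcK))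
  obtain ⟨e, he, hle⟩ := hK.exists_pairEnergy_gradDir_le ht ht0 hp hp' hgm hg
  have hC := hK.tendsto_integral_diffQuot_mul_dualPow hp' hq' hpq ht ht0 hum hum₀ hup hup₀ hlim
    hK'top huK hw hgm hg
  have hBe : Tendsto (fun i => sphereEnergy a p g + e i) l (𝓝 (sphereEnergy a p g)) := by
    simpa using tendsto_const_nhds.add he
  have hlim2 := (((ENNReal.tendsto_toReal hc₀).comp hc).div_const p.toReal).add
    (((ENNReal.tendsto_toReal hBtop).comp hBe).div_const q.toReal)
  have hev : ∀ᶠ i in l, e i < ∞ := he.eventually (gt_mem_nhds ENNReal.zero_lt_top)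
  have hfinal := le_of_tendsto_of_tendsto hC hlim2 (by
    filter_upwards [hev] with i hi
    have hsum : sphereEnergy a p g + e i ≠ ∞ := ENNReal.add_ne_top.2 ⟨hBtop, hi.ne⟩
    have hci : c i ≠ ∞ := ne_top_of_le_ne_top hKtop (hcK i)
    refine (hK.integral_diffQuot_mul_dualPow_le hp hp' hpq (hVm i) (measurable_gradDir hgm)
      (ne_top_of_le_ne_top hci (huc i)) (ne_top_of_le_ne_top hsum (hle i))).trans ?_
    have h1 := ENNReal.toReal_mono hci (huc i)
    have h2 := ENNReal.toReal_mono hsum (hle i)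
    simp only [Function.comp_apply]
    have hQ := hpq.symm.nonneg
    gcongr)
  rw [← ENNReal.toReal_le_toReal hBtop hc₀]
  have hconj := hpq.inv_add_inv_eq_one
  set B := (sphereEnergy a p g).toReal
  have h3 : B = B / p.toReal + B / q.toReal := by
    rw [div_eq_mul_inv, div_eq_mul_inv, ← mul_add, hconj, mul_one]
  have h4 : B / p.toReal ≤ c₀.toReal / p.toReal := by linarith
  exact (div_le_div_iff_of_pos_right hP).1 h4

end RegularKernel

/-! ### The functionals in terms of the energies of regular kernels -/

section WeakGradient

variable {n : ℕ}

theorem HasWeakGradient.ae_eq {u : Eucl n → ℝ} {g₁ g₂ : Eucl n → Eucl n}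
    (h₁ : HasWeakGradient u g₁) (h₂ : HasWeakGradient u g₂) : g₁ =ᵐ[volume] g₂ := by
  refine ae_eq_of_integral_contDiff_smul_eq h₁.2.1 h₂.2.1 fun φ hφ hφc => ?_
  refine ext_inner_left ℝ fun v => ?_
  have hi : ∀ g : Eucl n → Eucl n, HasWeakGradient u g →
      inner ℝ v (∫ x, φ x • g x) = ∫ x, φ x * inner ℝ (g x) v := fun g hg => by
    rw [← integral_inner
      (hg.2.1.integrable_smul_left_of_hasCompactSupport hφ.continuous hφc) v]
    refine integral_congr_ae (Eventually.of_forall fun x => ?_)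
    simp only [inner_smul_right]
    rw [real_inner_comm]
  rw [hi g₁ h₁, hi g₂ h₂]
  exact neg_injective ((h₁.2.2 φ hφ hφc v).symm.trans (h₂.2.2 φ hφ hφc v))

theorem HasWeakGradient.congr {u : Eucl n → ℝ} {g₁ g₂ : Eucl n → Eucl n}
    (h₁ : HasWeakGradient u g₁) (h : g₁ =ᵐ[volume] g₂) : HasWeakGradient u g₂ := by
  refine ⟨h₁.1, h₁.2.1.congr h, fun φ hφ hφc v => ?_⟩
  rw [h₁.2.2 φ hφ hφc v]
  congr 1
  refine integral_congr_ae ?_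
  filter_upwards [h] with x hx
  rw [hx]

theorem HasWeakGradient.weakGradient_ae_eq {u : Eucl n → ℝ} {g : Eucl n → Eucl n}
    (h : HasWeakGradient u g) : weakGradient u =ᵐ[volume] g := by
  have hex : ∃ g, HasWeakGradient u g := ⟨g, h⟩
  rw [weakGradient, dif_pos hex]
  exact hex.choose_spec.ae_eq h

theorem MemSobolevOne.exists_measurable {p : ℝ≥0∞} {u : Eucl n → ℝ} (h : MemSobolevOne p u) :
    ∃ g, HasWeakGradient u g ∧ Measurable g ∧ MemLp g p volume := by
  obtain ⟨-, g, hw, hg⟩ := h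
  have he := hg.1.aemeasurable.ae_eq_mk
  exact ⟨hg.1.aemeasurable.mk g, hw.congr he, hg.1.aemeasurable.measurable_mk,
    (memLp_congr_ae he).1 hg⟩

end WeakGradient

section ZeroExtension

variable {n : ℕ} {p : ℝ≥0∞} {Ω : Set (Eucl n)}

theorem measurable_indicator_Lp (hΩ : MeasurableSet Ω) (u : Lp ℝ p (volume.restrict Ω)) :
    Measurable (Ω.indicator u) :=
  (Lp.stronglyMeasurable u).measurable.indicator hΩ

theorem memLp_indicator_Lp (hΩ : MeasurableSet Ω) (u : Lp ℝ p (volume.restrict Ω)) :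
    MemLp (Ω.indicator u) p volume :=
  (memLp_indicator_iff_restrict hΩ).2 (Lp.memLp u)

theorem eLpNorm_indicator_Lp_sub (hΩ : MeasurableSet Ω) (u v : Lp ℝ p (volume.restrict Ω)) :
    eLpNorm (Ω.indicator u - Ω.indicator v) p volume = edist u v := by
  rw [Lp.edist_def, ← eLpNorm_indicator_eq_eLpNorm_restrict hΩ, ← indicator_sub']

theorem ae_indicator_eq_zero (u : Eucl n → ℝ) : ∀ᵐ x : Eucl n, x ∉ Ω → Ω.indicator u x = 0 :=
  Eventually.of_forall fun _ hx => indicator_of_notMem hx _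

variable [NeZero n] {m : Eucl n → Eucl n → ℝ} {m' : Eucl n × Eucl n → ℝ}
  {a : Eucl n → USphere n → ℝ} {a' : Eucl n × USphere n → ℝ} {lo up : ℝ}

theorem IsRegularKernel.energy_eq (hK : IsRegularKernel m' a' lo up)
    (hm : ∀ᵐ z : Eucl n × Eucl n, m z.1 z.2 = m' z) (hp : 1 ≤ p) (hp' : p ≠ ∞) {s : ℝ}
    (hs : s < 1) {u : Eucl n → ℝ} (hu : Measurable u) :
    ENNReal.ofReal ((1 - s) / p.toReal) * ∫⁻ z : Eucl n × Eucl n, ENNReal.ofReal (m z.1 z.2 *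
        (|u z.1 - u (z.1 - z.2)| ^ p.toReal / ‖z.2‖ ^ ((n : ℝ) + s * p.toReal))) =
      ENNReal.ofReal (p.toReal⁻¹ * p.toReal⁻¹) *
          pairEnergy m' p (p.toReal * (1 - s)) (diffQuot u) +
        ENNReal.ofReal ((1 - s) / p.toReal) * farEnergy m' p.toReal s u := by
  have hP := toReal_pos_of_one_le hp hp'
  have e1 : pairEnergy m' p (p.toReal * (1 - s)) (diffQuot u) =
      ∫⁻ z, ENNReal.ofReal (m' z * |diffQuot u z| ^ p.toReal)
        ∂(pairMeasure n (p.toReal * (1 - s))) :=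
    lintegral_congr fun z =>
      (ofReal_mul_abs_rpow (hK.lo_pos.le.trans (hK.lo_le_m z)) hP.le).symm
  rw [e1, ← energy_decomposition hu hK.measurable_m hP hs]
  congr 1
  refine lintegral_congr_ae ?_
  filter_upwards [hm] with z hz
  rw [hz]

theorem IsRegularKernel.le_nonlocalEnergy (hK : IsRegularKernel m' a' lo up)
    (hm : ∀ᵐ z : Eucl n × Eucl n, m z.1 z.2 = m' z) (hp : 1 ≤ p) (hp' : p ≠ ∞)
    (hΩ : MeasurableSet Ω) {s : ℝ} (hs : s < 1) (u : Lp ℝ p (volume.restrict Ω)) :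
    ENNReal.ofReal (p.toReal⁻¹ * p.toReal⁻¹) *
      pairEnergy m' p (p.toReal * (1 - s)) (diffQuot (Ω.indicator u)) ≤
        nonlocalEnergy m Ω p s u := by
  rw [nonlocalEnergy]
  split_ifs with h
  · rw [hK.energy_eq hm hp hp' hs (measurable_indicator_Lp hΩ u)]
    exact le_self_add
  · exact le_top

theorem IsRegularKernel.exists_nonlocalEnergy_le (hK : IsRegularKernel m' a' lo up)
    (hm : ∀ᵐ z : Eucl n × Eucl n, m z.1 z.2 = m' z) (hp : 1 ≤ p) (hp' : p ≠ ∞)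
    (hΩ : MeasurableSet Ω) (u : Lp ℝ p (volume.restrict Ω)) :
    ∃ A : ℝ≥0∞, A ≠ ∞ ∧ ∀ s : ℝ, 1 / 2 ≤ s → s < 1 → nonlocalEnergy m Ω p s u ≤
      ENNReal.ofReal (p.toReal⁻¹ * p.toReal⁻¹) *
          pairEnergy m' p (p.toReal * (1 - s)) (diffQuot (Ω.indicator u)) +
        ENNReal.ofReal ((1 - s) / p.toReal) * A := by
  have hP := toReal_pos_of_one_le hp hp'
  set U : Eucl n → ℝ := Ω.indicator u with hU
  have hUm : Measurable U := measurable_indicator_Lp hΩ u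
  have hUp : MemLp U p volume := memLp_indicator_Lp hΩ u
  have hUint : ∫⁻ x, ENNReal.ofReal (|U x| ^ p.toReal) ≠ ∞ := by
    have h1 := lintegral_rpow_enorm_lt_top hp hp' hUp
    refine ne_of_lt (lt_of_eq_of_lt (lintegral_congr fun x => ?_) h1)
    rw [Real.enorm_eq_ofReal_abs, ENNReal.ofReal_rpow_of_nonneg (abs_nonneg _) hP.le]
  have hfar : ∀ M : ℝ, ENNReal.ofReal (M * 2 ^ p.toReal) * (2 * tailMass n p.toReal *
      ∫⁻ x, ENNReal.ofReal (|U x| ^ p.toReal)) ≠ ∞ := fun M =>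
    ENNReal.mul_ne_top ENNReal.ofReal_ne_top (ENNReal.mul_ne_top
      (ENNReal.mul_ne_top (by simp) (tailMass_lt_top hP).ne) hUint)
  refine ⟨_, hfar up, fun s hs1 hs2 => ?_⟩
  have hc : 0 < p.toReal⁻¹ * p.toReal⁻¹ := by positivity
  rcases eq_or_ne (pairEnergy m' p (p.toReal * (1 - s)) (diffQuot U)) ∞ with htop | hfin
  · rw [htop, ENNReal.mul_top (ENNReal.ofReal_pos.2 hc).ne', top_add]
    exact le_top
  have hmem : MemFracSobolevZero Ω s p U := by
    refine ⟨⟨hUp, ?_⟩, ae_indicator_eq_zero _⟩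
    have hdec := energy_decomposition hUm (κ := fun _ => 1) measurable_const hP hs2
    have hnear : ∫⁻ z, ENNReal.ofReal (1 * |diffQuot U z| ^ p.toReal)
        ∂(pairMeasure n (p.toReal * (1 - s))) ≠ ∞ := by
      have h1 : ENNReal.ofReal lo * ∫⁻ z, ENNReal.ofReal (1 * |diffQuot U z| ^ p.toReal)
          ∂(pairMeasure n (p.toReal * (1 - s))) ≤
          pairEnergy m' p (p.toReal * (1 - s)) (diffQuot U) := by
        rw [← lintegral_const_mul' _ _ ENNReal.ofReal_ne_top]
        refine lintegral_mono fun z => ?_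
        rw [ofReal_mul_abs_rpow zero_le_one hP.le, ENNReal.ofReal_one, one_mul]
        gcongr
        exact hK.lo_le_m z
      intro h
      rw [h, ENNReal.mul_top (ENNReal.ofReal_pos.2 hK.lo_pos).ne', top_le_iff] at h1
      exact hfin h1
    have hfar1 := ne_top_of_le_ne_top (hfar 1) (farEnergy_le hUm (κ := fun _ => 1)
      (fun _ => zero_le_one) (fun _ => le_rfl) hP hs1)
    have hrhs := ENNReal.add_ne_top.2 ⟨ENNReal.mul_ne_top
      (ENNReal.ofReal_ne_top (r := p.toReal⁻¹ * p.toReal⁻¹)) hnear, ENNReal.mul_ne_top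
      (ENNReal.ofReal_ne_top (r := (1 - s) / p.toReal)) hfar1⟩
    rw [← hdec] at hrhs
    simp only [one_mul] at hrhs
    refine lt_top_iff_ne_top.2 fun h => hrhs ?_
    have h2 : 0 < (1 - s) / p.toReal := div_pos (by linarith) hP
    rw [gagliardoEnergy] at h
    rw [h, ENNReal.mul_top (ENNReal.ofReal_pos.2 h2).ne']
  rw [nonlocalEnergy, if_pos hmem, hK.energy_eq hm hp hp' hs2 hUm]
  gcongr
  exact farEnergy_le hUm (fun z => hK.lo_pos.le.trans (hK.lo_le_m z)) hK.m_le_up hP hs1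

theorem IsRegularKernel.inv_mul_localEnergy (hK : IsRegularKernel m' a' lo up)
    (ha : ∀ᵐ x, ∀ᵐ ω ∂(surfaceMeasure n), a x ω = a' (x, ω)) (hp : 1 ≤ p) (hp' : p ≠ ∞)
    (hΩ : MeasurableSet Ω) (u : Lp ℝ p (volume.restrict Ω)) {g : Eucl n → Eucl n}
    (hw : HasWeakGradient (Ω.indicator u) g) (hgm : Measurable g) (hg : MemLp g p volume) :
    p⁻¹ * localEnergy a Ω p u =
      ENNReal.ofReal (p.toReal⁻¹ * p.toReal⁻¹) * sphereEnergy a' p g := by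
  have hP := toReal_pos_of_one_le hp hp'
  have hmem : MemSobolevOneZero Ω p (Ω.indicator u) :=
    ⟨⟨memLp_indicator_Lp hΩ u, g, hw, hg⟩, ae_indicator_eq_zero _⟩
  have hm1 : Measurable fun z => ENNReal.ofReal (a' z) * ‖sphGrad g z‖ₑ ^ p.toReal :=
    hK.measurable_a.ennreal_ofReal.mul ((measurable_sphGrad hgm).enorm.pow_const _)
  have ha0 : ∀ z, 0 ≤ a' z := fun z => hK.lo_pos.le.trans (hK.lo_le_a z)
  have key : ∀ᵐ x, ENNReal.ofReal (localDensity a p x (weakGradient (Ω.indicator u) x)) =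
      ENNReal.ofReal p.toReal⁻¹ *
        ∫⁻ ω, ENNReal.ofReal (a' (x, ω)) * ‖sphGrad g (x, ω)‖ₑ ^ p.toReal ∂(surfaceMeasure n) := by
    filter_upwards [ha, hw.weakGradient_ae_eq] with x hx hgx
    have e1 : ∫ ω : USphere n, a x ω * |inner ℝ (g x) (ω : Eucl n)| ^ p.toReal
        ∂(surfaceMeasure n) = ∫ ω, a' (x, ω) * |sphGrad g (x, ω)| ^ p.toReal
        ∂(surfaceMeasure n) := by
      refine integral_congr_ae ?_
      filter_upwards [hx] with ω hω
      rw [hω]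
      rfl
    have hmx : Measurable fun ω => a' (x, ω) * |sphGrad g (x, ω)| ^ p.toReal :=
      (hK.measurable_a.mul ((measurable_sphGrad hgm).abs.pow_const _)).comp measurable_prodMk_left
    have hint : Integrable (fun ω => a' (x, ω) * |sphGrad g (x, ω)| ^ p.toReal)
        (surfaceMeasure n) := by
      refine Integrable.of_bound hmx.aestronglyMeasurable (up * ‖g x‖ ^ p.toReal)
        (Eventually.of_forall fun ω => ?_)
      have h1 : |sphGrad g (x, ω)| ≤ ‖g x‖ := by
        simpa [sphGrad] using abs_real_inner_le_norm (g x) (ω : Eucl n)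
      have h2 := ha0 (x, ω)
      rw [Real.norm_of_nonneg (by positivity)]
      have := hK.a_le_up (x, ω)
      have hup : 0 ≤ up := h2.trans this
      gcongr
    rw [hgx, localDensity, e1, ENNReal.ofReal_mul (by positivity), one_div,
      ofReal_integral_eq_lintegral_ofReal hint (Eventually.of_forall fun ω =>
        mul_nonneg (ha0 _) (by positivity))]
    congr 1
    exact lintegral_congr fun ω => ofReal_mul_abs_rpow (ha0 _) hP.le
  have hpinv : p⁻¹ = ENNReal.ofReal p.toReal⁻¹ := by
    rw [ENNReal.ofReal_inv_of_pos hP, ENNReal.ofReal_toReal hp']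
  rw [localEnergy, if_pos hmem, lintegral_congr_ae key, lintegral_const_mul _
    hm1.lintegral_prod_right', sphereEnergy, bundleMeasure, lintegral_prod _ hm1.aemeasurable,
    hpinv, ← mul_assoc, ENNReal.ofReal_mul (inv_nonneg.2 hP.le)]

end ZeroExtension

section Gamma

theorem gammaLiminf_le_gammaLimsup {ι X β : Type*} [TopologicalSpace X] [CompleteLattice β]
    (l : Filter ι) [l.NeBot] (F : ι → X → β) (x : X) : gammaLiminf l F x ≤ gammaLimsup l F x :=
  iSup₂_mono fun _ _ => liminf_le_limsup

theorem gammaLimsup_le_limsup {ι X β : Type*} [TopologicalSpace X] [CompleteLattice β]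
    (l : Filter ι) (F : ι → X → β) (x : X) : gammaLimsup l F x ≤ limsup (fun i => F i x) l :=
  iSup₂_le fun _ hU => limsup_le_limsup
    (Eventually.of_forall fun _ => iInf₂_le x (mem_of_mem_nhds hU))

/-- A finite `Γ`-lower limit is approached along some sequence of parameters and points. -/
theorem exists_seq_of_gammaLiminf_ne_top {X : Type*} [PseudoMetricSpace X] {F : ℝ → X → ℝ≥0∞}
    {x : X} (h : gammaLiminf (𝓝[<] (1 : ℝ)) F x ≠ ∞) :
    ∃ (s : ℕ → ℝ) (v : ℕ → X), (∀ k, s k < 1) ∧ Tendsto s atTop (𝓝 1) ∧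
      Tendsto v atTop (𝓝 x) ∧
      ∀ k, F (s k) (v k) ≤ gammaLiminf (𝓝[<] (1 : ℝ)) F x + ((k : ℝ≥0∞) + 1)⁻¹ := by
  set L := gammaLiminf (𝓝[<] (1 : ℝ)) F x with hL
  have hstep : ∀ k : ℕ, ∃ s : ℝ, ∃ v : X, s < 1 ∧ 1 - 1 / ((k : ℝ) + 1) < s ∧
      dist v x < 1 / ((k : ℝ) + 1) ∧ F s v ≤ L + ((k : ℝ≥0∞) + 1)⁻¹ := by
    intro k
    have hk : 0 < 1 / ((k : ℝ) + 1) := by positivity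
    have h1 : liminf (fun s => ⨅ y ∈ Metric.ball x (1 / ((k : ℝ) + 1)), F s y)
        (𝓝[<] (1 : ℝ)) ≤ L := by
      rw [hL, gammaLiminf]
      exact le_iSup₂ (f := fun U (_ : U ∈ 𝓝 x) => liminf (fun s => ⨅ y ∈ U, F s y) (𝓝[<] (1 : ℝ)))
        _ (Metric.ball_mem_nhds x hk)
    have h2 : L < L + ((k : ℝ≥0∞) + 1)⁻¹ := by
      refine ENNReal.lt_add_right h (ENNReal.inv_ne_zero.2 ?_)
      exact ENNReal.add_ne_top.2 ⟨ENNReal.natCast_ne_top k, ENNReal.one_ne_top⟩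
    have h3 := frequently_lt_of_liminf_lt (h := h1.trans_lt h2)
    have h4 : ∀ᶠ s in 𝓝[<] (1 : ℝ), s ∈ Ioo (1 - 1 / ((k : ℝ) + 1)) 1 :=
      Ioo_mem_nhdsLT (by linarith)
    obtain ⟨s, hs, hs2, hs1⟩ := (h3.and_eventually h4).exists
    obtain ⟨v, hv⟩ := iInf_lt_iff.1 hs
    obtain ⟨hvb, hv⟩ := iInf_lt_iff.1 hv
    exact ⟨s, v, hs1, hs2, hvb, hv.le⟩
  choose s v hs1 hs2 hv hF using hstep
  have h0 := tendsto_one_div_add_atTop_nhds_zero_nat (𝕜 := ℝ)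
  refine ⟨s, v, hs1, ?_, ?_, hF⟩
  · have h5 : Tendsto (fun k : ℕ => 1 - 1 / ((k : ℝ) + 1)) atTop (𝓝 1) := by
      simpa using tendsto_const_nhds.sub h0
    exact tendsto_of_tendsto_of_tendsto_of_le_of_le h5 tendsto_const_nhds
      (fun k => (hs2 k).le) fun k => (hs1 k).le
  · rw [tendsto_iff_dist_tendsto_zero]
    exact squeeze_zero (fun _ => dist_nonneg) (fun k => (hv k).le) h0

variable {n : ℕ} [NeZero n] {p : ℝ≥0∞} {Ω : Set (Eucl n)}
  {m : Eucl n → Eucl n → ℝ} {m' : Eucl n × Eucl n → ℝ} {a : Eucl n → USphere n → ℝ}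
  {a' : Eucl n × USphere n → ℝ} {lo up : ℝ}

theorem IsRegularKernel.inv_mul_localEnergy_le_gammaLiminf [Fact (1 ≤ p)]
    (hK : IsRegularKernel m' a' lo up) (hm : ∀ᵐ z : Eucl n × Eucl n, m z.1 z.2 = m' z)
    (ha : ∀ᵐ x, ∀ᵐ ω ∂(surfaceMeasure n), a x ω = a' (x, ω)) (hp : 1 < p) (hp' : p ≠ ∞)
    (hΩ : MeasurableSet Ω) (u : Lp ℝ p (volume.restrict Ω)) :
    p⁻¹ * localEnergy a Ω p u ≤ gammaLiminf (𝓝[<] (1 : ℝ)) (nonlocalEnergy m Ω p) u := by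
  rcases eq_or_ne (gammaLiminf (𝓝[<] (1 : ℝ)) (nonlocalEnergy m Ω p) u) ∞ with htop | hfin
  · rw [htop]; exact le_top
  have hP := toReal_pos_of_one_le hp.le hp'
  have hP1 : 1 < p.toReal := by
    simpa using (ENNReal.toReal_lt_toReal ENNReal.one_ne_top hp').2 hp
  have hpq0 := Real.HolderConjugate.conjExponent hP1
  set q : ℝ≥0∞ := ENNReal.ofReal p.toReal.conjExponent with hq
  have hpq : p.toReal.HolderConjugate q.toReal := by
    rw [hq, ENNReal.toReal_ofReal hpq0.symm.nonneg]
    exact hpq0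
  have hq' : q ≠ ∞ := ENNReal.ofReal_ne_top
  obtain ⟨s, v, hs1, hs, hv, hF⟩ := exists_seq_of_gammaLiminf_ne_top hfin
  set L := gammaLiminf (𝓝[<] (1 : ℝ)) (nonlocalEnergy m Ω p) u with hL
  set b : ℝ≥0∞ := ENNReal.ofReal (p.toReal⁻¹ * p.toReal⁻¹) with hb
  have hb0 : b ≠ 0 := (ENNReal.ofReal_pos.2 (by positivity)).ne'
  have hbtop : b ≠ ∞ := ENNReal.ofReal_ne_top
  have ht : ∀ k, 0 < p.toReal * (1 - s k) := fun k => mul_pos hP (by linarith [hs1 k])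
  have ht0 : Tendsto (fun k => p.toReal * (1 - s k)) atTop (𝓝 0) := by
    simpa using (hs.const_sub 1).const_mul p.toReal
  have hlim : Tendsto (fun k => eLpNorm (Ω.indicator (v k) - Ω.indicator u) p volume) atTop
      (𝓝 0) := by
    simp only [eLpNorm_indicator_Lp_sub hΩ]
    exact tendsto_iff_edist_tendsto_0.1 hv
  have hε : Tendsto (fun k : ℕ => ((k : ℝ≥0∞) + 1)⁻¹) atTop (𝓝 0) := by
    have := (tendsto_add_atTop_iff_nat 1).2 ENNReal.tendsto_inv_nat_nhds_zero
    simpa using this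
  have hc : Tendsto (fun k : ℕ => b⁻¹ * (L + ((k : ℝ≥0∞) + 1)⁻¹)) atTop (𝓝 (b⁻¹ * L)) := by
    refine ENNReal.Tendsto.const_mul ?_ (Or.inr (ENNReal.inv_ne_top.2 hb0))
    simpa using tendsto_const_nhds.add hε
  obtain ⟨g, hw, hgm, hg, hle⟩ := hK.sphereEnergy_le_of_tendsto hp' hq' hpq ht ht0
    (fun k => measurable_indicator_Lp hΩ (v k)) (measurable_indicator_Lp hΩ u)
    (fun k => memLp_indicator_Lp hΩ (v k)) (memLp_indicator_Lp hΩ u) hlim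
    (K := b⁻¹ * (L + 1)) (ENNReal.mul_ne_top (ENNReal.inv_ne_top.2 hb0)
      (ENNReal.add_ne_top.2 ⟨hfin, ENNReal.one_ne_top⟩))
    (fun k => by
      gcongr
      exact ENNReal.inv_le_one.2 le_add_self) hc
    (fun k => (ENNReal.mul_le_iff_le_inv hb0 hbtop).1
      ((hK.le_nonlocalEnergy hm hp.le hp' hΩ (hs1 k) (v k)).trans (hF k)))
  rw [hK.inv_mul_localEnergy ha hp.le hp' hΩ u hw hgm hg]
  exact (ENNReal.mul_le_iff_le_inv hb0 hbtop).2 hle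

theorem IsRegularKernel.limsup_nonlocalEnergy_le (hK : IsRegularKernel m' a' lo up)
    (hm : ∀ᵐ z : Eucl n × Eucl n, m z.1 z.2 = m' z)
    (ha : ∀ᵐ x, ∀ᵐ ω ∂(surfaceMeasure n), a x ω = a' (x, ω)) (hp : 1 ≤ p) (hp' : p ≠ ∞)
    (hΩ : MeasurableSet Ω) (u : Lp ℝ p (volume.restrict Ω)) :
    limsup (fun s => nonlocalEnergy m Ω p s u) (𝓝[<] (1 : ℝ)) ≤ p⁻¹ * localEnergy a Ω p u := by
  by_cases hmem : MemSobolevOneZero Ω p (Ω.indicator u)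
  swap
  · rw [localEnergy, if_neg hmem, ENNReal.mul_top (ENNReal.inv_ne_zero.2 hp')]
    exact le_top
  have hP := toReal_pos_of_one_le hp hp'
  obtain ⟨g, hw, hgm, hg⟩ := hmem.1.exists_measurable
  rw [hK.inv_mul_localEnergy ha hp hp' hΩ u hw hgm hg]
  obtain ⟨A, hA, hle⟩ := hK.exists_nonlocalEnergy_le hm hp hp' hΩ u
  have hev : ∀ᶠ s in 𝓝[<] (1 : ℝ), s ∈ Ioo (1 / 2 : ℝ) 1 := Ioo_mem_nhdsLT (by norm_num)
  have h1s : Tendsto (fun s : ℝ => 1 - s) (𝓝[<] (1 : ℝ)) (𝓝 0) := by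
    have : Tendsto (fun s : ℝ => 1 - s) (𝓝 1) (𝓝 (1 - 1)) := by
      exact (continuous_const.sub continuous_id).tendsto 1
    rw [sub_self] at this
    exact this.mono_left nhdsWithin_le_nhds
  set t : ℝ → ℝ := fun s => if s < 1 then p.toReal * (1 - s) else 1 with ht
  have htpos : ∀ s, 0 < t s := fun s => by
    simp only [ht]
    split_ifs with h
    · exact mul_pos hP (by linarith)
    · exact one_pos
  have ht0 : Tendsto t (𝓝[<] (1 : ℝ)) (𝓝 0) := by
    have h2 : Tendsto (fun s : ℝ => p.toReal * (1 - s)) (𝓝[<] (1 : ℝ)) (𝓝 0) := by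
      simpa using h1s.const_mul p.toReal
    refine h2.congr' ?_
    filter_upwards [hev] with s hs
    simp only [ht, if_pos hs.2]
  obtain ⟨e, he, hpe⟩ := hK.exists_pairEnergy_diffQuot_le htpos ht0 hp hp' hw
    (measurable_indicator_Lp hΩ u) hgm (memLp_indicator_Lp hΩ u) hg
  have hfar : Tendsto (fun s : ℝ => ENNReal.ofReal ((1 - s) / p.toReal) * A) (𝓝[<] (1 : ℝ))
      (𝓝 0) := by
    have h3 := ENNReal.tendsto_ofReal (h1s.div_const p.toReal)
    rw [zero_div, ENNReal.ofReal_zero] at h3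
    simpa using ENNReal.Tendsto.mul_const h3 (b := A) (Or.inr hA)
  have hlim : Tendsto (fun s : ℝ => ENNReal.ofReal (p.toReal⁻¹ * p.toReal⁻¹) * e s +
      ENNReal.ofReal ((1 - s) / p.toReal) * A) (𝓝[<] (1 : ℝ))
      (𝓝 (ENNReal.ofReal (p.toReal⁻¹ * p.toReal⁻¹) * sphereEnergy a' p g)) := by
    have h4 := (ENNReal.Tendsto.const_mul he (a := ENNReal.ofReal (p.toReal⁻¹ * p.toReal⁻¹))
      (Or.inr ENNReal.ofReal_ne_top)).add hfar
    rwa [add_zero] at h4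
  rw [← hlim.limsup_eq]
  refine limsup_le_limsup ?_
  filter_upwards [hev] with s hs
  refine (hle s hs.1.le hs.2).trans ?_
  gcongr
  have := hpe s
  simpa only [ht, if_pos hs.2] using this

end Gamma

theorem theorem5p1 {n : ℕ} (hn : 1 ≤ n) {p : ℝ≥0∞} [Fact (1 ≤ p)] (hp : 1 < p) (hp' : p ≠ ∞)
    {Ω : Set (Eucl n)} (hΩ : IsOpen Ω)
    {m : Eucl n → Eucl n → ℝ} {a : Eucl n → USphere n → ℝ}
    (hm : MemLp (fun z : Eucl n × Eucl n => m z.1 z.2) ∞ volume)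
    (hm1 : KernelBounded m) (hm2 : KernelSymmetric m) (hm3 : KernelRadialLimit m a) :
    GammaTendsto (𝓝[<] (1 : ℝ)) (nonlocalEnergy m Ω p)
      (fun u : Lp ℝ p (volume.restrict Ω) => p⁻¹ * localEnergy a Ω p u) := by
  have : NeZero n := ⟨by omega⟩
  obtain ⟨m', a', lo, up, hK, hmm, haa⟩ := exists_isRegularKernel hm.1 hm1 hm3
  intro u
  have h1 := hK.inv_mul_localEnergy_le_gammaLiminf hmm haa hp hp' hΩ.measurableSet u
  have h2 := (gammaLimsup_le_limsup (𝓝[<] (1 : ℝ)) (nonlocalEnergy m Ω p) u).trans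
    (hK.limsup_nonlocalEnergy_le hmm haa hp.le hp' hΩ.measurableSet u)
  have h3 := gammaLiminf_le_gammaLimsup (𝓝[<] (1 : ℝ)) (nonlocalEnergy m Ω p) u
  exact ⟨le_antisymm (h3.trans h2) h1, le_antisymm h2 (h1.trans h3)⟩
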